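/- **Setting.** For every sample size $n\ge 1$ let $p=p(n)$, $r=r(n)\ge 1$ be integers, $\epsilon=\epsilon(n)>0$, $\delta=\delta(n)\in(0,1/e)$, $b_n>0$, and let $\theta_0=\theta_0(n)\in\mathbb R^{p}$ satisfy $\|\theta_0\|_2=1$; put $S_0=\{j:\theta_{0,j}\ne0\}$, $s_0=|S_0|$. Let $\sigma>0$ be fixed and let $\mathcal D$ be a fixed probability distribution supported on $[-b,b]$ with mean $0$ and variance $1$. Let $X,\widetilde X\in\mathbb R^{n\times p}$ have i.i.d. entries from $\mathcal D$, let $\xi\in\mathbb R^n$ have i.i.d. entries distributed as $\mathcal N(0,\sigma^2)$ conditioned on $[-b_n,b_n]$, and let $R\in\mathbb R^{r\times(n+2p+1)}$ have i.i.d. $\mathcal N(0,1/r)$ entries, all independent. Assume $b_n=O(\sigma\sqrt{\log n})$, $b_n/\sigma-\sqrt{2\log(2n)}\to\infty$, and $p(n),r(n)\to\infty$ as $n\to\infty$. Let $y=X\theta_0+\xi$ and $$B=\sqrt{2pb^2+(b\sqrt{s_0}+b_n)^2},\quad w^2=\tfrac{4B^2}{\epsilon}\Big(\sqrt{2r\log(4/\delta)}+\log(4/\delta)\Big),\quad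 [X^*\ \widetilde X^*\ y^*]=R\begin{bmatrix}X\ \ \widetilde X\ \ y\\ wI_{2p+1}\end{bmatrix}.$$ With $d=2p$ and a constant $C_\lambda>0$ put $$\rho_n^2=\tfrac{n+r+1}{nr}+\tfrac{w^2}{nr},\quad \phi_w=1+\tfrac{w^2}{n},\quad \lambda=C_\lambda\sigma\max\Big\{\sqrt{\tfrac{\log d}{n}},\sqrt{\tfrac{(\log d)^3}{r}}\Big\},\quad \kappa_n=2\lambda\sqrt{s_0}+\tfrac{w^2}{n}.$$ Let $\widehat\theta^*$ be a minimizer over $\theta\in\mathbb R^{2p}$ of $\frac1{2n}\|[X^*\ \widetilde X^*]\theta-y^*\|_2^2+\lambda\|\theta\|_1$, and $\widehat\theta^u=\widehat\theta^*+\frac1n[X^*\ \widetilde X^*]^\top(y^*-[X^*\ \widetilde X^*]\widehat\theta^*)+\frac{w^2}{n}\widehat\theta^*$. The *debiasing conditions* are, as $n\to\infty$, 1. $\frac{\kappa_n^2}{\lambda^2\phi_w}=o\Big(\sqrt{\tfrac{n}{\log d}}\,\min\big\{1,\sqrt{\tfrac rn},\tfrac{\sqrt{rn}}{w^2}\big\}\Big)$;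 2. $\sqrt{s_0}=O\left(\frac{\max\{1/\sqrt n,\ \log d/\sqrt r\}}{\max\{w\log d/\sqrt{nr},\ (w^2/n)\sqrt{\log d/r}\}}\right)$; 3. $\frac{\sqrt{s_0}}{\sigma\rho_n}=o\Big(\min\big\{\tfrac n{w^2}\sqrt{\tfrac r{\log d}},\tfrac{\sqrt{nr}}{w\log d}\big\}\Big)$; 4. $\frac1{\sigma\rho_n}\frac{4\kappa_n^2}{\lambda\phi_w}=o\Big(\min\big\{\sqrt{\tfrac n{\log d}},\sqrt{\tfrac r{\log d}},\tfrac n{w^2}\sqrt{\tfrac r{\log d}},\tfrac{\sqrt{nr}}{w\log d}\big\}\Big)$. Let $f:\mathbb R^2\to\mathbb R_{\ge0}$, $(x,a)\mapsto f(x;a)$, be such that for some $L>0$ and every $a\in\mathbb R$: $f(\cdot;a)$ is $L$-Lipschitz; $kf(x;a)=f(kx;ka)$ for all $k>0$ and all $x$; $f(\cdot;a)$ is even, and non-decreasing on $[0,\infty)$; and there are $c_a,c_x>0$ (possibly depending on $a$) with $f(x;a)\ge c_ax$ for $x\ge c_x$. Put $W_j=f(\widehat\theta^u_j;\sigma\rho_n)-f(\widehat\theta^u_{j+p};\sigma\rho_n)$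 for $1\le j\le p$. For $t\in\mathbb R\cup\{+\infty\}$ let $\widehat S(t)=\{j:W_j\ge t\}$, $$\mathrm{FDP}(t)=\frac{|\widehat S(t)\setminus S_0|}{|\widehat S(t)|\vee1},\quad \mathrm{Power}(t)=\frac{|\widehat S(t)\cap S_0|}{s_0},\quad \widehat{\mathrm{FDP}}(t)=\frac{1+|\{j:W_j\le-t\}|}{|\{j:W_j\ge t\}|\vee1}.$$ **Statement.** There is an absolute constant $C_\lambda>0$ such that the following holds in every such setting. Assume the debiasing conditions, $s_0(n)/p(n)\to c_0$ for some $c_0\in(0,1)$, and $|\theta_{0,j}|\ge\mu_n$ for all $j\in S_0$, where $\mu_n>0$ and $\mu_n/(\sigma\rho_n)\to\infty$. Then: 1. For every $q\in(0,1)$, the data-dependent threshold $\widehat t_n=\min\{t\in\mathcal W:\widehat{\mathrm{FDP}}(t)\le q\}$, where $\mathcal W=\{|W_j|:j\le p\}\setminus\{0\}$ and $\widehat t_n=+\infty$ if the set is empty, satisfies (a) $\mathbb E[\mathrm{FDP}(\widehat t_n)]\le q$ for every $n\ge1$, and (b) $\mathrm{Power}(\widehat t_n)\to1$ in probability as $n\to\infty$.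 2. For every deterministic real sequence $(t_n)$ with $t_n/(\sigma\rho_n)\to\infty$ and $t_n/\mu_n\to0$, $\mathrm{FDP}(t_n)\to0$ and $\mathrm{Power}(t_n)\to1$ in probability as $n\to\infty$. -/

import Mathlib

open MeasureTheory ProbabilityTheory Filter Asymptotics
open scoped Topology

noncomputable section

namespace JLKnockoff

/-! ### Privatization, private Lasso and its debiased version -/

/-- Johnson–Lindenstrauss transform: append `w` times the identity below the data matrix `A`
and multiply from the left by the random matrix `R`. -/
def jlt {ι κ ρ : Type*} [Fintype ι] [Fintype κ] [DecidableEq κ]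
    (R : Matrix ρ (ι ⊕ κ) ℝ) (A : Matrix ι κ ℝ) (w : ℝ) : Matrix ρ κ ℝ :=
  R * Matrix.fromRows A (w • (1 : Matrix κ κ ℝ))

/-- Response `y = X θ₀ + ξ` of the linear model. -/
def response {n p : ℕ} (X : Matrix (Fin n) (Fin p) ℝ) (θ₀ : Fin p → ℝ) (ξ : Fin n → ℝ) :
    Fin n → ℝ :=
  X.mulVec θ₀ + ξ

/-- The data matrix `A = [X X̃ y]`. Original features are indexed by `inl (inl j)`, knockoffs by
`inl (inr j)`, the response by `inr ()`. -/
def dataMatrix {n p : ℕ} (X Xt : Matrix (Fin n) (Fin p) ℝ) (y : Fin n → ℝ) :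
    Matrix (Fin n) ((Fin p ⊕ Fin p) ⊕ Unit) ℝ :=
  Matrix.fromCols (Matrix.fromCols X Xt) (Matrix.replicateCol Unit y)

/-- Lasso objective `(1/(2n)) ‖M θ - y‖₂² + lam ‖θ‖₁`. The normalization `n` is the original
sample size, not the number of rows of `M`. -/
def lassoObjective {ρ κ : Type*} [Fintype ρ] [Fintype κ] (n : ℕ) (lam : ℝ)
    (M : Matrix ρ κ ℝ) (y : ρ → ℝ) (θ : κ → ℝ) : ℝ :=
  1 / (2 * (n : ℝ)) * ∑ i, (M.mulVec θ i - y i) ^ 2 + lam * ∑ k, |θ k|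

/-- `θ` is a Lasso solution, i.e. a global minimizer of the Lasso objective. -/
def IsLassoSolution {ρ κ : Type*} [Fintype ρ] [Fintype κ] (n : ℕ) (lam : ℝ)
    (M : Matrix ρ κ ℝ) (y : ρ → ℝ) (θ : κ → ℝ) : Prop :=
  ∀ θ' : κ → ℝ, lassoObjective n lam M y θ ≤ lassoObjective n lam M y θ'

/-- Debiased private Lasso `θ + (1/n) Mᵀ (y - M θ) + (w²/n) θ`. -/
def debiased {ρ κ : Type*} [Fintype ρ] [Fintype κ] (n : ℕ) (w : ℝ)
    (M : Matrix ρ κ ℝ) (y : ρ → ℝ) (θ : κ → ℝ) : κ → ℝ :=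
  θ + (1 / (n : ℝ)) • M.transpose.mulVec (y - M.mulVec θ) + (w ^ 2 / (n : ℝ)) • θ

/-! ### Feature statistics, knockoff threshold, FDP and power -/

/-- Conditions on the function `f(x; a)` (written `f x a`) that generates feature statistics. -/
structure IsFeatureFunction (f : ℝ → ℝ → ℝ) : Prop where
  nonneg : ∀ x a, 0 ≤ f x a
  lipschitz : ∃ L : NNReal, 0 < L ∧ ∀ a, LipschitzWith L (fun x => f x a)
  homogeneous : ∀ k x a, 0 < k → k * f x a = f (k * x) (k * a)
  even : ∀ x a, f x a = f (-x) a
  monotone : ∀ a, MonotoneOn (fun x => f x a) (Set.Ici 0)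
  linear_growth : ∀ a, ∃ ca cx : ℝ, 0 < ca ∧ 0 < cx ∧ ∀ x, cx ≤ x → ca * x ≤ f x a

/-- `W_j = f(u_j; a) - f(u_{j+p}; a)`. -/
def featureStat {p : ℕ} (f : ℝ → ℝ → ℝ) (a : ℝ) (u : Fin p ⊕ Fin p → ℝ) (j : Fin p) : ℝ :=
  f (u (Sum.inl j)) a - f (u (Sum.inr j)) a

/-- Estimated false discovery proportion at the threshold `t`. -/
def fdpHat {p : ℕ} (W : Fin p → ℝ) (t : ℝ) : ℝ :=
  (1 + ((Finset.univ.filter fun j => W j ≤ -t).card : ℝ)) /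
    max 1 ((Finset.univ.filter fun j => t ≤ W j).card : ℝ)

/-- Data-dependent knockoff threshold: the least `t` among the nonzero values `|W_j|` with
`fdpHat W t ≤ q`, and `⊤` (that is, `+∞`) if there is none. -/
def knockoffThreshold {p : ℕ} (q : ℝ) (W : Fin p → ℝ) : WithTop ℝ :=
  ((Finset.univ.image fun j => |W j|).filter fun t => t ≠ 0 ∧ fdpHat W t ≤ q).min

open Classical in
/-- Features selected at the (possibly infinite) threshold `t`. -/
def selected {p : ℕ} (W : Fin p → ℝ) (t : WithTop ℝ) : Finset (Fin p) :=
  Finset.univ.filter fun j => t ≤ (W j : WithTop ℝ)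

/-- `S₀`, the set of indices of nonzero coefficients. -/
def supp {p : ℕ} (θ₀ : Fin p → ℝ) : Finset (Fin p) :=
  Finset.univ.filter fun j => θ₀ j ≠ 0

/-- False discovery proportion at threshold `t`. -/
def FDP {p : ℕ} (θ₀ : Fin p → ℝ) (W : Fin p → ℝ) (t : WithTop ℝ) : ℝ :=
  ((selected W t \ supp θ₀).card : ℝ) / max 1 ((selected W t).card : ℝ)

/-- Power at threshold `t`. -/
def power {p : ℕ} (θ₀ : Fin p → ℝ) (W : Fin p → ℝ) (t : WithTop ℝ) : ℝ :=
  ((selected W t ∩ supp θ₀).card : ℝ) / ((supp θ₀).card : ℝ)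

/-! ### The asymptotic setting -/

/-- Deterministic data of the problem; all sequences are indexed by the sample size `n`. -/
structure Setting where
  /-- noise level before truncation -/
  σ : ℝ
  /-- bound on the entries of the design -/
  b : ℝ
  /-- distribution of the entries of the design -/
  D : Measure ℝ
  /-- number of features -/
  p : ℕ → ℕ
  /-- number of rows of the projection matrix -/
  r : ℕ → ℕ
  /-- first privacy parameter -/
  ε : ℕ → ℝ
  /-- second privacy parameter -/
  δ : ℕ → ℝ
  /-- truncation level of the noise -/
  bn : ℕ → ℝ
  /-- true regression coefficients -/
  θ₀ : ∀ n, Fin (p n) → ℝ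

namespace Setting

variable (S : Setting)

/-- Sparsity level. -/
def s₀ (n : ℕ) : ℕ := (supp (S.θ₀ n)).card

/-- Number of columns of `[X X̃]`, as a real number. -/
def d (n : ℕ) : ℝ := 2 * (S.p n : ℝ)

/-- Bound on the `ℓ²` norm of the rows of `[X X̃ y]`. -/
def B (n : ℕ) : ℝ :=
  √(2 * (S.p n : ℝ) * S.b ^ 2 + (S.b * √(S.s₀ n : ℝ) + S.bn n) ^ 2)

/-- Privacy parameter `w`. -/
def w (n : ℕ) : ℝ :=
  √(4 * S.B n ^ 2 / S.ε n *
    (√(2 * (S.r n : ℝ) * Real.log (4 / S.δ n)) + Real.log (4 / S.δ n)))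

/-- `ρ_n`. -/
def ρ (n : ℕ) : ℝ :=
  √(((n : ℝ) + S.r n + 1) / (n * S.r n) + S.w n ^ 2 / (n * S.r n))

/-- Regularization parameter, with multiplicative constant `C`. -/
def lam (C : ℝ) (n : ℕ) : ℝ :=
  C * S.σ * max √(Real.log (S.d n) / n) √(Real.log (S.d n) ^ 3 / S.r n)

/-- `φ_w = 1 + w²/n`. -/
def φ (n : ℕ) : ℝ := 1 + S.w n ^ 2 / n

/-- `κ_n = 2 lam √s₀ + w²/n`. -/
def κ (C : ℝ) (n : ℕ) : ℝ := 2 * S.lam C n * √(S.s₀ n : ℝ) + S.w n ^ 2 / n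

/-- Law of a single noise variable: `N(0, σ²)` conditioned on `[-b_n, b_n]`. -/
def noiseLaw (n : ℕ) : Measure ℝ :=
  (gaussianReal 0 (Real.toNNReal (S.σ ^ 2)))[|Set.Icc (-S.bn n) (S.bn n)]

/-- Law of a single entry of the projection matrix: `N(0, 1/r)`. -/
def projLaw (n : ℕ) : Measure ℝ := gaussianReal 0 (1 / (S.r n : NNReal))

/-- Standing assumptions on the parameters of the model. -/
structure Standing : Prop where
  σ_pos : 0 < S.σ
  D_prob : IsProbabilityMeasure S.D
  D_bdd : ∀ᵐ x ∂S.D, |x| ≤ S.b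
  D_mean : ∫ x, x ∂S.D = 0
  D_var : variance id S.D = 1
  bn_pos : ∀ n, 0 < S.bn n
  bn_upper : S.bn =O[atTop] fun n => S.σ * √(Real.log n)
  bn_lower : Tendsto (fun n => S.bn n / S.σ - √(2 * Real.log (2 * n))) atTop atTop
  θ₀_norm : ∀ n, ∑ j, S.θ₀ n j ^ 2 = 1
  r_pos : ∀ n, 0 < S.r n
  ε_pos : ∀ n, 0 < S.ε n
  δ_pos : ∀ n, 0 < S.δ n
  δ_lt : ∀ n, S.δ n < Real.exp (-1)
  p_tendsto : Tendsto S.p atTop atTop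
  r_tendsto : Tendsto S.r atTop atTop

/-- The four growth conditions for debiasing, for a design with `d = 2p` columns. -/
structure Debiasing (C : ℝ) : Prop where
  compatibility :
    (fun n => S.κ C n ^ 2 / (S.lam C n ^ 2 * S.φ n)) =o[atTop] fun n =>
      √((n : ℝ) / Real.log (S.d n)) *
        min 1 (min √((S.r n : ℝ) / n) (√((S.r n : ℝ) * n) / S.w n ^ 2))
  regularization :
    (fun n => √(S.s₀ n : ℝ)) =O[atTop] fun n =>
      max (1 / √(n : ℝ)) (Real.log (S.d n) / √(S.r n : ℝ)) /
        max (S.w n * Real.log (S.d n) / √((n : ℝ) * S.r n))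
          (S.w n ^ 2 / n * √(Real.log (S.d n) / S.r n))
  sparsity :
    (fun n => 1 / (S.σ * S.ρ n) * √(S.s₀ n : ℝ)) =o[atTop] fun n =>
      min ((n : ℝ) / S.w n ^ 2 * √((S.r n : ℝ) / Real.log (S.d n)))
        (√((n : ℝ) * S.r n) / (S.w n * Real.log (S.d n)))
  error :
    (fun n => 1 / (S.σ * S.ρ n) * (4 * S.κ C n ^ 2 / (S.lam C n * S.φ n))) =o[atTop] fun n =>
      min (min √((n : ℝ) / Real.log (S.d n)) √((S.r n : ℝ) / Real.log (S.d n)))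
        (min ((n : ℝ) / S.w n ^ 2 * √((S.r n : ℝ) / Real.log (S.d n)))
          (√((n : ℝ) * S.r n) / (S.w n * Real.log (S.d n))))

end Setting

/-- The random objects at sample size `n`: design, knockoffs, noise, projection matrix and
private Lasso estimate. -/
structure Sample (S : Setting) (n : ℕ) (Ω : Type*) where
  X : Ω → Matrix (Fin n) (Fin (S.p n)) ℝ
  Xt : Ω → Matrix (Fin n) (Fin (S.p n)) ℝ
  ξ : Ω → Fin n → ℝ
  R : Ω → Matrix (Fin (S.r n)) (Fin n ⊕ ((Fin (S.p n) ⊕ Fin (S.p n)) ⊕ Unit)) ℝ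
  θhat : Ω → Fin (S.p n) ⊕ Fin (S.p n) → ℝ

namespace Sample

variable {S : Setting} {n : ℕ} {Ω : Type*} (T : Sample S n Ω)

/-- All scalar random inputs of the procedure as one family: the entries of `[X X̃]`, of `ξ` and
of `R`. -/
def entries :
    (Fin n × (Fin (S.p n) ⊕ Fin (S.p n))) ⊕ Fin n ⊕
      (Fin (S.r n) × (Fin n ⊕ ((Fin (S.p n) ⊕ Fin (S.p n)) ⊕ Unit))) → Ω → ℝ
  | Sum.inl (i, k) => fun ω => Matrix.fromCols (T.X ω) (T.Xt ω) i k
  | Sum.inr (Sum.inl i) => fun ω => T.ξ ω i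
  | Sum.inr (Sum.inr (i, k)) => fun ω => T.R ω i k

/-- The privatized data matrix `A* = [X* X̃* y*]`. -/
def Astar (ω : Ω) : Matrix (Fin (S.r n)) ((Fin (S.p n) ⊕ Fin (S.p n)) ⊕ Unit) ℝ :=
  jlt (T.R ω) (dataMatrix (T.X ω) (T.Xt ω) (response (T.X ω) (S.θ₀ n) (T.ξ ω))) (S.w n)

/-- `[X* X̃*]`. -/
def Xstar (ω : Ω) : Matrix (Fin (S.r n)) (Fin (S.p n) ⊕ Fin (S.p n)) ℝ :=
  (T.Astar ω).toCols₁

/-- `y*`. -/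
def ystar (ω : Ω) : Fin (S.r n) → ℝ := fun i => T.Astar ω i (Sum.inr ())

/-- The random objects have the laws of the model, are jointly independent, and `θhat` is
(a measurable version of) the private Lasso estimate with regularization constant `C`. -/
structure IsModel [MeasurableSpace Ω] (C : ℝ) (P : Measure Ω) : Prop where
  indep : iIndepFun T.entries P
  law_X : ∀ i j, HasLaw (fun ω => T.X ω i j) S.D P
  law_Xt : ∀ i j, HasLaw (fun ω => T.Xt ω i j) S.D P
  law_ξ : ∀ i, HasLaw (fun ω => T.ξ ω i) (S.noiseLaw n) P
  law_R : ∀ i k, HasLaw (fun ω => T.R ω i k) (S.projLaw n) P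
  θhat_measurable : Measurable T.θhat
  θhat_lasso : ∀ᵐ ω ∂P, IsLassoSolution n (S.lam C n) (T.Xstar ω) (T.ystar ω) (T.θhat ω)

/-- Feature statistics `W_j` built from the debiased private Lasso, with scale `a = σ ρ_n`. -/
def W (f : ℝ → ℝ → ℝ) (ω : Ω) : Fin (S.p n) → ℝ :=
  featureStat f (S.σ * S.ρ n) (debiased n (S.w n) (T.Xstar ω) (T.ystar ω) (T.θhat ω))

end Sample

/-- Convergence in probability to a constant, for random variables that may live on different
probability spaces. -/
def TendstoInProb {Ω : ℕ → Type*} [∀ n, MeasurableSpace (Ω n)] (P : ∀ n, Measure (Ω n))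
    (Y : ∀ n, Ω n → ℝ) (c : ℝ) : Prop :=
  ∀ η : ℝ, 0 < η → Tendsto (fun n => P n {ω | η ≤ |Y n ω - c|}) atTop (𝓝 0)

end JLKnockoff

end

noncomputable section

namespace JLKnockoff

/-! ### Zero sets of polynomials -/

/-! The finite-sample FDR bound comes from a symmetry, the limits come from second moments, and the
two arguments are independent.

FDR. If `θ₀ j = 0`, exchanging feature `j` with its knockoff is a permutation of the i.i.d. inputs:
it exchanges two columns of the design together with the two columns of `R` that meet the block `w
I`. The joint law is unchanged, `y*` is unchanged, and two columns of `[X* X̃*]` are exchanged. To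
carry the symmetry over to the Lasso estimate, the solution has to be unique. It is, almost surely:
`[X* X̃*]` is a Gaussian matrix times a matrix of full column rank, hence in general position
because nonzero polynomials vanish on null sets only. So flipping the sign of `W j` preserves the
law of `W` (`Sample.IsModel.map_flipSign_W`). Invariance under these single flips suffices for the
knockoff filter (`knockoff_fdr_control`): the FDP is at most `q` times a sum of terms `nullRatio`,
the `j`-th of which may be evaluated at the `j`-th flip of `W` without changing its expectation, and
the sum of the flipped terms is at most 1 pointwise.

Limits. Since `s₀ / p → c₀ > 0`, errors in a small proportion of the coordinates are harmless, so no
coordinatewise limit law is needed: it is enough that the squared `ℓ²` error of the debiased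
estimate is of order `p ρ²` in probability (`Setting.Debiasing.debiasedError_tight`). That error is
`gramError` applied to the Lasso error, plus `noiseTerm`. Mean squares of both are computed by
integrating out `R` first, then design and noise. Because `s₀` is comparable to `p`, the
compatibility condition makes the Frobenius norm of the Gram error small relative to `φ`. The Lasso
problem is then strongly convex, a crude `ℓ²` bound without any use of sparsity holds, and the error
condition brings its product with the Gram error down to `√p ρ`.

By Markov, all but `β p` features then have both coordinates within a multiple of `σ ρ` of the
truth. Outside these exceptions a null has `|W j|` of order `σ ρ`, a signal has `W j` of order at
least `μ`, and any `t` between the two scales separates them (`Separates`). Small FDP, power near 1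
and a small estimated FDP at `t` follow by counting. For the data-dependent threshold, `t` is the
geometric mean of the two scales. Its estimated FDP is eventually below `q`, so the knockoff
threshold selects at least as much as `t` does. -/

theorem ae_eval_ne_zero_fin (ν : Measure ℝ) [SigmaFinite ν] [NullSingletonClass ν] (n : ℕ)
    (q : MvPolynomial (Fin n) ℝ) (hq : q ≠ 0) :
    ∀ᵐ x ∂(Measure.pi fun _ : Fin n => ν), MvPolynomial.eval x q ≠ 0 := by
  induction n with
  | zero =>
    refine ae_of_all _ fun x h => hq ?_
    obtain ⟨c, rfl⟩ := MvPolynomial.C_surjective (R := ℝ) (Fin 0) q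
    simp only [MvPolynomial.eval_C] at h
    simp [h]
  | succ n ih =>
    have hmp := measurePreserving_piFinSuccAbove (fun _ : Fin (n + 1) => ν) 0
    set Q := MvPolynomial.finSuccEquiv ℝ n q with hQ
    have hQ0 : Q ≠ 0 := by
      rw [hQ]; exact (map_ne_zero_iff _ (MvPolynomial.finSuccEquiv ℝ n).injective).2 hq
    -- Read `q` as a polynomial in the first variable. Where its leading coefficient does not vanish
    -- at the tail, only finitely many values of the first coordinate are roots, and an atomless law
    -- gives them mass zero; Fubini concludes.
    have hlead := ih Q.leadingCoeff (by simpa using hQ0)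
    have hms : MeasurableSet {z : ℝ × (Fin n → ℝ) |
        MvPolynomial.eval (Fin.cons z.1 z.2 : Fin (n + 1) → ℝ) q ≠ 0} := by
      refine (measurableSet_singleton (0 : ℝ)).compl.preimage
        ((MvPolynomial.continuous_eval q).measurable.comp ?_)
      refine measurable_pi_lambda _ fun i => ?_
      refine Fin.cases ?_ (fun j => ?_) i
      · simpa using measurable_fst
      · simp only [Fin.cons_succ]; fun_prop
    have key : ∀ᵐ z ∂(ν.prod (Measure.pi fun _ : Fin n => ν)),
        MvPolynomial.eval (Fin.cons z.1 z.2 : Fin (n + 1) → ℝ) q ≠ 0 := by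
      rw [Measure.ae_prod_iff_ae_ae hms, Measure.ae_ae_comm hms]
      filter_upwards [hlead] with x hx
      have hne : Polynomial.map (MvPolynomial.eval x) Q ≠ 0 := by
        intro h0
        apply hx
        have := congrArg (fun P => Polynomial.coeff P Q.natDegree) h0
        simpa using this
      have hfin : {y : ℝ | Polynomial.IsRoot (Polynomial.map (MvPolynomial.eval x) Q) y}.Finite :=
        Polynomial.finite_setOfPred_isRoot hne
      rw [ae_iff]
      refine measure_mono_null (fun y hy => ?_) (hfin.measure_zero ν)
      simp only [not_not, Set.mem_ofPred_eq] at hy ⊢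
      rw [MvPolynomial.eval_eq_eval_mv_eval'] at hy
      exact hy
    have := hmp.quasiMeasurePreserving.ae key
    filter_upwards [this] with x hx
    have hx' : (Fin.cons (x 0) (fun j => x (Fin.succ j)) : Fin (n + 1) → ℝ) = x :=
      Fin.cons_self_tail x
    simpa [MeasurableEquiv.piFinSuccAbove, Fin.insertNthEquiv, Fin.removeNth, hx'] using hx

/-- A nonzero polynomial is almost surely nonzero at a point with i.i.d. atomless coordinates. -/
theorem ae_eval_ne_zero {τ : Type*} [Fintype τ] (ν : Measure ℝ) [SigmaFinite ν]
    [NullSingletonClass ν] (q : MvPolynomial τ ℝ) (hq : q ≠ 0) :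
    ∀ᵐ x ∂(Measure.pi fun _ : τ => ν), MvPolynomial.eval x q ≠ 0 := by
  let e := Fintype.equivFin τ
  have hmp := measurePreserving_arrowCongr' (fun _ : τ => ν)
    (fun _ : Fin (Fintype.card τ) => ν) e (MeasurableEquiv.refl ℝ)
    (fun _ => MeasurePreserving.id _)
  have h0 : MvPolynomial.rename e q ≠ 0 :=
    (map_ne_zero_iff _ (MvPolynomial.rename_injective e e.injective)).2 hq
  have := hmp.quasiMeasurePreserving.ae (ae_eval_ne_zero_fin ν _ _ h0)
  filter_upwards [this] with x hx
  rw [MvPolynomial.eval_rename] at hx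
  have hcomp : (MeasurableEquiv.arrowCongr' e (MeasurableEquiv.refl ℝ)) x ∘ e = x := by
    ext i
    simp [MeasurableEquiv.arrowCongr', Equiv.arrowCongr']
  rwa [hcomp] at hx

/-! ### Uniqueness of the Lasso solution for designs in general position -/

section Lasso

variable {ρ κ : Type*} [Fintype ρ] [Fintype κ]

/-- Exact expansion around `θ`, since the fit is quadratic. It serves uniqueness of the fitted
values, the stationarity condition, and the basic inequality behind the `ℓ²` error bound. -/
theorem lassoObjective_add (n : ℕ) (lam : ℝ) (M : Matrix ρ κ ℝ) (y : ρ → ℝ) (θ v : κ → ℝ) :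
    lassoObjective n lam M y (θ + v) = lassoObjective n lam M y θ
      + 1 / (2 * (n : ℝ)) * ∑ i, M.mulVec v i ^ 2
      - 1 / (n : ℝ) * ∑ i, M.mulVec v i * (y - M.mulVec θ) i
      + lam * ∑ k, (|θ k + v k| - |θ k|) := by
  have h : ∑ i, (M.mulVec (θ + v) i - y i) ^ 2 = ∑ i, (M.mulVec θ i - y i) ^ 2
      + ∑ i, M.mulVec v i ^ 2 - 2 * ∑ i, M.mulVec v i * (y - M.mulVec θ) i := by
    rw [Finset.mul_sum, ← Finset.sum_add_distrib, ← Finset.sum_sub_distrib]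
    refine Finset.sum_congr rfl fun i _ => ?_
    simp only [Matrix.mulVec_add, Pi.add_apply, Pi.sub_apply]
    ring
  simp only [lassoObjective, h, Finset.sum_sub_distrib, Pi.add_apply]
  ring

/-- All Lasso solutions have the same fitted values. -/
theorem IsLassoSolution.mulVec_eq {n : ℕ} (hn : 0 < n) {lam : ℝ} (hlam : 0 ≤ lam)
    {M : Matrix ρ κ ℝ} {y : ρ → ℝ} {θ θ' : κ → ℝ} (h : IsLassoSolution n lam M y θ)
    (h' : IsLassoSolution n lam M y θ') : M.mulVec θ = M.mulVec θ' := by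
  set v := θ' - θ with hv
  have e1 := lassoObjective_add n lam M y θ v
  -- At the midpoint the quadratic term carries the factor 1/4 instead of 1/2, so if the fits
  -- differed the midpoint would strictly beat both minimizers.
  have e2 := lassoObjective_add n lam M y θ ((1 / 2 : ℝ) • v)
  have hθ' : θ + v = θ' := by simp [hv]
  rw [hθ'] at e1
  have i1 := h' θ
  have i2 := h (θ + (1 / 2 : ℝ) • v)
  have hn' : (0 : ℝ) < n := by exact_mod_cast hn
  have s1 : ∑ i, M.mulVec ((1 / 2 : ℝ) • v) i ^ 2 = 1 / 4 * ∑ i, M.mulVec v i ^ 2 := by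
    rw [Finset.mul_sum]
    refine Finset.sum_congr rfl fun i _ => ?_
    simp only [Matrix.mulVec_smul, Pi.smul_apply, smul_eq_mul]; ring
  have s2 : ∑ i, M.mulVec ((1 / 2 : ℝ) • v) i * (y - M.mulVec θ) i
      = 1 / 2 * ∑ i, M.mulVec v i * (y - M.mulVec θ) i := by
    rw [Finset.mul_sum]
    refine Finset.sum_congr rfl fun i _ => ?_
    simp only [Matrix.mulVec_smul, Pi.smul_apply, smul_eq_mul]; ring
  have s3 : ∑ k, (|θ k + ((1 / 2 : ℝ) • v) k| - |θ k|)
      ≤ 1 / 2 * ∑ k, (|θ k + v k| - |θ k|) := by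
    rw [Finset.mul_sum]
    refine Finset.sum_le_sum fun k _ => ?_
    simp only [Pi.smul_apply, smul_eq_mul]
    have := abs_add_le (θ k + v k) (θ k)
    have h2 : |θ k + v k + θ k| = 2 * |θ k + 1 / 2 * v k| := by
      rw [show θ k + v k + θ k = 2 * (θ k + 1 / 2 * v k) by ring, abs_mul, abs_two]
    linarith
  rw [s1, s2] at e2
  have s4 := mul_le_mul_of_nonneg_left s3 hlam
  set Q := ∑ i, M.mulVec v i ^ 2 with hQ
  have hQ0 : 0 ≤ Q := Finset.sum_nonneg fun i _ => sq_nonneg _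
  have hQ1 : 1 / (2 * (n : ℝ)) * Q ≤ 0 := by nlinarith
  have hQ2 : Q = 0 := by
    refine le_antisymm ?_ hQ0
    by_contra! hc
    have : 0 < 1 / (2 * (n : ℝ)) * Q := by positivity
    linarith
  rw [hQ, Finset.sum_eq_zero_iff_of_nonneg (fun i _ => sq_nonneg _)] at hQ2
  ext i
  have := pow_eq_zero_iff two_ne_zero |>.1 (hQ2 i (Finset.mem_univ i))
  rw [hv, Matrix.mulVec_sub, Pi.sub_apply] at this
  linarith

theorem eq_zero_of_forall_small_nonneg {c A ε : ℝ} (hε : 0 < ε)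
    (h : ∀ t : ℝ, |t| < ε → 0 ≤ t * c + t ^ 2 * A) : c = 0 := by
  have hmin : IsLocalMin (fun t : ℝ => t * c + t ^ 2 * A) 0 := by
    filter_upwards [Metric.ball_mem_nhds (0 : ℝ) hε] with t ht
    simpa using h t (by simpa using ht)
  have hd : HasDerivAt (fun t : ℝ => t * c + t ^ 2 * A) (1 * c + (2 * 0) * A) 0 := by
    convert! ((hasDerivAt_id (0 : ℝ)).mul_const c).add
      (((hasDerivAt_id (0 : ℝ)).pow 2).mul_const A) using 1
    simp
  simpa using hmin.hasDerivAt_eq_zero hd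

/-- Active coefficients of a Lasso solution have maximal correlation with the residual. -/
theorem IsLassoSolution.abs_corr_eq [DecidableEq κ] {n : ℕ} (hn : 0 < n) {lam : ℝ} (hlam : 0 ≤ lam)
    {M : Matrix ρ κ ℝ} {y : ρ → ℝ} {θ : κ → ℝ} (h : IsLassoSolution n lam M y θ)
    {j : κ} (hj : θ j ≠ 0) :
    |∑ i, M i j * (y - M.mulVec θ) i| = n * lam := by
  have hn' : (0 : ℝ) < n := by exact_mod_cast hn
  set z := ∑ i, M i j * (y - M.mulVec θ) i with hz
  set sg : ℝ := (SignType.sign (θ j) : ℝ) with hsg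
  have habs : |sg| = 1 := by
    rcases lt_or_gt_of_ne hj with h0 | h0 <;> simp [hsg, h0]
  have hc : lam * sg - 1 / n * z = 0 := by
    -- A perturbation smaller than `|θ j|` keeps the sign of the coordinate, so the penalty is
    -- linear in `t` and the objective changes by exactly a linear plus a quadratic term.
    refine eq_zero_of_forall_small_nonneg (A := 1 / (2 * (n : ℝ)) * ∑ i, M i j ^ 2)
      (abs_pos.2 hj) fun t ht => ?_
    have e := lassoObjective_add n lam M y θ (Pi.single j t)
    have i := h (θ + Pi.single j t)
    have m : ∀ i, M.mulVec (Pi.single j t) i = t * M i j := by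
      intro i; simp [Matrix.mulVec_single, mul_comm]
    have s1 : ∑ i, M.mulVec (Pi.single j t) i ^ 2 = t ^ 2 * ∑ i, M i j ^ 2 := by
      rw [Finset.mul_sum]; refine Finset.sum_congr rfl fun i _ => ?_
      rw [m]; ring
    have s2 : ∑ i, M.mulVec (Pi.single j t) i * (y - M.mulVec θ) i = t * z := by
      rw [hz, Finset.mul_sum]; refine Finset.sum_congr rfl fun i _ => ?_
      rw [m]; ring
    have s3 : ∑ k, (|θ k + (Pi.single j t : κ → ℝ) k| - |θ k|) = t * sg := by
      rw [Finset.sum_eq_single j]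
      · rw [Pi.single_eq_same, hsg]
        have := abs_lt.1 ht
        rcases lt_or_gt_of_ne hj with h0 | h0
        · rw [abs_of_neg h0] at this
          rw [abs_of_neg h0, abs_of_neg (by linarith), sign_neg h0]; simp
        · rw [abs_of_pos h0] at this
          rw [abs_of_pos h0, abs_of_pos (by linarith), sign_pos h0]; simp
      · intro k _ hk; simp [hk]
      · simp
    rw [s1, s2, s3] at e
    linarith
  have : z = n * lam * sg := by
    field_simp at hc
    linarith
  rw [this, abs_mul, habs, mul_one, abs_of_nonneg (by positivity)]

/-- The design with an additional row of signs. -/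
def augment (M : Matrix ρ κ ℝ) (s : κ → ℤˣ) : Matrix (ρ ⊕ Unit) κ ℝ :=
  Matrix.fromRows M (Matrix.replicateRow Unit fun j => (((s j : ℤ)) : ℝ))

/-- Up to `|ρ| + 1` columns of the design, augmented by arbitrary signs, are linearly independent;
expressed through Gram determinants. -/
def GeneralPosition [DecidableEq κ] (M : Matrix ρ κ ℝ) : Prop :=
  ∀ (s : κ → ℤˣ) (F : Finset κ), F.card ≤ Fintype.card ρ + 1 →
    (((augment M s).submatrix id ((↑) : F → κ)).transpose *
      (augment M s).submatrix id ((↑) : F → κ)).det ≠ 0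

theorem eq_zero_of_gram_det_ne_zero {ι F : Type*} [Fintype ι] [Fintype F] [DecidableEq F]
    {N : Matrix ι F ℝ} (h : (N.transpose * N).det ≠ 0) {c : F → ℝ} (hc : N.mulVec c = 0) :
    c = 0 :=
  Matrix.eq_zero_of_mulVec_eq_zero h (by rw [← Matrix.mulVec_mulVec, hc, Matrix.mulVec_zero])

/-- As many independent columns as rows span the whole space, so a vector orthogonal to all of them
is orthogonal to itself. -/
theorem eq_zero_of_vecMul_eq_zero_of_card {ι F : Type*} [Fintype ι] [Fintype F] [DecidableEq F]
    {N : Matrix ι F ℝ} (h : (N.transpose * N).det ≠ 0) (hcard : Fintype.card F = Fintype.card ι)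
    {v : ι → ℝ} (hv : ∀ j, ∑ i, N i j * v i = 0) : v = 0 := by
  have hinj : Function.Injective N.mulVecLin := by
    rw [← LinearMap.ker_eq_bot, LinearMap.ker_eq_bot']
    intro c hc
    exact eq_zero_of_gram_det_ne_zero h hc
  have hsurj := (LinearMap.injective_iff_surjective_of_finrank_eq_finrank
    (by simp [hcard])).1 hinj
  obtain ⟨c, hc⟩ := hsurj v
  have : ∑ i, v i * v i = 0 := by
    calc ∑ i, v i * v i = ∑ i, (∑ j, N i j * c j) * v i := by
          refine Finset.sum_congr rfl fun i _ => ?_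
          rw [← hc]; simp [Matrix.mulVec, dotProduct]
      _ = ∑ j, c j * ∑ i, N i j * v i := by
          simp_rw [Finset.sum_mul, Finset.mul_sum]
          rw [Finset.sum_comm]
          exact Finset.sum_congr rfl fun j _ => Finset.sum_congr rfl fun i _ => by ring
      _ = 0 := by simp [hv]
  rw [Finset.sum_eq_zero_iff_of_nonneg (fun i _ => mul_self_nonneg _)] at this
  ext i
  simpa using this i (Finset.mem_univ i)

/-- For a design in general position the Lasso solution is unique. -/
theorem GeneralPosition.lasso_unique [DecidableEq κ] {n : ℕ} (hn : 0 < n) {lam : ℝ}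
    (hlam : 0 < lam) {M : Matrix ρ κ ℝ} (hM : GeneralPosition M) {y : ρ → ℝ} {θ θ' : κ → ℝ}
    (h : IsLassoSolution n lam M y θ) (h' : IsLassoSolution n lam M y θ') : θ = θ' := by
  classical
  have hfit := h.mulVec_eq hn hlam.le h'
  have hn' : (0 : ℝ) < n := by exact_mod_cast hn
  -- Residual scaled so that every active column has correlation `±1` with it. By `mulVec_eq` it is
  -- the same for both solutions, and so is the equicorrelation set `E`, which contains both
  -- supports.
  set u : ρ → ℝ := fun i => (y - M.mulVec θ) i / (n * lam) with hu
  have hnl : (0 : ℝ) < n * lam := by positivity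
  have hz : ∀ j, ∑ i, M i j * u i = (∑ i, M i j * (y - M.mulVec θ) i) / (n * lam) := by
    intro j
    rw [Finset.sum_div]
    exact Finset.sum_congr rfl fun i _ => by rw [hu]; ring
  set s : κ → ℤˣ := fun j => if 0 ≤ ∑ i, M i j * u i then 1 else -1 with hs
  set E : Finset κ := Finset.univ.filter fun j => |∑ i, M i j * u i| = 1 with hE
  have hsE : ∀ j ∈ E, ∑ i, M i j * u i = ((s j : ℤ) : ℝ) := by
    intro j hj
    rw [hE, Finset.mem_filter] at hj
    by_cases h0 : 0 ≤ ∑ i, M i j * u i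
    · rw [hs]; simp only [h0, if_true]; rw [abs_of_nonneg h0] at hj; simpa using hj.2
    · rw [hs]; simp only [h0, if_false]
      rw [abs_of_neg (not_le.1 h0)] at hj
      push_cast; linarith [hj.2]
  have hmem : ∀ j, θ j ≠ 0 ∨ θ' j ≠ 0 → j ∈ E := by
    intro j hj
    rw [hE, Finset.mem_filter]
    refine ⟨Finset.mem_univ _, ?_⟩
    rw [hz, abs_div, abs_of_pos hnl]
    rcases hj with hj | hj
    · rw [h.abs_corr_eq hn hlam.le hj, div_self hnl.ne']
    · rw [hfit, h'.abs_corr_eq hn hlam.le hj, div_self hnl.ne']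
  -- Otherwise `|ρ| + 1` columns of the augmented design indexed in `E` form an invertible square
  -- matrix, yet all of them are orthogonal to `(u, -1)`, whose last entry is not zero.
  have hcard : E.card ≤ Fintype.card ρ + 1 := by
    by_contra hlt
    obtain ⟨F, hFE, hF⟩ := Finset.exists_subset_card_eq (le_of_not_ge hlt)
    have hg := hM s F hF.le
    have hv := eq_zero_of_vecMul_eq_zero_of_card hg (by simp [hF])
      (v := Sum.elim u fun _ => -1) (by
        intro j
        simp [augment, hsE j (hFE j.2)])
    have := congrFun hv (Sum.inr ())
    simp at this
  have hg := hM s E hcard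
  -- The difference of the solutions is killed by the rows of `M` because the fits agree, and by the
  -- sign row because on `E` that row equals `uᵀ M`.
  have hc := eq_zero_of_gram_det_ne_zero hg (c := fun j => θ j - θ' j) (by
    have hsumE : ∀ g : κ → ℝ, ∑ j : E, g j * (θ j - θ' j) = ∑ j, g j * (θ j - θ' j) := by
      intro g
      rw [Finset.sum_coe_sort E (fun j => g j * (θ j - θ' j))]
      refine Finset.sum_subset (Finset.subset_univ _) fun j _ hj => ?_
      have : ¬ (θ j ≠ 0 ∨ θ' j ≠ 0) := fun hh => hj (hmem j hh)
      push Not at this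
      rw [this.1, this.2]; ring
    have hM0 : ∀ i, ∑ j, M i j * (θ j - θ' j) = 0 := by
      intro i
      have := congrFun hfit i
      simp only [Matrix.mulVec, dotProduct] at this
      simp only [mul_sub, Finset.sum_sub_distrib, this, sub_self]
    ext i
    rcases i with i | i
    · simp only [Matrix.mulVec, dotProduct, augment, Matrix.submatrix_apply, id,
        Matrix.fromRows_apply_inl, Pi.zero_apply]
      rw [hsumE (fun j => M i j), hM0]
    · simp only [Matrix.mulVec, dotProduct, augment, Matrix.submatrix_apply, id,
        Matrix.fromRows_apply_inr, Matrix.replicateRow_apply, Pi.zero_apply]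
      calc ∑ j : E, ((s j : ℤ) : ℝ) * (θ j - θ' j)
          = ∑ j : E, (∑ i, M i j * u i) * (θ j - θ' j) :=
            Finset.sum_congr rfl fun j _ => by rw [hsE j j.2]
        _ = ∑ j, (∑ i, M i j * u i) * (θ j - θ' j) := hsumE fun j => ∑ i, M i j * u i
        _ = ∑ i, u i * ∑ j, M i j * (θ j - θ' j) := by
            simp_rw [Finset.sum_mul, Finset.mul_sum]
            rw [Finset.sum_comm]
            exact Finset.sum_congr rfl fun j _ => Finset.sum_congr rfl fun i _ => by ring
        _ = 0 := by simp [hM0])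
  ext j
  by_cases hj : j ∈ E
  · have := congrFun hc ⟨j, hj⟩
    simp only [Pi.zero_apply] at this
    linarith
  · have : ¬ (θ j ≠ 0 ∨ θ' j ≠ 0) := fun hh => hj (hmem j hh)
    push Not at this
    rw [this.1, this.2]

end Lasso

/-! ### Genericity of randomly projected designs. -/

section GeneralPosition

variable {ρ κ : Type*} [Fintype ρ] [DecidableEq κ]

theorem isOpen_generalPosition [Fintype κ] : IsOpen {M : Matrix ρ κ ℝ | GeneralPosition M} := by
  have : {M : Matrix ρ κ ℝ | GeneralPosition M} =
      ⋂ (s : κ → ℤˣ), ⋂ (F : Finset κ), ⋂ (_ : F.card ≤ Fintype.card ρ + 1),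
        {M : Matrix ρ κ ℝ | (((augment M s).submatrix id ((↑) : F → κ)).transpose *
      (augment M s).submatrix id ((↑) : F → κ)).det ≠ 0} := by
    ext M; simp [GeneralPosition]
  rw [this]
  refine isOpen_iInter_of_finite fun s => isOpen_iInter_of_finite fun F =>
    isOpen_iInter_of_finite fun _ => ?_
  refine isOpen_ne_fun ?_ continuous_const
  have h1 : Continuous fun M : Matrix ρ κ ℝ => (augment M s).submatrix id ((↑) : F → κ) := by
    refine continuous_matrix fun i j => ?_
    rcases i with i | i
    · simp only [augment, Matrix.submatrix_apply, id, Matrix.fromRows_apply_inl]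
      fun_prop
    · simp only [augment, Matrix.submatrix_apply, id, Matrix.fromRows_apply_inr]
      fun_prop
  exact (h1.matrix_transpose.matrix_mul h1).matrix_det

/-- Embed `F` into the rows of the augmented design and let each column be the matching unit vector.
At most one column is sent to the sign row; it is zero in `M`, and its sign `±1` makes the whole
system triangular. -/
theorem exists_gram_det_ne_zero (s : κ → ℤˣ) (F : Finset κ)
    (hF : F.card ≤ Fintype.card ρ + 1) :
    ∃ M : Matrix ρ κ ℝ, (((augment M s).submatrix id ((↑) : F → κ)).transpose *
      (augment M s).submatrix id ((↑) : F → κ)).det ≠ 0 := by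
  classical
  obtain ⟨e⟩ : Nonempty (F ↪ ρ ⊕ Unit) := Function.Embedding.nonempty_of_card_le (by simpa using hF)
  let M : Matrix ρ κ ℝ := Matrix.of fun i j =>
    if h : j ∈ F then (if e ⟨j, h⟩ = Sum.inl i then 1 else 0) else 0
  refine ⟨M, ?_⟩
  set N := (augment M s).submatrix id ((↑) : F → κ) with hN
  have hinj : ∀ c : F → ℝ, N.mulVec c = 0 → c = 0 := by
    intro c hc
    have h1 : ∀ j : F, ∀ i, e j = Sum.inl i → c j = 0 := by
      intro j i hij
      have := congrFun hc (Sum.inl i)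
      simp only [Matrix.mulVec, dotProduct, hN, augment, Matrix.submatrix_apply, id,
        Matrix.fromRows_apply_inl, Pi.zero_apply, M, Matrix.of_apply] at this
      rw [Finset.sum_eq_single j] at this
      · simpa [hij] using this
      · intro k _ hk
        have : e k ≠ Sum.inl i := fun h => hk (e.injective (h.trans hij.symm))
        simp [this]
      · simp
    ext j
    rcases hj : e j with i | ⟨⟩
    · exact h1 j i hj
    · have := congrFun hc (Sum.inr ())
      simp only [Matrix.mulVec, dotProduct, hN, augment, Matrix.submatrix_apply, id,
        Matrix.fromRows_apply_inr, Pi.zero_apply, Matrix.replicateRow_apply] at this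
      rw [Finset.sum_eq_single j] at this
      · simpa using this
      · intro k _ hk
        rcases hk' : e k with i | ⟨⟩
        · rw [h1 k i hk', mul_zero]
        · exact absurd (e.injective (hk'.trans hj.symm)) hk
      · simp
  intro hdet
  obtain ⟨c, hc0, hc⟩ := Matrix.exists_mulVec_eq_zero_iff.2 hdet
  apply hc0
  apply hinj
  have : ∑ i, N.mulVec c i * N.mulVec c i = 0 := by
    have h2 : dotProduct c ((N.transpose * N).mulVec c) = 0 := by rw [hc]; simp
    rw [← Matrix.mulVec_mulVec, Matrix.dotProduct_mulVec, Matrix.vecMul_transpose] at h2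
    exact h2
  rw [Finset.sum_eq_zero_iff_of_nonneg (fun i _ => mul_self_nonneg _)] at this
  ext i
  simpa using this i (Finset.mem_univ i)

variable [Fintype κ]

/-- A random projection with i.i.d. atomless entries turns any matrix of full column rank into a
matrix in general position. -/
theorem ae_generalPosition_mul {N : Type*} [Fintype N] (ν : Measure ℝ) [SigmaFinite ν]
    [NullSingletonClass ν] (A : Matrix N κ ℝ) (L : Matrix κ N ℝ) (hL : L * A = 1) :
    ∀ᵐ x ∂(Measure.pi fun _ : ρ × N => ν),
      GeneralPosition (Matrix.of (fun i k => x (i, k)) * A) := by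
  unfold GeneralPosition
  rw [ae_all_iff]
  intro s
  rw [ae_all_iff]
  intro F
  by_cases hF : F.card ≤ Fintype.card ρ + 1
  swap
  · exact ae_of_all _ fun x h => absurd h hF
  -- For fixed signs and `F`, the Gram determinant is a polynomial in the entries of the projection,
  -- and there are only finitely many such pairs.
  let Mp : Matrix ρ κ (MvPolynomial (ρ × N) ℝ) := Matrix.of fun i j =>
    ∑ k, MvPolynomial.X (i, k) * MvPolynomial.C (A k j)
  let Np : Matrix (ρ ⊕ Unit) F (MvPolynomial (ρ × N) ℝ) := Matrix.of fun i j =>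
    Sum.elim (fun a => Mp a j) (fun _ => MvPolynomial.C (((s j : ℤ)) : ℝ)) i
  have hev : ∀ x : ρ × N → ℝ, MvPolynomial.eval x (Np.transpose * Np).det =
      (((augment (Matrix.of (fun i k => x (i, k)) * A) s).submatrix id ((↑) : F → κ)).transpose *
      (augment (Matrix.of (fun i k => x (i, k)) * A) s).submatrix id ((↑) : F → κ)).det := by
    intro x
    rw [RingHom.map_det]
    congr 1
    rw [RingHom.mapMatrix_apply, Matrix.map_mul, Matrix.transpose_map]
    have : Np.map (MvPolynomial.eval x) =
        (augment (Matrix.of (fun i k => x (i, k)) * A) s).submatrix id ((↑) : F → κ) := by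
      ext i j
      rcases i with i | i
      · simp [Np, Mp, augment, Matrix.mul_apply]
      · simp [Np, augment]
    rw [this]
  have hne : (Np.transpose * Np).det ≠ 0 := by
    intro h0
    obtain ⟨M, hM⟩ := exists_gram_det_ne_zero (ρ := ρ) s F hF
    have h1 := hev (fun q => (M * L) q.1 q.2)
    -- The left inverse `L` shows that every `M`, in particular the good one, is of the form
    -- projection times `A`; so the polynomial is not identically zero.
    have h2 : Matrix.of (fun (i : ρ) (k : N) => (M * L) i k) * A = M := by
      have : Matrix.of (fun (i : ρ) (k : N) => (M * L) i k) = M * L := rfl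
      rw [this, Matrix.mul_assoc, hL, Matrix.mul_one]
    rw [h0, map_zero] at h1
    simp only [h2] at h1
    exact hM h1.symm
  filter_upwards [ae_eval_ne_zero ν _ hne] with x hx _
  rwa [hev] at hx

end GeneralPosition

/-- If two random pairs have first components with the same law and both pairs lie on the same
measurable graph, then the pairs have the same law. -/
theorem map_prodMk_eq_of_mem_graph {Ω α β : Type*} [MeasurableSpace Ω] {P : Measure Ω}
    [MeasurableSpace α] [StandardBorelSpace α] [MeasurableSpace β] [StandardBorelSpace β]
    {E E' : Ω → α} {U U' : Ω → β} (hE : AEMeasurable E P) (hE' : AEMeasurable E' P)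
    (hU : AEMeasurable U P) (hU' : AEMeasurable U' P) (hlaw : P.map E = P.map E')
    {Γ : Set (α × β)} (hΓ : MeasurableSet Γ) (hinj : Set.InjOn Prod.fst Γ)
    (h : ∀ᵐ ω ∂P, (E ω, U ω) ∈ Γ) (h' : ∀ᵐ ω ∂P, (E' ω, U' ω) ∈ Γ) :
    P.map (fun ω => (E ω, U ω)) = P.map (fun ω => (E' ω, U' ω)) := by
  have key : ∀ (E : Ω → α) (U : Ω → β), AEMeasurable E P → AEMeasurable U P →
      (∀ᵐ ω ∂P, (E ω, U ω) ∈ Γ) → ∀ D, MeasurableSet D →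
      P.map (fun ω => (E ω, U ω)) D = P.map E (Prod.fst '' (Γ ∩ D)) := by
    intro E U hE hU h D hD
    -- Injective measurable images of Borel sets are Borel (Lusin–Souslin). Hence each event about
    -- the pair coincides almost surely with an event about its first component, and no measurable
    -- solution map has to be constructed.
    have hI : MeasurableSet (Prod.fst '' (Γ ∩ D)) :=
      (hΓ.inter hD).image_of_measurable_injOn measurable_fst (hinj.mono Set.inter_subset_left)
    rw [Measure.map_apply_of_aemeasurable (hE.prodMk hU) hD,
      Measure.map_apply_of_aemeasurable hE hI]
    refine measure_congr ?_
    filter_upwards [h] with ω hω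
    refine propext ⟨fun hd => ⟨(E ω, U ω), ⟨hω, hd⟩, rfl⟩, ?_⟩
    rintro ⟨z, ⟨hz, hzD⟩, hzE⟩
    have : z = (E ω, U ω) := hinj hz hω hzE
    rw [this] at hzD
    exact hzD
  refine Measure.ext fun D hD => ?_
  rw [key E U hE hU h D hD, key E' U' hE' hU' h' D hD, hlaw]

/-! ### Control of the false discovery rate -/

section Knockoff

variable {p : ℕ}

theorem knockoffThreshold_le_coe_iff {q : ℝ} {W : Fin p → ℝ} {x : ℝ} :
    knockoffThreshold q W ≤ (x : WithTop ℝ) ↔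
      ∃ k, W k ≠ 0 ∧ fdpHat W |W k| ≤ q ∧ |W k| ≤ x := by
  constructor
  · intro h
    obtain ⟨t, ht⟩ : ∃ t : ℝ, knockoffThreshold q W = t :=
      ⟨_, (WithTop.coe_untop _ (ne_top_of_le_ne_top WithTop.coe_ne_top h)).symm⟩
    have hmem := Finset.mem_of_min ht
    simp only [Finset.mem_filter, Finset.mem_image, Finset.mem_univ, true_and] at hmem
    obtain ⟨⟨k, rfl⟩, h0, hq⟩ := hmem
    refine ⟨k, by simpa using h0, hq, ?_⟩
    rw [ht] at h
    exact_mod_cast h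
  · rintro ⟨k, h0, hq, hx⟩
    refine (Finset.min_le ?_).trans (WithTop.coe_le_coe.2 hx)
    simp only [Finset.mem_filter, Finset.mem_image, Finset.mem_univ, true_and]
    exact ⟨⟨k, rfl⟩, by simpa using h0, hq⟩

theorem knockoffThreshold_eq_coe {q : ℝ} {W : Fin p → ℝ} {t : ℝ}
    (ht : knockoffThreshold q W = t) :
    0 < t ∧ (∃ k, |W k| = t) ∧ fdpHat W t ≤ q := by
  have hmem := Finset.mem_of_min ht
  simp only [Finset.mem_filter, Finset.mem_image, Finset.mem_univ, true_and] at hmem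
  obtain ⟨⟨k, rfl⟩, h0, hq⟩ := hmem
  exact ⟨lt_of_le_of_ne (abs_nonneg _) (Ne.symm h0), ⟨k, rfl⟩, hq⟩

theorem knockoffThreshold_eq_coe_of_le {q : ℝ} {W : Fin p → ℝ} {x : ℝ}
    (h : knockoffThreshold q W ≤ (x : WithTop ℝ)) :
    ∃ t : ℝ, knockoffThreshold q W = t ∧ t ≤ x := by
  have ht := (WithTop.coe_untop _ (ne_top_of_le_ne_top WithTop.coe_ne_top h)).symm
  refine ⟨_, ht, ?_⟩
  rw [ht] at h
  exact_mod_cast h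

theorem mem_selected {W : Fin p → ℝ} {t : WithTop ℝ} {j : Fin p} :
    j ∈ selected W t ↔ t ≤ (W j : WithTop ℝ) := by
  simp [selected]

/-- Flip the sign of the `j`-th coordinate. -/
def flipSign (j : Fin p) (W : Fin p → ℝ) : Fin p → ℝ := Function.update W j (-W j)

theorem flipSign_same (j : Fin p) (W : Fin p → ℝ) : flipSign j W j = -W j := by
  simp [flipSign]

theorem flipSign_of_ne {j k : Fin p} (h : k ≠ j) (W : Fin p → ℝ) : flipSign j W k = W k := by
  simp [flipSign, h]

theorem abs_flipSign (j k : Fin p) (W : Fin p → ℝ) : |flipSign j W k| = |W k| := by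
  by_cases h : k = j
  · subst h; rw [flipSign_same, abs_neg]
  · rw [flipSign_of_ne h]

/-- Flipping a coordinate at or below `-t` moves one unit from the negative to the positive count.
The removed unit cancels the `1 +` in the numerator, so the result no longer depends on `j`. -/
theorem fdpHat_flipSign {j : Fin p} {W : Fin p → ℝ} {t : ℝ} (ht : 0 < t) (hj : t ≤ -W j) :
    fdpHat (flipSign j W) t = ((Finset.univ.filter fun k => W k ≤ -t).card : ℝ) /
      max 1 (((Finset.univ.filter fun k => t ≤ W k).card : ℝ) + 1) := by
  classical
  have h1 : (Finset.univ.filter fun k => flipSign j W k ≤ -t)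
      = (Finset.univ.filter fun k => W k ≤ -t).erase j := by
    ext k
    by_cases h : k = j
    · subst h; simp [flipSign_same]; linarith
    · simp [flipSign_of_ne h, h]
  have h2 : (Finset.univ.filter fun k => t ≤ flipSign j W k)
      = insert j (Finset.univ.filter fun k => t ≤ W k) := by
    ext k
    by_cases h : k = j
    · subst h; simp [flipSign_same]; linarith
    · simp [flipSign_of_ne h, h]
  have hm : j ∈ Finset.univ.filter fun k => W k ≤ -t := by simp; linarith
  have hm' : j ∉ Finset.univ.filter fun k => t ≤ W k := by simp; linarith
  have h3 := Finset.card_erase_add_one hm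
  unfold fdpHat
  rw [h1, h2, Finset.card_insert_of_notMem hm']
  rw [← h3]
  push_cast
  ring_nf

/-- At the smaller of the two thresholds both flips have the same estimated FDP by
`fdpHat_flipSign`, so that value is admissible for both. All indices that are selected after their
own flip thus share one threshold. -/
theorem knockoffThreshold_flipSign_le {q : ℝ} {j k : Fin p} {W : Fin p → ℝ}
    (hj : knockoffThreshold q (flipSign j W) ≤ ((-W j : ℝ) : WithTop ℝ))
    (hk : knockoffThreshold q (flipSign k W) ≤ ((-W k : ℝ) : WithTop ℝ))
    (hjk : knockoffThreshold q (flipSign j W) ≤ knockoffThreshold q (flipSign k W)) :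
    knockoffThreshold q (flipSign k W) ≤ knockoffThreshold q (flipSign j W) := by
  obtain ⟨t, ht, htj⟩ := knockoffThreshold_eq_coe_of_le hj
  obtain ⟨t', ht', htk⟩ := knockoffThreshold_eq_coe_of_le hk
  obtain ⟨h0, ⟨i, hi⟩, hq⟩ := knockoffThreshold_eq_coe ht
  rw [ht, ht'] at hjk
  have hjk' : t ≤ t' := by exact_mod_cast hjk
  rw [ht, knockoffThreshold_le_coe_iff]
  refine ⟨i, ?_, ?_, ?_⟩
  · intro h
    have := abs_flipSign k i W
    rw [h, abs_zero, ← abs_flipSign j i W, hi] at this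
    linarith
  · rw [abs_flipSign, ← abs_flipSign j, hi, fdpHat_flipSign h0 (htk.trans' hjk'),
      ← fdpHat_flipSign h0 htj]
    exact hq
  · rw [abs_flipSign, ← abs_flipSign j, hi]

/-- Contribution of feature `j` to the ratio of selected nulls to one plus the number of nulls
below the negative threshold. -/
def nullRatio (q : ℝ) (S : Finset (Fin p)) (j : Fin p) (W : Fin p → ℝ) : ℝ :=
  open Classical in
  if knockoffThreshold q W ≤ (W j : WithTop ℝ) then
    1 / (1 + (((S.erase j).filter fun k =>
      knockoffThreshold q W ≤ ((-W k : ℝ) : WithTop ℝ)).card : ℝ)) else 0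

theorem nullRatio_nonneg (q : ℝ) (S : Finset (Fin p)) (j : Fin p) (W : Fin p → ℝ) :
    0 ≤ nullRatio q S j W := by
  unfold nullRatio; split_ifs <;> positivity

theorem nullRatio_le_one (q : ℝ) (S : Finset (Fin p)) (j : Fin p) (W : Fin p → ℝ) :
    nullRatio q S j W ≤ 1 := by
  unfold nullRatio
  split_ifs
  · rw [div_le_one (by positivity)]; simp
  · exact zero_le_one

theorem sum_nullRatio_flipSign_le_one (q : ℝ) (S : Finset (Fin p)) (W : Fin p → ℝ) :
    ∑ j ∈ S, nullRatio q S j (flipSign j W) ≤ 1 := by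
  classical
  set T : Fin p → WithTop ℝ := fun j => knockoffThreshold q (flipSign j W) with hT
  set J := S.filter fun j => T j ≤ ((-W j : ℝ) : WithTop ℝ) with hJ
  have hterm : ∀ j ∈ J, nullRatio q S j (flipSign j W) =
      1 / ((S.filter fun k => T j ≤ ((-W k : ℝ) : WithTop ℝ)).card : ℝ) := by
    intro j hj
    rw [hJ, Finset.mem_filter] at hj
    unfold nullRatio
    rw [flipSign_same, if_pos hj.2]
    -- The `1 +` in the denominator of `nullRatio` accounts for `j` itself: before the flip, `j`
    -- lies below the negative threshold.
    have : (S.filter fun k => T j ≤ ((-W k : ℝ) : WithTop ℝ)) =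
        insert j ((S.erase j).filter fun k =>
          knockoffThreshold q (flipSign j W) ≤ ((-flipSign j W k : ℝ) : WithTop ℝ)) := by
      ext k
      by_cases h : k = j
      · subst h
        simp only [Finset.mem_filter, Finset.mem_insert, true_or, iff_true]
        exact hj
      · simp only [Finset.mem_filter, Finset.mem_insert, Finset.mem_erase, flipSign_of_ne h, h, hT,
          false_or, ne_eq, not_false_eq_true, true_and]
    rw [this, Finset.card_insert_of_notMem
      (by simp only [Finset.mem_filter, Finset.mem_erase, ne_eq, not_true, false_and,
        not_false_eq_true])]
    push_cast
    rw [add_comm]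
  have hzero : ∑ j ∈ S, nullRatio q S j (flipSign j W) =
      ∑ j ∈ J, nullRatio q S j (flipSign j W) := by
    symm
    refine Finset.sum_subset (Finset.filter_subset _ _) fun j hjS hj => ?_
    have : ¬ T j ≤ ((-W j : ℝ) : WithTop ℝ) := fun h => hj (Finset.mem_filter.2 ⟨hjS, h⟩)
    unfold nullRatio
    rw [flipSign_same, if_neg this]
  rw [hzero]
  rcases J.eq_empty_or_nonempty with he | ⟨i, hi⟩
  · rw [he]; simp
  have hTeq : ∀ j ∈ J, T j = T i := by
    intro j hj
    have hj' := (Finset.mem_filter.1 hj).2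
    have hi' := (Finset.mem_filter.1 hi).2
    rcases le_total (T j) (T i) with h | h
    · exact le_antisymm h (knockoffThreshold_flipSign_le hj' hi' h)
    · exact le_antisymm (knockoffThreshold_flipSign_le hi' hj' h) h
  -- With a common threshold all nonzero terms have the same denominator, the size of a set
  -- containing `J`; hence `|J|` equal terms sum to at most 1.
  have hsub : J ⊆ S.filter fun k => T i ≤ ((-W k : ℝ) : WithTop ℝ) := by
    intro j hj
    have := Finset.mem_filter.1 hj
    exact Finset.mem_filter.2 ⟨this.1, hTeq j hj ▸ this.2⟩
  have hpos : 0 < J.card := Finset.card_pos.2 ⟨i, hi⟩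
  have hle := Finset.card_le_card hsub
  calc ∑ j ∈ J, nullRatio q S j (flipSign j W)
      = ∑ j ∈ J, 1 / ((S.filter fun k => T i ≤ ((-W k : ℝ) : WithTop ℝ)).card : ℝ) :=
        Finset.sum_congr rfl fun j hj => by rw [hterm j hj, hTeq j hj]
    _ = J.card / ((S.filter fun k => T i ≤ ((-W k : ℝ) : WithTop ℝ)).card : ℝ) := by
        rw [Finset.sum_const, nsmul_eq_mul, mul_one_div]
    _ ≤ 1 := by
        rw [div_le_one (by exact_mod_cast hpos.trans_le hle)]
        exact_mod_cast hle

theorem fdp_nonneg (θ₀ W : Fin p → ℝ) (t : WithTop ℝ) : 0 ≤ FDP θ₀ W t := by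
  unfold FDP; positivity

theorem fdp_le_one (θ₀ W : Fin p → ℝ) (t : WithTop ℝ) : FDP θ₀ W t ≤ 1 := by
  unfold FDP
  rw [div_le_one (by positivity)]
  refine le_trans ?_ (le_max_right _ _)
  exact_mod_cast Finset.card_le_card Finset.sdiff_subset

/-- The stopping rule `fdpHat ≤ q` bounds one over the number of selections by `q / (1 + m)`, where
`m` counts all features below the negative threshold. Counting only nulls other than `j` makes the
denominator smaller, which gives `nullRatio`. -/
theorem fdp_le_mul_sum_nullRatio {q : ℝ} (hq : 0 < q) (θ₀ W : Fin p → ℝ) :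
    FDP θ₀ W (knockoffThreshold q W) ≤ q * ∑ j ∈ (supp θ₀)ᶜ, nullRatio q (supp θ₀)ᶜ j W := by
  classical
  set S := (supp θ₀)ᶜ with hS
  have hsel : selected W (knockoffThreshold q W) \ supp θ₀ =
      S.filter fun j => knockoffThreshold q W ≤ (W j : WithTop ℝ) := by
    ext j; simp [mem_selected, hS, and_comm]
  rcases eq_or_ne (knockoffThreshold q W) ⊤ with htop | htop
  · have : FDP θ₀ W (knockoffThreshold q W) = 0 := by
      unfold FDP
      rw [hsel, htop]
      simp
    rw [this]
    exact mul_nonneg hq.le (Finset.sum_nonneg fun j _ => nullRatio_nonneg _ _ _ _)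
  obtain ⟨t, ht⟩ : ∃ t : ℝ, knockoffThreshold q W = t := ⟨_, (WithTop.coe_untop _ htop).symm⟩
  obtain ⟨h0, -, hfq⟩ := knockoffThreshold_eq_coe ht
  have hcardsel : (selected W (knockoffThreshold q W)).card =
      (Finset.univ.filter fun j => t ≤ W j).card := by
    rw [ht]; congr 1; ext j; simp [mem_selected]
  unfold fdpHat at hfq
  unfold FDP
  rw [hsel, hcardsel]
  set D := max 1 ((Finset.univ.filter fun j => t ≤ W j).card : ℝ) with hD
  set m := ((Finset.univ.filter fun j => W j ≤ -t).card : ℝ) with hm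
  have hDpos : 0 < D := lt_of_lt_of_le one_pos (le_max_left _ _)
  have hm0 : 0 ≤ m := by positivity
  have hinv : 1 / D ≤ q * (1 / (1 + m)) := by
    rw [div_le_iff₀ hDpos] at hfq
    rw [mul_one_div, div_le_div_iff₀ hDpos (by positivity)]
    linarith
  have hterm : ∀ j ∈ S.filter (fun j => knockoffThreshold q W ≤ (W j : WithTop ℝ)),
      1 / (1 + m) ≤ nullRatio q S j W := by
    intro j hj
    unfold nullRatio
    rw [if_pos (Finset.mem_filter.1 hj).2]
    refine one_div_le_one_div_of_le (by positivity) ?_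
    rw [hm]
    have : ((S.erase j).filter fun k => knockoffThreshold q W ≤ ((-W k : ℝ) : WithTop ℝ)) ⊆
        Finset.univ.filter fun j => W j ≤ -t := by
      intro k hk
      have := (Finset.mem_filter.1 hk).2
      rw [ht] at this
      have h2 : t ≤ -W k := by exact_mod_cast this
      simp; linarith
    have := Finset.card_le_card this
    gcongr
  calc ((S.filter fun j => knockoffThreshold q W ≤ (W j : WithTop ℝ)).card : ℝ) / D
      = ((S.filter fun j => knockoffThreshold q W ≤ (W j : WithTop ℝ)).card : ℝ) * (1 / D) := by
        ring
    _ ≤ ((S.filter fun j => knockoffThreshold q W ≤ (W j : WithTop ℝ)).card : ℝ) *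
          (q * (1 / (1 + m))) := by gcongr
    _ = q * ∑ j ∈ S.filter (fun j => knockoffThreshold q W ≤ (W j : WithTop ℝ)), 1 / (1 + m) := by
        rw [Finset.sum_const, nsmul_eq_mul]; ring
    _ ≤ q * ∑ j ∈ S.filter (fun j => knockoffThreshold q W ≤ (W j : WithTop ℝ)),
          nullRatio q S j W := by
        gcongr with j hj
        exact hterm j hj
    _ ≤ q * ∑ j ∈ S, nullRatio q S j W := by
        gcongr
        · intros; exact nullRatio_nonneg _ _ _ _
        · exact Finset.filter_subset _ _

theorem measurable_card_filter {α ι : Type*} [MeasurableSpace α] (S : Finset ι)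
    (Q : α → ι → Prop) [∀ a i, Decidable (Q a i)] (hQ : ∀ i, MeasurableSet {a | Q a i}) :
    Measurable fun a => ((S.filter fun i => Q a i).card : ℝ) := by
  have : (fun a => ((S.filter fun i => Q a i).card : ℝ)) =
      fun a => ∑ i ∈ S, Set.indicator {a | Q a i} (fun _ => (1 : ℝ)) a := by
    ext a
    rw [Finset.card_filter]
    push_cast
    exact Finset.sum_congr rfl fun i _ => by simp [Set.indicator]
  rw [this]
  exact Finset.measurable_sum _ fun i _ => measurable_const.indicator (hQ i)

theorem measurableSet_knockoffThreshold_le (q : ℝ) {g : (Fin p → ℝ) → ℝ} (hg : Measurable g) :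
    MeasurableSet {W : Fin p → ℝ | knockoffThreshold q W ≤ (g W : WithTop ℝ)} := by
  have : {W : Fin p → ℝ | knockoffThreshold q W ≤ (g W : WithTop ℝ)} =
      ⋃ k, {W | W k ≠ 0 ∧ fdpHat W |W k| ≤ q ∧ |W k| ≤ g W} := by
    ext W; simp [knockoffThreshold_le_coe_iff]
  rw [this]
  refine MeasurableSet.iUnion fun k => ?_
  have hk : Measurable fun W : Fin p → ℝ => W k := measurable_pi_apply k
  have habs : Measurable fun W : Fin p → ℝ => |W k| := hk.abs
  refine MeasurableSet.inter ?_ (MeasurableSet.inter ?_ ?_)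
  · exact (measurableSet_singleton (0 : ℝ)).compl.preimage hk
  · refine measurableSet_le (f := fun W : Fin p → ℝ => fdpHat W |W k|) ?_
      (measurable_const (a := q))
    unfold fdpHat
    refine Measurable.div (measurable_const.add (measurable_card_filter _ _ fun i => ?_))
      (measurable_const.max (measurable_card_filter _ _ fun i => ?_))
    · exact measurableSet_le (f := fun W : Fin p → ℝ => W i) (measurable_pi_apply i) habs.neg
    · exact measurableSet_le (g := fun W : Fin p → ℝ => W i) habs (measurable_pi_apply i)
  · exact measurableSet_le habs hg

theorem measurable_nullRatio (q : ℝ) (S : Finset (Fin p)) (j : Fin p) :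
    Measurable (nullRatio q S j) := by
  unfold nullRatio
  refine Measurable.ite (measurableSet_knockoffThreshold_le q (measurable_pi_apply j)) ?_
    measurable_const
  refine measurable_const.div (measurable_const.add (measurable_card_filter _ _ fun i => ?_))
  exact measurableSet_knockoffThreshold_le q (measurable_pi_apply i).neg

theorem measurable_fdp_knockoffThreshold (q : ℝ) (θ₀ : Fin p → ℝ) :
    Measurable fun W : Fin p → ℝ => FDP θ₀ W (knockoffThreshold q W) := by
  classical
  unfold FDP
  have h1 : ∀ W : Fin p → ℝ, selected W (knockoffThreshold q W) \ supp θ₀ =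
      (supp θ₀)ᶜ.filter fun j => knockoffThreshold q W ≤ (W j : WithTop ℝ) := by
    intro W; ext j; simp [mem_selected, and_comm]
  have h2 : ∀ W : Fin p → ℝ, selected W (knockoffThreshold q W) =
      Finset.univ.filter fun j => knockoffThreshold q W ≤ (W j : WithTop ℝ) := by
    intro W; ext j; simp [mem_selected]
  simp_rw [h1]
  simp_rw [h2]
  refine Measurable.div (measurable_card_filter _ _ fun i => ?_)
      (measurable_const.max (measurable_card_filter _ _ fun i => ?_)) <;>
  exact measurableSet_knockoffThreshold_le q (measurable_pi_apply i)

theorem measurable_flipSign (j : Fin p) : Measurable (flipSign j) := by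
  refine measurable_pi_lambda _ fun k => ?_
  by_cases h : k = j
  · subst h
    simp only [flipSign_same]
    exact (measurable_pi_apply _).neg
  · simp only [flipSign_of_ne h]
    exact measurable_pi_apply _

/-- The knockoff filter controls the false discovery rate as soon as the law of the statistics is
invariant under flipping the sign of a single null coordinate. -/
theorem knockoff_fdr_control {Ω : Type*} [MeasurableSpace Ω] {P : Measure Ω}
    [IsProbabilityMeasure P] (θ₀ : Fin p → ℝ) {W : Ω → Fin p → ℝ} (hW : AEMeasurable W P)
    (hflip : ∀ j, θ₀ j = 0 → P.map (fun ω => flipSign j (W ω)) = P.map W) {q : ℝ} (hq : 0 < q) :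
    Integrable (fun ω => FDP θ₀ (W ω) (knockoffThreshold q (W ω))) P ∧
      ∫ ω, FDP θ₀ (W ω) (knockoffThreshold q (W ω)) ∂P ≤ q := by
  have hint : Integrable (fun ω => FDP θ₀ (W ω) (knockoffThreshold q (W ω))) P := by
    refine Integrable.of_bound (C := 1)
      ((measurable_fdp_knockoffThreshold q θ₀).comp_aemeasurable hW).aestronglyMeasurable ?_
    refine ae_of_all _ fun ω => ?_
    rw [Real.norm_eq_abs, abs_of_nonneg (fdp_nonneg _ _ _)]
    exact fdp_le_one _ _ _
  refine ⟨hint, ?_⟩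
  set S := (supp θ₀)ᶜ with hS
  have hbd : ∀ j (V : Ω → Fin p → ℝ), AEMeasurable V P →
      Integrable (fun ω => nullRatio q S j (V ω)) P := by
    intro j V hV
    refine Integrable.of_bound (C := 1)
      ((measurable_nullRatio q S j).comp_aemeasurable hV).aestronglyMeasurable ?_
    refine ae_of_all _ fun ω => ?_
    rw [Real.norm_eq_abs, abs_of_nonneg (nullRatio_nonneg _ _ _ _)]
    exact nullRatio_le_one _ _ _ _
  have hfl : ∀ j, AEMeasurable (fun ω => flipSign j (W ω)) P := fun j =>
    (measurable_flipSign j).comp_aemeasurable hW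
  -- Each term is flipped in its own coordinate. The invariance is used once per null, never for
  -- several flips at a time.
  have hswap : ∀ j ∈ S, ∫ ω, nullRatio q S j (W ω) ∂P =
      ∫ ω, nullRatio q S j (flipSign j (W ω)) ∂P := by
    intro j hj
    have hj0 : θ₀ j = 0 := by simpa [hS, supp] using hj
    rw [← integral_map (f := nullRatio q S j) hW (measurable_nullRatio q S j).aestronglyMeasurable,
      ← hflip j hj0,
      integral_map (hfl j) (measurable_nullRatio q S j).aestronglyMeasurable]
  calc ∫ ω, FDP θ₀ (W ω) (knockoffThreshold q (W ω)) ∂P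
      ≤ ∫ ω, q * ∑ j ∈ S, nullRatio q S j (W ω) ∂P :=
        integral_mono hint ((integrable_finsetSum _ fun j _ => hbd j W hW).const_mul q)
          fun ω => fdp_le_mul_sum_nullRatio hq θ₀ (W ω)
    _ = q * ∑ j ∈ S, ∫ ω, nullRatio q S j (flipSign j (W ω)) ∂P := by
        rw [integral_const_mul, integral_finsetSum _ fun j _ => hbd j W hW]
        rw [Finset.sum_congr rfl hswap]
    _ = q * ∫ ω, ∑ j ∈ S, nullRatio q S j (flipSign j (W ω)) ∂P := by
        rw [integral_finsetSum _ fun j _ => hbd j _ (hfl j)]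
    _ ≤ q * ∫ _, (1 : ℝ) ∂P := by
        refine mul_le_mul_of_nonneg_left ?_ hq.le
        exact integral_mono (integrable_finsetSum _ fun j _ => hbd j _ (hfl j))
          (integrable_const _) fun ω => sum_nullRatio_flipSign_le_one q S (W ω)
    _ = q := by simp

end Knockoff

/-! ### The canonical sample space -/

theorem jlt_apply {ι κ ρ : Type*} [Fintype ι] [Fintype κ] [DecidableEq κ]
    (R : Matrix ρ (ι ⊕ κ) ℝ) (A : Matrix ι κ ℝ) (w : ℝ) (a : ρ) (c : κ) :
    jlt R A w a c = ∑ i, R a (Sum.inl i) * A i c + w * R a (Sum.inr c) := by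
  simp [jlt, Matrix.mul_apply, Fintype.sum_sum_type, Matrix.one_apply, mul_comm]

/-- Index set of the scalar random inputs at sample size `n`. -/
abbrev EntryIndex (S : Setting) (n : ℕ) : Type :=
  (Fin n × (Fin (S.p n) ⊕ Fin (S.p n))) ⊕ Fin n ⊕
      (Fin (S.r n) × (Fin n ⊕ ((Fin (S.p n) ⊕ Fin (S.p n)) ⊕ Unit)))

/-- Laws of the scalar random inputs. -/
def entryLaw (S : Setting) (n : ℕ) : EntryIndex S n → Measure ℝ
  | Sum.inl _ => S.D
  | Sum.inr (Sum.inl _) => S.noiseLaw n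
  | Sum.inr (Sum.inr _) => S.projLaw n

/-- The sample whose underlying point is the family of its scalar inputs. -/
def canonicalSample (S : Setting) (n : ℕ) : Sample S n (EntryIndex S n → ℝ) where
  X e := Matrix.of fun i j => e (Sum.inl (i, Sum.inl j))
  Xt e := Matrix.of fun i j => e (Sum.inl (i, Sum.inr j))
  ξ e := fun i => e (Sum.inr (Sum.inl i))
  R e := Matrix.of fun a k => e (Sum.inr (Sum.inr (a, k)))
  θhat _ := 0

namespace Sample

variable {S : Setting} {n : ℕ} {Ω : Type*} (T : Sample S n Ω)

/-- All scalar inputs of a sample at the point `ω`. -/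
def entryFun (ω : Ω) : EntryIndex S n → ℝ := fun i => T.entries i ω

theorem astar_eq_canonical (ω : Ω) : T.Astar ω = (canonicalSample S n).Astar (T.entryFun ω) := by
  have hX : T.X ω = (canonicalSample S n).X (T.entryFun ω) := by
    ext i j; simp [canonicalSample, entryFun, entries]
  have hXt : T.Xt ω = (canonicalSample S n).Xt (T.entryFun ω) := by
    ext i j; simp [canonicalSample, entryFun, entries]
  have hR : T.R ω = (canonicalSample S n).R (T.entryFun ω) := by
    ext i j; simp [canonicalSample, entryFun, entries]
  have hξ : T.ξ ω = (canonicalSample S n).ξ (T.entryFun ω) := by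
    ext i; simp [canonicalSample, entryFun, entries]
  unfold Astar
  rw [hX, hXt, hR, hξ]

theorem IsModel.hasLaw_entryFun [MeasurableSpace Ω] {C : ℝ} {P : Measure Ω}
    (h : T.IsModel C P) : HasLaw T.entryFun (Measure.pi (entryLaw S n)) P := by
  refine h.indep.hasLaw_pi fun i => ?_
  rcases i with ⟨i, k | k⟩ | i | ⟨a, k⟩
  · simpa [Sample.entryFun, entries, entryLaw] using h.law_X i k
  · simpa [Sample.entryFun, entries, entryLaw] using h.law_Xt i k
  · exact h.law_ξ i
  · exact h.law_R a k

end Sample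

theorem isProbabilityMeasure_noiseLaw {S : Setting} (hS : S.Standing) (n : ℕ) :
    IsProbabilityMeasure (S.noiseLaw n) := by
  refine cond_isProbabilityMeasure ?_
  have hv : Real.toNNReal (S.σ ^ 2) ≠ 0 := by
    have := hS.σ_pos
    simp only [ne_eq, Real.toNNReal_eq_zero, not_le]
    positivity
  intro h0
  have h1 := gaussianReal_absolutelyContinuous' 0 hv h0
  rw [Real.volume_Icc] at h1
  have := hS.bn_pos n
  simp only [ENNReal.ofReal_eq_zero] at h1
  linarith

theorem isProbabilityMeasure_entryLaw {S : Setting} (hS : S.Standing) (n : ℕ)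
    (i : EntryIndex S n) : IsProbabilityMeasure (entryLaw S n i) := by
  rcases i with i | i | i
  · exact hS.D_prob
  · exact isProbabilityMeasure_noiseLaw hS n
  · simp only [entryLaw, Setting.projLaw]; infer_instance

theorem lintegral_pi_sum {ι ι' : Type*} [Fintype ι] [Fintype ι'] (μ : ι ⊕ ι' → Measure ℝ)
    [∀ i, SigmaFinite (μ i)] {F : (ι ⊕ ι' → ℝ) → ENNReal} (hF : Measurable F) :
    ∫⁻ e, F e ∂Measure.pi μ = ∫⁻ a, ∫⁻ c, F (Sum.elim a c) ∂Measure.pi (fun i => μ (Sum.inr i))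
      ∂Measure.pi (fun i => μ (Sum.inl i)) := by
  have hmp := measurePreserving_sumPiEquivProdPi_symm (X := fun _ : ι ⊕ ι' => ℝ) μ
  rw [← hmp.lintegral_comp hF, lintegral_prod (fun z => F ((MeasurableEquiv.sumPiEquivProdPi fun _ => ℝ).symm z))
    (hF.comp hmp.measurable).aemeasurable]
  refine lintegral_congr fun a => lintegral_congr fun c => ?_
  congr 1

theorem measurable_sumElim {ι ι' : Type*} (a : ι → ℝ) :
    Measurable fun c : ι' → ℝ => (Sum.elim a c : ι ⊕ ι' → ℝ) := by
  refine measurable_pi_lambda _ fun i => ?_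
  rcases i with i | i
  · exact measurable_const
  · exact measurable_pi_apply i

/-- Integrate out the entries of the projection matrix first. -/
theorem lintegral_entries {S : Setting} (hS : S.Standing) (n : ℕ)
    {F : (EntryIndex S n → ℝ) → ENNReal} (hF : Measurable F) :
    ∫⁻ e, F e ∂Measure.pi (entryLaw S n) =
      ∫⁻ a, ∫⁻ b, ∫⁻ c, F (Sum.elim a (Sum.elim b c)) ∂Measure.pi (fun _ => S.projLaw n)
        ∂Measure.pi (fun _ => S.noiseLaw n) ∂Measure.pi (fun _ => S.D) := by
  have := isProbabilityMeasure_entryLaw hS n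
  rw [lintegral_pi_sum _ hF]
  refine lintegral_congr fun a => ?_
  exact lintegral_pi_sum (fun i => entryLaw S n (Sum.inr i)) (hF.comp (measurable_sumElim a))

theorem ae_entries_of_forall {S : Setting} (hS : S.Standing) (n : ℕ)
    {Q : (EntryIndex S n → ℝ) → Prop} (hQ : MeasurableSet {e | Q e})
    (h : ∀ a b, ∀ᵐ c ∂Measure.pi (fun _ => S.projLaw n), Q (Sum.elim a (Sum.elim b c))) :
    ∀ᵐ e ∂Measure.pi (entryLaw S n), Q e := by
  rw [ae_iff]
  have hm : MeasurableSet {e | ¬ Q e} := hQ.compl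
  rw [← lintegral_indicator_one hm, lintegral_entries hS n (measurable_one.indicator hm)]
  have : ∀ a b, ∫⁻ c, Set.indicator {e | ¬ Q e} (1 : (EntryIndex S n → ℝ) → ENNReal)
       (Sum.elim a (Sum.elim b c))
      ∂Measure.pi (fun _ => S.projLaw n) = 0 := by
    intro a b
    rw [lintegral_eq_zero_iff]
    · filter_upwards [h a b] with c hc
      simp [hc]
    · exact (measurable_one.indicator hm).comp
        ((measurable_sumElim a).comp (measurable_sumElim b))
  simp [this]

/-! ### Exchangeability of a null feature and its knockoff -/

section Exchangeability

variable {S : Setting} {n : ℕ}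

theorem astar_canonical_inl (e : EntryIndex S n → ℝ) (a : Fin (S.r n))
    (k : Fin (S.p n) ⊕ Fin (S.p n)) :
    (canonicalSample S n).Astar e a (Sum.inl k) =
      ∑ i, e (Sum.inr (Sum.inr (a, Sum.inl i))) * e (Sum.inl (i, k)) +
        S.w n * e (Sum.inr (Sum.inr (a, Sum.inr (Sum.inl k)))) := by
  unfold Sample.Astar
  rw [jlt_apply]
  rcases k with k | k <;> simp [canonicalSample, dataMatrix]

theorem astar_canonical_inr (e : EntryIndex S n → ℝ) (a : Fin (S.r n)) :
    (canonicalSample S n).Astar e a (Sum.inr ()) =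
      ∑ i, e (Sum.inr (Sum.inr (a, Sum.inl i))) *
        (∑ j, e (Sum.inl (i, Sum.inl j)) * S.θ₀ n j + e (Sum.inr (Sum.inl i))) +
        S.w n * e (Sum.inr (Sum.inr (a, Sum.inr (Sum.inr ())))) := by
  unfold Sample.Astar
  rw [jlt_apply]
  simp [canonicalSample, dataMatrix, response, Matrix.mulVec, dotProduct]

theorem continuous_astar_canonical :
    Continuous fun (e : EntryIndex S n → ℝ) => (canonicalSample S n).Astar e := by
  refine continuous_matrix fun a c => ?_
  rcases c with k | ⟨⟩
  · change Continuous fun e : EntryIndex S n → ℝ => (canonicalSample S n).Astar e a (Sum.inl k)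
    simp only [astar_canonical_inl]
    fun_prop
  · change Continuous fun e : EntryIndex S n → ℝ => (canonicalSample S n).Astar e a (Sum.inr ())
    simp only [astar_canonical_inr]
    fun_prop

/-- Interchange of the `j`-th feature with its knockoff. -/
abbrev swapFeature {p : ℕ} (j : Fin p) : Equiv.Perm (Fin p ⊕ Fin p) :=
  Equiv.swap (Sum.inl j) (Sum.inr j)

/-- Permutation of the scalar inputs induced by a permutation of the features. -/
def permEntries (τ : Equiv.Perm (Fin (S.p n) ⊕ Fin (S.p n))) : Equiv.Perm (EntryIndex S n) :=
  -- `τ` acts on the columns of `[X X̃]` and on the columns of `R` that multiply the feature part of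
  -- `w I`; the noise and the remaining columns of `R` stay fixed.
  Equiv.sumCongr (Equiv.prodCongr (Equiv.refl _) τ)
    (Equiv.sumCongr (Equiv.refl _)
      (Equiv.prodCongr (Equiv.refl _) (Equiv.sumCongr (Equiv.refl _)
        (Equiv.sumCongr τ (Equiv.refl _)))))

theorem measurePreserving_permEntries (hS : S.Standing)
    (τ : Equiv.Perm (Fin (S.p n) ⊕ Fin (S.p n))) :
    MeasurePreserving (fun e : EntryIndex S n → ℝ => e ∘ permEntries τ)
      (Measure.pi (entryLaw S n)) (Measure.pi (entryLaw S n)) := by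
  have := isProbabilityMeasure_entryLaw hS n
  have h := measurePreserving_arrowCongr' (entryLaw S n) (entryLaw S n) (permEntries τ).symm
    (MeasurableEquiv.refl ℝ) (fun i => by
      have : entryLaw S n ((permEntries τ).symm i) = entryLaw S n i := by
        rcases i with i | i | i <;> rfl
      rw [this]
      exact MeasurePreserving.id _)
  convert h using 1
  rfl

theorem astar_permEntries_inl (τ : Equiv.Perm (Fin (S.p n) ⊕ Fin (S.p n)))
    (e : EntryIndex S n → ℝ) (a : Fin (S.r n)) (k : Fin (S.p n) ⊕ Fin (S.p n)) :
    (canonicalSample S n).Astar (e ∘ permEntries τ) a (Sum.inl k) =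
      (canonicalSample S n).Astar e a (Sum.inl (τ k)) := by
  rw [astar_canonical_inl, astar_canonical_inl]
  simp [permEntries]

/-- The response sees column `j` only through `θ₀ j = 0`, and the columns of `R` entering `y*` are
not moved. This is where being a null is needed. -/
theorem astar_swapFeature_inr {j : Fin (S.p n)} (hj : S.θ₀ n j = 0)
    (e : EntryIndex S n → ℝ) (a : Fin (S.r n)) :
    (canonicalSample S n).Astar (e ∘ permEntries (swapFeature j)) a (Sum.inr ()) =
      (canonicalSample S n).Astar e a (Sum.inr ()) := by
  rw [astar_canonical_inr, astar_canonical_inr]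
  simp only [permEntries, Function.comp_apply, Equiv.sumCongr_apply, Sum.map_inr, Sum.map_inl,
    Equiv.prodCongr_apply, Prod.map_apply, Equiv.coe_refl, id]
  congr 1
  refine Finset.sum_congr rfl fun i _ => ?_
  congr 2
  refine Finset.sum_congr rfl fun k _ => ?_
  by_cases hk : k = j
  · subst hk; simp [hj]
  · rw [Equiv.swap_apply_of_ne_of_ne (by simpa using hk) (by simp)]

theorem isLassoSolution_submatrix {ρ κ : Type*} [Fintype ρ] [Fintype κ] {m : ℕ} {lam : ℝ}
    {M : Matrix ρ κ ℝ} {y : ρ → ℝ} {θ : κ → ℝ} (h : IsLassoSolution m lam M y θ)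
    (τ : Equiv.Perm κ) : IsLassoSolution m lam (M.submatrix id τ) y (θ ∘ τ) := by
  have key : ∀ v : κ → ℝ, lassoObjective m lam (M.submatrix id τ) y (v ∘ τ) =
      lassoObjective m lam M y v := by
    intro v
    unfold lassoObjective
    rw [Matrix.submatrix_mulVec_equiv]
    have : (v ∘ τ) ∘ τ.symm = v := by ext; simp
    rw [this]
    congr 2
    exact Equiv.sum_comp τ fun k => |v k|
  intro v
  have : v = (v ∘ τ.symm) ∘ τ := by ext; simp
  rw [this, key, key]
  exact h _

theorem debiased_submatrix {ρ κ : Type*} [Fintype ρ] [Fintype κ] (m : ℕ) (w : ℝ)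
    (M : Matrix ρ κ ℝ) (y : ρ → ℝ) (θ : κ → ℝ) (τ : Equiv.Perm κ) :
    debiased m w (M.submatrix id τ) y (θ ∘ τ) = debiased m w M y θ ∘ τ := by
  unfold debiased
  rw [Matrix.submatrix_mulVec_equiv]
  have : (θ ∘ τ) ∘ τ.symm = θ := by ext; simp
  rw [this]
  ext k
  simp [Matrix.mulVec, dotProduct]

theorem featureStat_swapFeature {p : ℕ} (f : ℝ → ℝ → ℝ) (a : ℝ) (u : Fin p ⊕ Fin p → ℝ)
    (j : Fin p) : featureStat f a (u ∘ swapFeature j) = flipSign j (featureStat f a u) := by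
  ext k
  by_cases hk : k = j
  · subst hk; simp [flipSign_same, featureStat]
  · rw [flipSign_of_ne hk]
    simp only [featureStat, Function.comp_apply]
    rw [Equiv.swap_apply_of_ne_of_ne (by simpa using hk) (by simp),
      Equiv.swap_apply_of_ne_of_ne (by simp) (by simpa using hk)]

end Exchangeability

/-! ### Sign-flip symmetry of the statistics in the model and FDR control. -/

section ModelFDR

variable {S : Setting} {n : ℕ}

theorem Setting.Standing.p_pos (hS : S.Standing) (n : ℕ) : 0 < S.p n := by
  by_contra h
  have h0 : S.p n = 0 := by omega
  have := hS.θ₀_norm n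
  have : IsEmpty (Fin (S.p n)) := by rw [h0]; infer_instance
  simp_all

theorem Setting.Standing.log_inv_δ (hS : S.Standing) (n : ℕ) : 1 < Real.log (4 / S.δ n) := by
  have h1 := hS.δ_pos n
  have h2 := hS.δ_lt n
  rw [Real.lt_log_iff_exp_lt (by positivity), lt_div_iff₀ h1]
  calc Real.exp 1 * S.δ n < Real.exp 1 * Real.exp (-1) := by gcongr
    _ = 1 := by rw [← Real.exp_add]; simp
    _ < 4 := by norm_num

theorem Setting.Standing.one_le_b (hS : S.Standing) : 1 ≤ S.b := by
  have := hS.D_prob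
  have hb0 : 0 ≤ S.b := by
    obtain ⟨x, hx⟩ := hS.D_bdd.exists
    exact (abs_nonneg x).trans hx
  have hv : variance id S.D = ∫ x, x ^ 2 ∂S.D := by
    rw [variance_of_integral_eq_zero aemeasurable_id (by simpa using hS.D_mean)]
    simp
  have hle : ∫ x, x ^ 2 ∂S.D ≤ ∫ _, S.b ^ 2 ∂S.D := by
    refine integral_mono_of_nonneg (ae_of_all _ fun x => sq_nonneg x) (integrable_const _) ?_
    filter_upwards [hS.D_bdd] with x hx
    exact sq_le_sq' (by linarith [(abs_le.1 hx).1]) (abs_le.1 hx).2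
  rw [← hv, hS.D_var] at hle
  simp only [integral_const, probReal_univ, smul_eq_mul, one_mul] at hle
  nlinarith

theorem Setting.Standing.w_pos (hS : S.Standing) (n : ℕ) : 0 < S.w n := by
  have h1 := hS.log_inv_δ n
  have h2 := hS.ε_pos n
  have hb := hS.one_le_b
  have hbn := hS.bn_pos n
  have hB : 0 < S.B n := by
    unfold Setting.B
    apply Real.sqrt_pos.2
    have : 0 < S.b * √(S.s₀ n : ℝ) + S.bn n := by positivity
    positivity
  unfold Setting.w
  apply Real.sqrt_pos.2
  have : 0 ≤ √(2 * (S.r n : ℝ) * Real.log (4 / S.δ n)) := Real.sqrt_nonneg _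
  positivity

theorem Setting.Standing.log_d_pos (hS : S.Standing) (n : ℕ) : 0 < Real.log (S.d n) := by
  apply Real.log_pos
  have : (1 : ℝ) ≤ S.p n := by exact_mod_cast hS.p_pos n
  unfold Setting.d
  linarith

theorem Setting.Standing.lam_pos (hS : S.Standing) {C : ℝ} (hC : 0 < C) {n : ℕ} (hn : 0 < n) :
    0 < S.lam C n := by
  have h1 := hS.log_d_pos n
  have h2 := hS.σ_pos
  have h3 : (0 : ℝ) < n := by exact_mod_cast hn
  unfold Setting.lam
  have : 0 < max √(Real.log (S.d n) / n) √(Real.log (S.d n) ^ 3 / S.r n) :=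
    lt_of_lt_of_le (Real.sqrt_pos.2 (by positivity)) (le_max_left _ _)
  positivity

theorem measurableSet_astar_generalPosition :
    MeasurableSet {e : EntryIndex S n → ℝ |
      GeneralPosition ((canonicalSample S n).Astar e).toCols₁} := by
  have : Continuous fun e : EntryIndex S n → ℝ => ((canonicalSample S n).Astar e).toCols₁ := by
    refine continuous_matrix fun a c => ?_
    exact (continuous_astar_canonical (S := S) (n := n)).matrix_elem a (Sum.inl c)
  exact (isOpen_generalPosition.preimage this).measurableSet

/-- The privatized design is almost surely in general position. -/
theorem ae_generalPosition (hS : S.Standing) (n : ℕ) :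
    ∀ᵐ e ∂Measure.pi (entryLaw S n),
      GeneralPosition ((canonicalSample S n).Astar e).toCols₁ := by
  refine ae_entries_of_forall hS n measurableSet_astar_generalPosition fun a b => ?_
  have hw := hS.w_pos n
  have hr := hS.r_pos n
  let A : Matrix (Fin n ⊕ ((Fin (S.p n) ⊕ Fin (S.p n)) ⊕ Unit)) (Fin (S.p n) ⊕ Fin (S.p n)) ℝ :=
    Matrix.of fun i k => Sum.elim (fun i => a (i, k))
      (Sum.elim (fun k' => if k' = k then S.w n else 0) (fun _ => 0)) i
  -- The block `w I` alone gives the augmented design full column rank, whatever the design is; `w >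
  -- 0` is essential here.
  let L : Matrix (Fin (S.p n) ⊕ Fin (S.p n)) (Fin n ⊕ ((Fin (S.p n) ⊕ Fin (S.p n)) ⊕ Unit)) ℝ :=
    Matrix.of fun k i => Sum.elim (fun _ => 0)
      (Sum.elim (fun k' => if k = k' then (S.w n)⁻¹ else 0) (fun _ => 0)) i
  have hL : L * A = 1 := by
    ext k k'
    simp [L, A, Matrix.mul_apply, Fintype.sum_sum_type, Matrix.one_apply, hw.ne']
  have hna : NullSingletonClass (S.projLaw n) := by
    refine nullSingletonClass_gaussianReal ?_
    have : (S.r n : NNReal) ≠ 0 := by exact_mod_cast hr.ne'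
    simpa using this
  have hpr : IsProbabilityMeasure (S.projLaw n) := by unfold Setting.projLaw; infer_instance
  filter_upwards [ae_generalPosition_mul (ρ := Fin (S.r n)) (S.projLaw n) A L hL] with c hc
  convert hc using 1
  ext i k
  rw [Matrix.toCols₁_apply, astar_canonical_inl]
  simp [A, Matrix.mul_apply, Fintype.sum_sum_type, mul_comm]

variable {Ω : Type*} [MeasurableSpace Ω]

theorem IsFeatureFunction.continuous {f : ℝ → ℝ → ℝ} (hf : IsFeatureFunction f) (a : ℝ) :
    Continuous fun x => f x a := by
  obtain ⟨L, -, hL⟩ := hf.lipschitz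
  exact (hL a).continuous

/-- Values of the privatized data matrix, as a plain function space. -/
abbrev DataSpace (S : Setting) (n : ℕ) : Type :=
  Fin (S.r n) → (Fin (S.p n) ⊕ Fin (S.p n)) ⊕ Unit → ℝ

/-- The privatized data as an element of `DataSpace`. -/
def Sample.data {Ω : Type*} (T : Sample S n Ω) (ω : Ω) : DataSpace S n :=
  fun i c => T.Astar ω i c

theorem continuous_data_canonical : Continuous (canonicalSample S n).data :=
  continuous_pi fun a => continuous_pi fun c =>
    (continuous_astar_canonical (S := S) (n := n)).matrix_elem a c

/-- The statistics as a function of the privatized data and the Lasso estimate. -/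
def statOf (S : Setting) (n : ℕ) (f : ℝ → ℝ → ℝ)
    (z : DataSpace S n × (Fin (S.p n) ⊕ Fin (S.p n) → ℝ)) :
    Fin (S.p n) → ℝ :=
  featureStat f (S.σ * S.ρ n)
    (debiased n (S.w n) (Matrix.of z.1).toCols₁ (fun i => z.1 i (Sum.inr ())) z.2)

theorem measurable_statOf {f : ℝ → ℝ → ℝ} (hf : IsFeatureFunction f) :
    Measurable (statOf S n f) := by
  apply Continuous.measurable
  refine continuous_pi fun j => ?_
  unfold statOf featureStat
  have hu : ∀ k, Continuous fun z : DataSpace S n ×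
      (Fin (S.p n) ⊕ Fin (S.p n) → ℝ) =>
      debiased n (S.w n) (Matrix.of z.1).toCols₁ (fun i => z.1 i (Sum.inr ())) z.2 k := by
    intro k
    simp only [debiased, Pi.add_apply, Pi.smul_apply, Matrix.mulVec, dotProduct,
      Matrix.transpose_apply, Matrix.toCols₁_apply, Matrix.of_apply, Pi.sub_apply]
    fun_prop
  exact ((hf.continuous _).comp (hu _)).sub ((hf.continuous _).comp (hu _))

variable {T : Sample S n Ω} {C : ℝ} {P : Measure Ω}

theorem Sample.IsModel.aemeasurable_data (h : T.IsModel C P) : AEMeasurable T.data P := by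
  have : T.data = (canonicalSample S n).data ∘ T.entryFun := by
    ext ω i c
    simp only [Sample.data, Function.comp_apply, T.astar_eq_canonical ω]
  rw [this]
  exact continuous_data_canonical.measurable.comp_aemeasurable h.hasLaw_entryFun.aemeasurable

theorem Sample.IsModel.aemeasurable_W (h : T.IsModel C P) {f : ℝ → ℝ → ℝ}
    (hf : IsFeatureFunction f) : AEMeasurable (T.W f) P := by
  have hW : T.W f = fun ω => statOf S n f (T.data ω, T.θhat ω) := by
    ext1 ω; rfl
  rw [hW]
  exact (measurable_statOf hf).comp_aemeasurable
    (h.aemeasurable_data.prodMk h.θhat_measurable.aemeasurable)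

/-- The swapped data have the same law as the data, and the swapped estimate solves the swapped
Lasso problem. Uniqueness makes the two pairs (data, estimate) equal in law, and the statistics of
the swapped pair are those of the original with the sign of the `j`-th one flipped. -/
theorem Sample.IsModel.map_flipSign_W (hS : S.Standing) (hC : 0 < C) (hn : 0 < n)
    (h : T.IsModel C P) {f : ℝ → ℝ → ℝ} (hf : IsFeatureFunction f) {j : Fin (S.p n)}
    (hj : S.θ₀ n j = 0) :
    P.map (fun ω => flipSign j (T.W f ω)) = P.map (T.W f) := by
  set A : Ω → DataSpace S n := T.data with hA
  have hcont : Continuous (canonicalSample S n).data := continuous_data_canonical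
  have hmp := measurePreserving_permEntries (n := n) hS (swapFeature j)
  set A' : Ω → DataSpace S n :=
    fun ω => (canonicalSample S n).data (T.entryFun ω ∘ permEntries (swapFeature j)) with hA'
  have hE := h.hasLaw_entryFun
  have hE' : HasLaw (fun ω => T.entryFun ω ∘ permEntries (swapFeature j))
      (Measure.pi (entryLaw S n)) P := hmp.fun_comp_hasLaw hE
  have hAe : A = fun ω => (canonicalSample S n).data (T.entryFun ω) := by
    ext ω i c
    simp only [hA, Sample.data, T.astar_eq_canonical ω]
  have hAm : AEMeasurable A P := h.aemeasurable_data
  have hAm' : AEMeasurable A' P := hcont.measurable.comp_aemeasurable hE'.aemeasurable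
  have hlaw : P.map A = P.map A' := by
    rw [hAe]
    have h1 := AEMeasurable.map_map_of_aemeasurable hcont.measurable.aemeasurable hE.aemeasurable
    have h2 := AEMeasurable.map_map_of_aemeasurable hcont.measurable.aemeasurable hE'.aemeasurable
    rw [hE.map_eq] at h1
    rw [hE'.map_eq] at h2
    exact h1.symm.trans h2
  -- Graph of the Lasso solution over data in general position. It is Borel (open condition and
  -- closed condition), and uniqueness makes the projection to the data injective on it.
  let Γ : Set (DataSpace S n ×
      (Fin (S.p n) ⊕ Fin (S.p n) → ℝ)) :=
    {z | GeneralPosition (Matrix.of z.1).toCols₁ ∧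
      IsLassoSolution n (S.lam C n) (Matrix.of z.1).toCols₁ (fun i => z.1 i (Sum.inr ())) z.2}
  have hΓ : MeasurableSet Γ := by
    refine MeasurableSet.inter ?_ ?_
    · have : Continuous fun z : DataSpace S n ×
          (Fin (S.p n) ⊕ Fin (S.p n) → ℝ) => (Matrix.of z.1).toCols₁ := by
        refine continuous_matrix fun a c => ?_
        simp only [Matrix.toCols₁_apply, Matrix.of_apply]
        fun_prop
      exact (isOpen_generalPosition.preimage this).measurableSet
    · refine IsClosed.measurableSet ?_
      have : {z : DataSpace S n ×
          (Fin (S.p n) ⊕ Fin (S.p n) → ℝ) | IsLassoSolution n (S.lam C n) (Matrix.of z.1).toCols₁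
            (fun i => z.1 i (Sum.inr ())) z.2} = ⋂ v : Fin (S.p n) ⊕ Fin (S.p n) → ℝ,
          {z | lassoObjective n (S.lam C n) (Matrix.of z.1).toCols₁
            (fun i => z.1 i (Sum.inr ())) z.2 ≤ lassoObjective n (S.lam C n)
              (Matrix.of z.1).toCols₁ (fun i => z.1 i (Sum.inr ())) v} := by
        ext z; simp [IsLassoSolution]
      change IsClosed {z : DataSpace S n ×
          (Fin (S.p n) ⊕ Fin (S.p n) → ℝ) | IsLassoSolution n (S.lam C n) (Matrix.of z.1).toCols₁
            (fun i => z.1 i (Sum.inr ())) z.2}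
      rw [this]
      refine isClosed_iInter fun v => ?_
      refine isClosed_le ?_ ?_ <;>
      · simp only [lassoObjective, Matrix.mulVec, dotProduct, Matrix.toCols₁_apply,
          Matrix.of_apply]
        fun_prop
  have hinj : Set.InjOn Prod.fst Γ := by
    rintro ⟨a, θ⟩ ⟨hg, hθ⟩ ⟨a', θ'⟩ ⟨-, hθ'⟩ haa
    simp only at haa
    subst haa
    exact Prod.ext rfl (hg.lasso_unique hn (hS.lam_pos hC hn) hθ hθ')
  have hgood : ∀ᵐ ω ∂P, GeneralPosition ((canonicalSample S n).Astar (T.entryFun ω)).toCols₁ :=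
    (hE.ae_iff (measurableSet_setOfPred.1 measurableSet_astar_generalPosition)).2
      (ae_generalPosition hS n)
  have hgood' : ∀ᵐ ω ∂P, GeneralPosition ((canonicalSample S n).Astar
      (T.entryFun ω ∘ permEntries (swapFeature j))).toCols₁ :=
    (hE'.ae_iff (measurableSet_setOfPred.1 measurableSet_astar_generalPosition)).2
      (ae_generalPosition hS n)
  have hsub : ∀ ω, ((canonicalSample S n).Astar
      (T.entryFun ω ∘ permEntries (swapFeature j))).toCols₁ =
      (T.Astar ω).toCols₁.submatrix id (swapFeature j) := by
    intro ω
    ext i k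
    rw [Matrix.toCols₁_apply, astar_permEntries_inl, Matrix.submatrix_apply, Matrix.toCols₁_apply,
      T.astar_eq_canonical]
    rfl
  have hy : ∀ ω i, A' ω i (Sum.inr ()) = A ω i (Sum.inr ()) := by
    intro ω i
    rw [hA', hAe]
    exact astar_swapFeature_inr hj _ _
  have hmem : ∀ᵐ ω ∂P, (A ω, T.θhat ω) ∈ Γ := by
    filter_upwards [hgood, h.θhat_lasso] with ω h1 h2
    refine ⟨?_, h2⟩
    rw [← T.astar_eq_canonical] at h1
    exact h1
  have hmem' : ∀ᵐ ω ∂P, (A' ω, T.θhat ω ∘ swapFeature j) ∈ Γ := by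
    filter_upwards [hgood', h.θhat_lasso] with ω h1 h2
    refine ⟨h1, ?_⟩
    have h3 := isLassoSolution_submatrix h2 (swapFeature j)
    have h4 : (fun i => A' ω i (Sum.inr ())) = T.ystar ω := by
      ext i; exact hy ω i
    simp only [h4]
    have h5 : (Matrix.of (A' ω)).toCols₁ = (T.Xstar ω).submatrix id (swapFeature j) := hsub ω
    rw [h5]
    exact h3
  have hθm' : AEMeasurable (fun ω => T.θhat ω ∘ swapFeature j) P := by
    refine Measurable.aemeasurable ?_
    exact measurable_pi_lambda _ fun k => (measurable_pi_apply _).comp h.θhat_measurable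
  have hjoint := map_prodMk_eq_of_mem_graph hAm hAm' h.θhat_measurable.aemeasurable hθm' hlaw hΓ
    hinj hmem hmem'
  have hstat : ∀ ω, statOf S n f (A' ω, T.θhat ω ∘ swapFeature j) = flipSign j (T.W f ω) := by
    intro ω
    have h4 : (fun i => A' ω i (Sum.inr ())) = T.ystar ω := by
      ext i; exact hy ω i
    have h5 : (Matrix.of (A' ω)).toCols₁ = (T.Xstar ω).submatrix id (swapFeature j) := hsub ω
    unfold statOf
    simp only [h4, h5]
    rw [debiased_submatrix, featureStat_swapFeature]
    rfl
  have h1 := AEMeasurable.map_map_of_aemeasurable (measurable_statOf (S := S) (n := n) hf).aemeasurable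
    (hAm.prodMk h.θhat_measurable.aemeasurable)
  have h2 := AEMeasurable.map_map_of_aemeasurable (measurable_statOf (S := S) (n := n) hf).aemeasurable
    (hAm'.prodMk hθm')
  rw [← hjoint] at h2
  have e2 : (fun ω => flipSign j (T.W f ω)) =
      statOf S n f ∘ fun ω => (A' ω, T.θhat ω ∘ swapFeature j) := by
    ext1 ω; exact (hstat ω).symm
  rw [e2, ← h2, h1]
  rfl

/-- Finite-sample control of the false discovery rate in the model. -/
theorem Sample.IsModel.fdr_control [IsProbabilityMeasure P] (hS : S.Standing) (hC : 0 < C)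
    (hn : 0 < n) (h : T.IsModel C P) {f : ℝ → ℝ → ℝ} (hf : IsFeatureFunction f) {q : ℝ}
    (hq : 0 < q) :
    Integrable (fun ω => FDP (S.θ₀ n) (T.W f ω) (knockoffThreshold q (T.W f ω))) P ∧
      ∫ ω, FDP (S.θ₀ n) (T.W f ω) (knockoffThreshold q (T.W f ω)) ∂P ≤ q :=
  knockoff_fdr_control _ (h.aemeasurable_W hf) (fun _ hj => h.map_flipSign_W hS hC hn hf hj) hq

end ModelFDR

/-! ### Second moments of sums over independent rows -/

theorem lintegral_sq_sub_integral {Ω : Type*} [MeasurableSpace Ω] {P : Measure Ω}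
    [IsFiniteMeasure P] {X : Ω → ℝ} (hX : MemLp X 2 P) :
    ∫⁻ ω, ENNReal.ofReal ((X ω - ∫ ω', X ω' ∂P) ^ 2) ∂P = ENNReal.ofReal (variance X P) := by
  rw [ofReal_variance hX, evariance_eq_lintegral_ofReal]

section Rows

variable {I K : Type*} [Fintype I] [Fintype K] (ν : Measure ℝ) [IsProbabilityMeasure ν]

/-- The summands depend on disjoint sets of independent coordinates, so their variances add. -/
theorem variance_sum_rows {h : I → (K → ℝ) → ℝ} (hm : ∀ i, Measurable (h i))
    (hL : ∀ i, MemLp (fun c : I × K → ℝ => h i fun k => c (i, k)) 2 (Measure.pi fun _ => ν)) :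
    variance (fun c : I × K → ℝ => ∑ i, h i fun k => c (i, k)) (Measure.pi fun _ => ν) =
      ∑ i, variance (fun c : I × K → ℝ => h i fun k => c (i, k)) (Measure.pi fun _ => ν) := by
  classical
  have e : (fun c : I × K → ℝ => ∑ i, h i fun k => c (i, k)) =
      ∑ i, fun c : I × K → ℝ => h i fun k => c (i, k) := by
    ext c; simp
  rw [e, IndepFun.variance_sum (fun i _ => hL i)]
  intro i _ j _ hij
  have hind : iIndepFun (fun (q : I × K) (c : I × K → ℝ) => c q) (Measure.pi fun _ => ν) :=
    iIndepFun_pi (X := fun _ x => x) (fun _ => aemeasurable_id)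
  have := hind.indepFun_finset (Finset.univ.filter fun q : I × K => q.1 = i)
    (Finset.univ.filter fun q : I × K => q.1 = j)
    (by
      rw [Finset.disjoint_left]
      intro q hq hq'
      simp only [Finset.mem_filter, Finset.mem_univ, true_and] at hq hq'
      exact hij (hq.symm.trans hq'))
    (fun q => measurable_pi_apply q)
  have h2 := this.comp
    (φ := fun y => h i fun k => y ⟨(i, k), by simp⟩) (ψ := fun y => h j fun k => y ⟨(j, k), by simp⟩)
    ((hm i).comp (measurable_pi_lambda _ fun k => measurable_pi_apply _))
    ((hm j).comp (measurable_pi_lambda _ fun k => measurable_pi_apply _))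
  exact h2

end Rows

/-! ### Gaussian random projections -/

/-- Fourth moment of the standard normal distribution. -/
def gaussFourth : ℝ := ∫ x, x ^ 4 ∂gaussianReal 0 1

theorem gaussFourth_nonneg : 0 ≤ gaussFourth :=
  integral_nonneg fun x => by positivity

theorem integral_pow_four_gaussianReal (v : NNReal) :
    ∫ x, x ^ 4 ∂gaussianReal 0 v = (v : ℝ) ^ 2 * gaussFourth := by
  have h : gaussianReal 0 v = (gaussianReal 0 1).map (fun x => √(v : ℝ) * x) := by
    have := gaussianReal_map_const_mul (μ := 0) (v := 1) (√(v : ℝ))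
    rw [this]
    congr 1
    · simp
    · ext; simp
  rw [h, integral_map (by fun_prop) (by fun_prop), gaussFourth, ← integral_const_mul]
  congr 1
  ext x
  rw [mul_pow, show √(v : ℝ) ^ 4 = (√(v : ℝ) ^ 2) ^ 2 by ring, Real.sq_sqrt v.coe_nonneg]

section Projection

variable {I K : Type*} [Fintype I] [Fintype K] (v : NNReal)

/-- Linear form in the entries of row `a`. -/
def rowForm (a : I) (u : K → ℝ) (c : I × K → ℝ) : ℝ := ∑ k, c (a, k) * u k

theorem hasLaw_rowForm (a : I) (u : K → ℝ) :
    HasLaw (rowForm a u) (gaussianReal 0 (v * ∑ k, Real.toNNReal (u k ^ 2)))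
      (Measure.pi fun _ : I × K => gaussianReal 0 v) := by
  set P := Measure.pi fun _ : I × K => gaussianReal 0 v with hP
  have hlaw : ∀ q : I × K, HasLaw (fun c : I × K → ℝ => c q) (gaussianReal 0 v) P := fun q =>
    (measurePreserving_eval (fun _ : I × K => gaussianReal 0 v) q).hasLaw
  have hlawk : ∀ k, HasLaw (fun c : I × K → ℝ => c (a, k) * u k)
      (gaussianReal 0 (Real.toNNReal (u k ^ 2) * v)) P := by
    intro k
    have := gaussianReal_mul_const (hlaw (a, k)) (u k)
    convert this using 2
    · simp
    · ext; simp [Real.toNNReal_of_nonneg, sq_nonneg]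
  have hind : iIndepFun (fun (k : K) (c : I × K → ℝ) => c (a, k) * u k) P := by
    have h0 : iIndepFun (fun (q : I × K) (c : I × K → ℝ) => c q) P :=
      iIndepFun_pi (X := fun _ x => x) (fun _ => aemeasurable_id)
    have h1 := h0.precomp (g := fun k : K => (a, k)) (fun k k' h => by simpa using h)
    exact h1.comp (fun k x => x * u k) (fun k => by fun_prop)
  have hG : ∀ k, HasGaussianLaw (fun c : I × K → ℝ => c (a, k) * u k) P := fun k =>
    ⟨by rw [(hlawk k).map_eq]; infer_instance⟩
  have hsum : HasGaussianLaw (fun c => ∑ k, c (a, k) * u k) P := by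
    have := (hind.hasGaussianLaw hG).sum
    have e : (fun c : I × K → ℝ => ∑ k, c (a, k) * u k) =
        ∑ k, fun c : I × K → ℝ => c (a, k) * u k := by
      ext c; simp
    rw [e]
    exact this
  have hmem : ∀ k, MemLp (fun c : I × K → ℝ => c (a, k) * u k) 2 P := fun k => (hG k).memLp_two
  have hmean : ∫ c, rowForm a u c ∂P = 0 := by
    unfold rowForm
    rw [integral_finsetSum _ fun k _ => (hmem k).integrable (by norm_num)]
    refine Finset.sum_eq_zero fun k _ => ?_
    rw [(hlawk k).integral_eq, integral_id_gaussianReal]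
  have hvar : variance (rowForm a u) P = ∑ k, u k ^ 2 * v := by
    have e : rowForm a u = ∑ k, fun c : I × K → ℝ => c (a, k) * u k := by
      ext c; simp [rowForm]
    rw [e, IndepFun.variance_sum (fun k _ => hmem k) (fun i _ j _ hij => hind.indepFun hij)]
    refine Finset.sum_congr rfl fun k _ => ?_
    rw [(hlawk k).variance_eq, variance_id_gaussianReal]
    simp [sq_nonneg]
  refine ⟨hsum.aemeasurable, ?_⟩
  have := hsum.map_eq_gaussianReal
  change P.map (rowForm a u) = gaussianReal (∫ c, rowForm a u c ∂P) (variance (rowForm a u) P).toNNReal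
    at this
  rw [this, hmean, hvar]
  congr 1
  ext
  rw [Real.coe_toNNReal _ (Finset.sum_nonneg fun k _ => by positivity)]
  push_cast
  rw [Finset.mul_sum]
  refine Finset.sum_congr rfl fun k _ => ?_
  rw [Real.coe_toNNReal _ (sq_nonneg _)]; ring

theorem memLp_rowForm (a : I) (u : K → ℝ) (q : ENNReal) (hq : q ≠ ⊤) :
    MemLp (rowForm a u) q (Measure.pi fun _ : I × K => gaussianReal 0 v) := by
  have h := memLp_id_gaussianReal' (μ := 0) (v := v * ∑ k, Real.toNNReal (u k ^ 2)) q hq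
  rw [← (hasLaw_rowForm (I := I) v a u).map_eq] at h
  have := h.comp_of_map (hasLaw_rowForm (I := I) v a u).aemeasurable
  simpa using this

theorem integral_rowForm_sq (a : I) (u : K → ℝ) :
    ∫ c, rowForm a u c ^ 2 ∂(Measure.pi fun _ : I × K => gaussianReal 0 v) =
      v * ∑ k, u k ^ 2 := by
  have hl := hasLaw_rowForm (I := I) v a u
  have h0 : ∫ c, rowForm a u c ∂(Measure.pi fun _ : I × K => gaussianReal 0 v) = 0 := by
    rw [hl.integral_eq, integral_id_gaussianReal]
  have := hl.variance_eq
  rw [variance_of_integral_eq_zero hl.aemeasurable h0, variance_id_gaussianReal] at this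
  rw [this]
  push_cast
  congr 1
  exact Finset.sum_congr rfl fun k _ => Real.coe_toNNReal _ (sq_nonneg _)

theorem integral_rowForm_pow_four (a : I) (u : K → ℝ) :
    ∫ c, rowForm a u c ^ 4 ∂(Measure.pi fun _ : I × K => gaussianReal 0 v) =
      (v * ∑ k, u k ^ 2) ^ 2 * gaussFourth := by
  have hl := hasLaw_rowForm (I := I) v a u
  have := hl.integral_comp (f := fun x : ℝ => x ^ 4) (by fun_prop)
  simp only [Function.comp_def] at this
  rw [this, integral_pow_four_gaussianReal]
  congr 2
  push_cast
  congr 1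
  exact Finset.sum_congr rfl fun k _ => Real.coe_toNNReal _ (sq_nonneg _)

theorem memLp_rowForm_mul (a : I) (u u' : K → ℝ) :
    MemLp (fun c => rowForm a u c * rowForm a u' c) 2
      (Measure.pi fun _ : I × K => gaussianReal 0 v) := by
  have : ENNReal.HolderTriple 4 4 2 := ⟨by
    rw [← two_mul, show (4 : ENNReal) = 2 * 2 by norm_num,
      ENNReal.mul_inv (by simp) (by simp), ← mul_assoc, ENNReal.mul_inv_cancel (by simp) (by simp),
      one_mul]⟩
  exact (memLp_rowForm v a u' 4 (by simp)).mul' (memLp_rowForm v a u 4 (by simp))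

theorem integral_rowForm_mul (a : I) (u u' : K → ℝ) :
    ∫ c, rowForm a u c * rowForm a u' c ∂(Measure.pi fun _ : I × K => gaussianReal 0 v) =
      v * ∑ k, u k * u' k := by
  set P := Measure.pi fun _ : I × K => gaussianReal 0 v with hP
  have hadd : ∀ c : I × K → ℝ, rowForm a u c * rowForm a u' c =
      1 / 2 * (rowForm a (u + u') c ^ 2 - rowForm a u c ^ 2 - rowForm a u' c ^ 2) := by
    intro c
    have : rowForm a (u + u') c = rowForm a u c + rowForm a u' c := by
      simp [rowForm, mul_add, Finset.sum_add_distrib]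
    rw [this]; ring
  have hi : ∀ u : K → ℝ, Integrable (fun c => rowForm a u c ^ 2) P := fun u =>
    (memLp_rowForm v a u 2 (by simp)).integrable_sq
  simp_rw [hadd]
  have hi2 : Integrable (fun c => rowForm a (u + u') c ^ 2 - rowForm a u c ^ 2) P :=
    (hi _).sub (hi _)
  rw [integral_const_mul, integral_sub hi2 (hi _), integral_sub (hi _) (hi _), integral_rowForm_sq, integral_rowForm_sq, integral_rowForm_sq]
  have : ∑ k, (u + u') k ^ 2 = ∑ k, u k ^ 2 + ∑ k, u' k ^ 2 + 2 * ∑ k, u k * u' k := by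
    rw [Finset.mul_sum, ← Finset.sum_add_distrib, ← Finset.sum_add_distrib]
    exact Finset.sum_congr rfl fun k _ => by simp; ring
  rw [this]; ring

/-- Weighted arithmetic–geometric mean inequality, with weights `B/(2A)` and `A/(2B)` chosen so that
the two fourth moments balance to the product `A B`. A vector of norm zero makes its form vanish and
is treated apart. -/
theorem integral_rowForm_mul_sq_le (a : I) (u u' : K → ℝ) :
    ∫ c, (rowForm a u c * rowForm a u' c) ^ 2 ∂(Measure.pi fun _ : I × K => gaussianReal 0 v) ≤
      gaussFourth * v ^ 2 * ((∑ k, u k ^ 2) * ∑ k, u' k ^ 2) := by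
  set P := Measure.pi fun _ : I × K => gaussianReal 0 v with hP
  set A := ∑ k, u k ^ 2 with hA
  set B := ∑ k, u' k ^ 2 with hB
  have hA0 : 0 ≤ A := Finset.sum_nonneg fun k _ => sq_nonneg _
  have hB0 : 0 ≤ B := Finset.sum_nonneg fun k _ => sq_nonneg _
  have hzero : ∀ u : K → ℝ, ∑ k, u k ^ 2 = 0 → ∀ c : I × K → ℝ, rowForm a u c = 0 := by
    intro u hu c
    rw [Finset.sum_eq_zero_iff_of_nonneg (fun i _ => sq_nonneg _)] at hu
    unfold rowForm
    refine Finset.sum_eq_zero fun k hk => ?_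
    have : u k = 0 := by simpa using hu k hk
    rw [this, mul_zero]
  have hrhs : 0 ≤ gaussFourth * (v : ℝ) ^ 2 * (A * B) := by
    have := gaussFourth_nonneg
    positivity
  rcases hA0.eq_or_lt with h0 | hApos
  · simp only [hzero u h0.symm, zero_mul]
    simpa using hrhs
  rcases hB0.eq_or_lt with h0 | hBpos
  · simp only [hzero u' h0.symm, mul_zero]
    simpa using hrhs
  have hi : ∀ u : K → ℝ, Integrable (fun c => rowForm a u c ^ 4) P := by
    intro u
    have := (memLp_rowForm v a u 4 (by simp) : MemLp (rowForm a u) 4 P).integrable_norm_pow'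
    refine this.congr (ae_of_all _ fun c => ?_)
    simp only [Real.norm_eq_abs]
    exact Even.pow_abs (by decide) _
  calc ∫ c, (rowForm a u c * rowForm a u' c) ^ 2 ∂P
      ≤ ∫ c, (B / (2 * A) * rowForm a u c ^ 4 + A / (2 * B) * rowForm a u' c ^ 4) ∂P := by
        refine integral_mono (memLp_rowForm_mul v a u u').integrable_sq
          (((hi u).const_mul _).add ((hi u').const_mul _)) fun c => ?_
        set x := rowForm a u c
        set y := rowForm a u' c
        have : B / (2 * A) * x ^ 4 + A / (2 * B) * y ^ 4 - (x * y) ^ 2 =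
            (B * x ^ 2 - A * y ^ 2) ^ 2 / (2 * A * B) := by
          field_simp; ring
        have h2 : 0 ≤ (B * x ^ 2 - A * y ^ 2) ^ 2 / (2 * A * B) := by positivity
        simp only
        linarith
    _ = gaussFourth * v ^ 2 * (A * B) := by
        rw [integral_add ((hi u).const_mul _) ((hi u').const_mul _), integral_const_mul,
          integral_const_mul, integral_rowForm_pow_four, integral_rowForm_pow_four, ← hA, ← hB]
        field_simp
        ring

/-- A Gaussian random projection preserves inner products up to a relative error of order
`1 / √r` in mean square. -/
theorem lintegral_projection_sq_le [Nonempty I] (hv : (v : ℝ) = 1 / Fintype.card I)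
    (u u' : K → ℝ) :
    ∫⁻ c, ENNReal.ofReal ((∑ a, rowForm a u c * rowForm a u' c - ∑ k, u k * u' k) ^ 2)
        ∂(Measure.pi fun _ : I × K => gaussianReal 0 v) ≤
      ENNReal.ofReal (gaussFourth / Fintype.card I * ((∑ k, u k ^ 2) * ∑ k, u' k ^ 2)) := by
  set P := Measure.pi fun _ : I × K => gaussianReal 0 v with hP
  have hcard : (0 : ℝ) < Fintype.card I := by exact_mod_cast Fintype.card_pos
  have hL := fun a => memLp_rowForm_mul (I := I) v a u u'
  have hmean : ∫ c, ∑ a, rowForm a u c * rowForm a u' c ∂P = ∑ k, u k * u' k := by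
    rw [integral_finsetSum _ fun a _ => (hL a).integrable (by norm_num)]
    rw [Finset.sum_congr rfl fun a _ => integral_rowForm_mul v a u u']
    rw [Finset.sum_const, Finset.card_univ, nsmul_eq_mul, hv]
    field_simp
  have hsum : MemLp (fun c => ∑ a, rowForm a u c * rowForm a u' c) 2 P :=
    memLp_finsetSum _ fun a _ => hL a
  have := lintegral_sq_sub_integral hsum
  rw [hmean] at this
  rw [this]
  apply ENNReal.ofReal_le_ofReal
  have hvar := variance_sum_rows (I := I) (K := K) (gaussianReal 0 v)
    (h := fun _ y => (∑ k, y k * u k) * ∑ k, y k * u' k) (fun _ => by fun_prop) hL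
  change variance (fun c : I × K → ℝ => ∑ a, rowForm a u c * rowForm a u' c) P =
    ∑ a, variance (fun c : I × K → ℝ => rowForm a u c * rowForm a u' c) P at hvar
  rw [hvar]
  calc ∑ a, variance (fun c : I × K → ℝ => rowForm a u c * rowForm a u' c) P
      ≤ ∑ _a : I, gaussFourth * (v : ℝ) ^ 2 * ((∑ k, u k ^ 2) * ∑ k, u' k ^ 2) := by
        refine Finset.sum_le_sum fun a _ => ?_
        exact (variance_le_expectation_sq (hL a).aestronglyMeasurable).trans
          (integral_rowForm_mul_sq_le v a u u')
    _ = gaussFourth / Fintype.card I * ((∑ k, u k ^ 2) * ∑ k, u' k ^ 2) := by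
        rw [Finset.sum_const, Finset.card_univ, nsmul_eq_mul, hv]
        field_simp

end Projection

/-! ### Mean-square size of the noise term and of the error of the Gram matrix -/

/-- The part of the estimation error of the debiased Lasso that does not involve the Lasso. -/
def noiseTerm {ρ κ : Type*} [Fintype ρ] [Fintype κ] (n : ℕ) (w : ℝ) (M : Matrix ρ κ ℝ)
    (y : ρ → ℝ) (θ : κ → ℝ) (k : κ) : ℝ :=
  1 / (n : ℝ) * ∑ a, M a k * (y - M.mulVec θ) a + w ^ 2 / n * θ k

/-- Deviation of the normalized Gram matrix from its expectation `(1 + w²/n) I`. -/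
def gramError {ρ κ : Type*} [Fintype ρ] [DecidableEq κ] (n : ℕ) (w : ℝ)
    (M : Matrix ρ κ ℝ) (k l : κ) : ℝ :=
  (if k = l then 1 + w ^ 2 / (n : ℝ) else 0) - 1 / (n : ℝ) * ∑ a, M a k * M a l

theorem lintegral_ofReal_mul_add_le {α : Type*} [MeasurableSpace α] {μ : Measure α}
    [IsProbabilityMeasure μ] {g : α → ℝ} (hg : Measurable g) (hg0 : ∀ x, 0 ≤ g x) {A B m : ℝ}
    (hA : 0 ≤ A) (hB : 0 ≤ B) (hm : 0 ≤ m)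
    (h : ∫⁻ x, ENNReal.ofReal (g x) ∂μ ≤ ENNReal.ofReal m) :
    ∫⁻ x, ENNReal.ofReal (A * g x + B) ∂μ ≤ ENNReal.ofReal (A * m + B) := by
  have e : ∀ x, ENNReal.ofReal (A * g x + B) =
      ENNReal.ofReal A * ENNReal.ofReal (g x) + ENNReal.ofReal B := by
    intro x
    rw [ENNReal.ofReal_add (mul_nonneg hA (hg0 x)) hB, ENNReal.ofReal_mul hA]
  simp_rw [e]
  rw [lintegral_add_right _ measurable_const, lintegral_const_mul _ hg.ennreal_ofReal,
    lintegral_const, measure_univ, mul_one, ENNReal.ofReal_add (mul_nonneg hA hm) hB,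
    ENNReal.ofReal_mul hA]
  gcongr

/-! ### Second moments of the bounded design. -/

section Design

variable {I K : Type*} [Fintype I] [Fintype K] {S : Setting}

theorem Setting.Standing.integral_sq (hS : S.Standing) : ∫ x, x ^ 2 ∂S.D = 1 := by
  have := hS.D_prob
  rw [← hS.D_var, variance_of_integral_eq_zero aemeasurable_id (by simpa using hS.D_mean)]
  simp

theorem Setting.Standing.ae_entries_bdd (hS : S.Standing) :
    ∀ᵐ a ∂(Measure.pi fun _ : I × K => S.D), ∀ q, |a q| ≤ S.b := by
  have := hS.D_prob
  rw [ae_all_iff]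
  intro q
  exact (Measure.quasiMeasurePreserving_eval (fun _ : I × K => S.D) q).ae hS.D_bdd

theorem Setting.Standing.integral_entry (hS : S.Standing) (q : I × K) :
    ∫ a, a q ∂(Measure.pi fun _ : I × K => S.D) = 0 := by
  have := hS.D_prob
  rw [(measurePreserving_eval (fun _ : I × K => S.D) q).hasLaw.integral_eq]
  exact hS.D_mean

theorem Setting.Standing.integral_entry_mul [DecidableEq K] (hS : S.Standing) (i : I) (k l : K) :
    ∫ a, a (i, k) * a (i, l) ∂(Measure.pi fun _ : I × K => S.D) = if k = l then 1 else 0 := by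
  have := hS.D_prob
  split_ifs with h
  · subst h
    have hl := (measurePreserving_eval (fun _ : I × K => S.D) (i, k)).hasLaw
    have := hl.integral_comp (f := fun x : ℝ => x ^ 2) (by fun_prop)
    rw [hS.integral_sq] at this
    rw [← this]
    congr 1
    ext a
    simp [Function.eval]
    ring
  · have hind : iIndepFun (fun (q : I × K) (c : I × K → ℝ) => c q)
        (Measure.pi fun _ => S.D) :=
      iIndepFun_pi (X := fun _ x => x) (fun _ => aemeasurable_id)
    have hne : (i, k) ≠ (i, l) := by simpa using h
    have := (hind.indepFun hne).integral_fun_mul_eq_mul_integral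
      (measurable_pi_apply _).aestronglyMeasurable (measurable_pi_apply _).aestronglyMeasurable
    rw [this, hS.integral_entry, zero_mul]

theorem memLp_of_ae_bdd {Ω : Type*} [MeasurableSpace Ω] {P : Measure Ω} [IsFiniteMeasure P]
    {X : Ω → ℝ} (hX : Measurable X) {B : ℝ} (h : ∀ᵐ ω ∂P, |X ω| ≤ B) : MemLp X 2 P :=
  MemLp.of_bound hX.aestronglyMeasurable B h

/-- Empirical second moments of the design concentrate in mean square. -/
theorem Setting.Standing.lintegral_gram_sq_le [DecidableEq K] (hS : S.Standing) (k l : K) :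
    ∫⁻ a, ENNReal.ofReal ((∑ i : I, a (i, k) * a (i, l) -
        Fintype.card I * (if k = l then 1 else 0)) ^ 2) ∂(Measure.pi fun _ : I × K => S.D) ≤
      ENNReal.ofReal (Fintype.card I * S.b ^ 4) := by
  have := hS.D_prob
  have hb := hS.one_le_b
  set P := Measure.pi fun _ : I × K => S.D with hP
  have hbd : ∀ i : I, ∀ᵐ a ∂P, |a (i, k) * a (i, l)| ≤ S.b ^ 2 := by
    intro i
    filter_upwards [hS.ae_entries_bdd (I := I) (K := K)] with a ha
    rw [abs_mul, sq]
    exact mul_le_mul (ha _) (ha _) (abs_nonneg _) (by linarith)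
  have hL : ∀ i : I, MemLp (fun a : I × K → ℝ => a (i, k) * a (i, l)) 2 P := fun i =>
    memLp_of_ae_bdd (by fun_prop) (hbd i)
  have hmean : ∫ a, ∑ i : I, a (i, k) * a (i, l) ∂P =
      Fintype.card I * (if k = l then 1 else 0) := by
    rw [integral_finsetSum _ fun i _ => (hL i).integrable (by norm_num)]
    simp only [hP, hS.integral_entry_mul]
    simp
  have hsum : MemLp (fun a : I × K → ℝ => ∑ i : I, a (i, k) * a (i, l)) 2 P :=
    memLp_finsetSum _ fun i _ => hL i
  have h1 := lintegral_sq_sub_integral hsum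
  rw [hmean] at h1
  rw [h1]
  apply ENNReal.ofReal_le_ofReal
  have hvar := variance_sum_rows (I := I) (K := K) S.D
    (h := fun _ y => y k * y l) (fun _ => by fun_prop) hL
  rw [hvar]
  calc ∑ i : I, variance (fun a : I × K → ℝ => a (i, k) * a (i, l)) P
      ≤ ∑ _i : I, S.b ^ 4 := by
        refine Finset.sum_le_sum fun i _ => ?_
        refine (variance_le_expectation_sq (hL i).aestronglyMeasurable).trans ?_
        calc ∫ a, (a (i, k) * a (i, l)) ^ 2 ∂P ≤ ∫ _, S.b ^ 4 ∂P := by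
              refine integral_mono_ae (hL i).integrable_sq (integrable_const _) ?_
              filter_upwards [hbd i] with a ha
              have := pow_le_pow_left₀ (abs_nonneg _) ha 2
              rw [sq_abs] at this
              calc _ ≤ _ := this
                _ = S.b ^ 4 := by ring
          _ = S.b ^ 4 := by simp
    _ = Fintype.card I * S.b ^ 4 := by simp

/-- Mean-square size of the correlation of a design column with a fixed vector. -/
theorem Setting.Standing.lintegral_corr_sq (hS : S.Standing) (k : K) (x : I → ℝ) :
    ∫⁻ a, ENNReal.ofReal ((∑ i : I, a (i, k) * x i) ^ 2) ∂(Measure.pi fun _ : I × K => S.D) =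
      ENNReal.ofReal (∑ i, x i ^ 2) := by
  have := hS.D_prob
  classical
  set P := Measure.pi fun _ : I × K => S.D with hP
  have hL0 : ∀ i : I, MemLp (fun a : I × K → ℝ => a (i, k)) 2 P := fun i =>
    memLp_of_ae_bdd (by fun_prop) (B := S.b) (by
      filter_upwards [hS.ae_entries_bdd (I := I) (K := K)] with a ha using ha _)
  have hL : ∀ i : I, MemLp (fun a : I × K → ℝ => a (i, k) * x i) 2 P := fun i =>
    (hL0 i).mul_const (x i)
  have hm0 : ∀ i : I, ∫ a, a (i, k) * x i ∂P = 0 := by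
    intro i
    rw [integral_mul_const, hS.integral_entry, zero_mul]
  have hmean : ∫ a, ∑ i : I, a (i, k) * x i ∂P = 0 := by
    rw [integral_finsetSum _ fun i _ => (hL i).integrable (by norm_num)]
    simp [hm0]
  have hsum : MemLp (fun a : I × K → ℝ => ∑ i : I, a (i, k) * x i) 2 P :=
    memLp_finsetSum _ fun i _ => hL i
  have h1 := lintegral_sq_sub_integral hsum
  rw [hmean] at h1
  simp only [sub_zero] at h1
  rw [h1]
  congr 1
  have hvar := variance_sum_rows (I := I) (K := K) S.D
    (h := fun i y => y k * x i) (fun _ => by fun_prop) hL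
  rw [hvar]
  refine Finset.sum_congr rfl fun i _ => ?_
  rw [variance_of_integral_eq_zero (hL i).aemeasurable (hm0 i)]
  have : ∀ a : I × K → ℝ, (a (i, k) * x i) ^ 2 = x i ^ 2 * (a (i, k) * a (i, k)) := fun a => by ring
  simp_rw [this]
  rw [integral_const_mul, hS.integral_entry_mul]
  simp

end Design

/-! ### Mean squares of Gram error and noise term in the model. -/

section ModelMoments

variable {S : Setting} {n : ℕ}

/-- True coefficients, extended by zero to the knockoffs. -/
def Setting.θext (S : Setting) (n : ℕ) : Fin (S.p n) ⊕ Fin (S.p n) → ℝ :=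
  Sum.elim (S.θ₀ n) fun _ => 0

/-- Column `k` of the augmented design. -/
def augCol (S : Setting) (n : ℕ) (a : Fin n × (Fin (S.p n) ⊕ Fin (S.p n)) → ℝ)
    (k : Fin (S.p n) ⊕ Fin (S.p n)) : Fin n ⊕ ((Fin (S.p n) ⊕ Fin (S.p n)) ⊕ Unit) → ℝ :=
  Sum.elim (fun i => a (i, k)) (Sum.elim (fun l => if l = k then S.w n else 0) fun _ => 0)

/-- Residual of the augmented response at the true coefficients. -/
def augResidual (S : Setting) (n : ℕ) (b : Fin n → ℝ) :
    Fin n ⊕ ((Fin (S.p n) ⊕ Fin (S.p n)) ⊕ Unit) → ℝ :=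
  Sum.elim b (Sum.elim (fun l => -(S.w n * S.θext n l)) fun _ => S.w n)

theorem xstar_eq_rowForm (a : Fin n × (Fin (S.p n) ⊕ Fin (S.p n)) → ℝ) (b : Fin n → ℝ)
    (c : Fin (S.r n) × (Fin n ⊕ ((Fin (S.p n) ⊕ Fin (S.p n)) ⊕ Unit)) → ℝ) (i : Fin (S.r n))
    (k : Fin (S.p n) ⊕ Fin (S.p n)) :
    (canonicalSample S n).Xstar (Sum.elim a (Sum.elim b c)) i k =
      rowForm i (augCol S n a k) c := by
  rw [Sample.Xstar, Matrix.toCols₁_apply, astar_canonical_inl]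
  simp [rowForm, augCol, Fintype.sum_sum_type, mul_comm]

theorem residual_eq_rowForm (a : Fin n × (Fin (S.p n) ⊕ Fin (S.p n)) → ℝ) (b : Fin n → ℝ)
    (c : Fin (S.r n) × (Fin n ⊕ ((Fin (S.p n) ⊕ Fin (S.p n)) ⊕ Unit)) → ℝ) (i : Fin (S.r n)) :
    ((canonicalSample S n).ystar (Sum.elim a (Sum.elim b c)) -
      ((canonicalSample S n).Xstar (Sum.elim a (Sum.elim b c))).mulVec (S.θext n)) i =
      rowForm i (augResidual S n b) c := by
  rw [Pi.sub_apply, Sample.ystar, astar_canonical_inr]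
  have h1 : ∀ k, rowForm i (augCol S n a k) c =
      ∑ i', c (i, Sum.inl i') * a (i', k) + S.w n * c (i, Sum.inr (Sum.inl k)) := by
    intro k
    simp [rowForm, augCol, Fintype.sum_sum_type, mul_comm]
  have h2 : rowForm i (augResidual S n b) c = ∑ i', c (i, Sum.inl i') * b i' -
      S.w n * ∑ j, c (i, Sum.inr (Sum.inl (Sum.inl j))) * S.θ₀ n j +
      S.w n * c (i, Sum.inr (Sum.inr ())) := by
    simp only [rowForm, augResidual, Setting.θext, Fintype.sum_sum_type, Sum.elim_inl,
      Sum.elim_inr, Finset.univ_unique, Finset.sum_singleton, mul_zero, neg_zero,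
      Finset.sum_const_zero, add_zero, Finset.mul_sum, sub_eq_add_neg, ← Finset.sum_neg_distrib,
      add_assoc]
    refine congrArg₂ _ rfl (congrArg₂ _ (Finset.sum_congr rfl fun j _ => by ring) (mul_comm _ _))
  simp only [Matrix.mulVec, dotProduct, xstar_eq_rowForm, h1, h2, Fintype.sum_sum_type,
    Setting.θext, Sum.elim_inl, Sum.elim_inr, mul_zero, Finset.sum_const_zero, add_zero]
  have h3 : ∑ j, (∑ i', c (i, Sum.inl i') * a (i', Sum.inl j) +
      S.w n * c (i, Sum.inr (Sum.inl (Sum.inl j)))) * S.θ₀ n j =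
      ∑ i', c (i, Sum.inl i') * ∑ j, a (i', Sum.inl j) * S.θ₀ n j +
      S.w n * ∑ j, c (i, Sum.inr (Sum.inl (Sum.inl j))) * S.θ₀ n j := by
    simp only [add_mul, Finset.sum_add_distrib, Finset.sum_mul, Finset.mul_sum]
    rw [Finset.sum_comm]
    simp only [mul_assoc]
  rw [h3]
  simp only [mul_add, Finset.sum_add_distrib]
  ring

theorem sum_augCol_sq_le {a : Fin n × (Fin (S.p n) ⊕ Fin (S.p n)) → ℝ} (ha : ∀ q, |a q| ≤ S.b)
    (k : Fin (S.p n) ⊕ Fin (S.p n)) :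
    ∑ q, augCol S n a k q ^ 2 ≤ n * S.b ^ 2 + S.w n ^ 2 := by
  simp only [augCol, Fintype.sum_sum_type (α₂ := (Fin (S.p n) ⊕ Fin (S.p n)) ⊕ Unit),
    Fintype.sum_sum_type (α₂ := Unit), Sum.elim_inl, Sum.elim_inr, ite_pow, ne_eq,
    OfNat.ofNat_ne_zero, not_false_eq_true, zero_pow, Finset.sum_ite_eq', Finset.mem_univ, if_true,
    Finset.sum_const_zero, add_zero]
  gcongr
  calc ∑ i, a (i, k) ^ 2 ≤ ∑ _i : Fin n, S.b ^ 2 :=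
        Finset.sum_le_sum fun i _ => sq_le_sq' (by linarith [(abs_le.1 (ha (i, k))).1])
          (abs_le.1 (ha (i, k))).2
    _ = n * S.b ^ 2 := by simp

theorem sum_augCol_mul (a : Fin n × (Fin (S.p n) ⊕ Fin (S.p n)) → ℝ)
    (k l : Fin (S.p n) ⊕ Fin (S.p n)) :
    ∑ q, augCol S n a k q * augCol S n a l q =
      ∑ i, a (i, k) * a (i, l) + if k = l then S.w n ^ 2 else 0 := by
  simp only [augCol, Fintype.sum_sum_type (α₂ := (Fin (S.p n) ⊕ Fin (S.p n)) ⊕ Unit),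
    Fintype.sum_sum_type (α₂ := Unit), Sum.elim_inl, Sum.elim_inr, mul_zero,
    Finset.sum_const_zero, add_zero, ite_mul, zero_mul, Finset.sum_ite_eq', Finset.mem_univ,
    if_true]
  congr 1
  split_ifs with h <;> ring

theorem Setting.Standing.sum_θext_sq (hS : S.Standing) (n : ℕ) : ∑ k, S.θext n k ^ 2 = 1 := by
  simp [Setting.θext, Fintype.sum_sum_type, hS.θ₀_norm n]

/-- The augmented residual is `(ξ, -w θ₀, w)`, and `‖θ₀‖ = 1` turns the last two blocks into `2 w²`.
-/
theorem sum_augResidual_sq (hS : S.Standing) (b : Fin n → ℝ) :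
    ∑ q, augResidual S n b q ^ 2 = ∑ i, b i ^ 2 + 2 * S.w n ^ 2 := by
  simp only [augResidual, Fintype.sum_sum_type (α₂ := (Fin (S.p n) ⊕ Fin (S.p n)) ⊕ Unit),
    Fintype.sum_sum_type (α₂ := Unit), Sum.elim_inl, Sum.elim_inr, neg_sq, mul_pow,
    ← Finset.mul_sum, hS.sum_θext_sq]
  simp
  ring

theorem sum_augCol_mul_augResidual (a : Fin n × (Fin (S.p n) ⊕ Fin (S.p n)) → ℝ) (b : Fin n → ℝ)
    (k : Fin (S.p n) ⊕ Fin (S.p n)) :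
    ∑ q, augCol S n a k q * augResidual S n b q =
      ∑ i, a (i, k) * b i - S.w n ^ 2 * S.θext n k := by
  simp only [augCol, augResidual, Fintype.sum_sum_type (α₂ := (Fin (S.p n) ⊕ Fin (S.p n)) ⊕ Unit),
    Fintype.sum_sum_type (α₂ := Unit), Sum.elim_inl, Sum.elim_inr,
    Finset.sum_const_zero, add_zero, ite_mul, zero_mul, Finset.sum_ite_eq', Finset.mem_univ,
    if_true]
  ring

theorem projLaw_eq (S : Setting) (n : ℕ) :
    S.projLaw n = gaussianReal 0 (1 / (Fintype.card (Fin (S.r n)) : NNReal)) := by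
  simp [Setting.projLaw]

/-- Mean square of the error made by the projection, for a bilinear form of two vectors. -/
theorem lintegral_proj_le (hS : S.Standing) (n : ℕ)
    (u u' : Fin n ⊕ ((Fin (S.p n) ⊕ Fin (S.p n)) ⊕ Unit) → ℝ) :
    ∫⁻ c, ENNReal.ofReal ((∑ i, rowForm i u c * rowForm i u' c - ∑ q, u q * u' q) ^ 2)
        ∂(Measure.pi fun _ : Fin (S.r n) × (Fin n ⊕ ((Fin (S.p n) ⊕ Fin (S.p n)) ⊕ Unit)) =>
          S.projLaw n) ≤
      ENNReal.ofReal (gaussFourth / S.r n * ((∑ q, u q ^ 2) * ∑ q, u' q ^ 2)) := by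
  have : Nonempty (Fin (S.r n)) := ⟨⟨0, hS.r_pos n⟩⟩
  have h := lintegral_projection_sq_le (I := Fin (S.r n))
    (1 / (Fintype.card (Fin (S.r n)) : NNReal)) (by simp) u u'
  rw [projLaw_eq]
  simpa using h

theorem measurable_xstar_canonical (i : Fin (S.r n)) (k : Fin (S.p n) ⊕ Fin (S.p n)) :
    Measurable fun e : EntryIndex S n → ℝ => (canonicalSample S n).Xstar e i k :=
  ((continuous_astar_canonical (S := S) (n := n)).matrix_elem i (Sum.inl k)).measurable

theorem measurable_ystar_canonical (i : Fin (S.r n)) :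
    Measurable fun e : EntryIndex S n → ℝ => (canonicalSample S n).ystar e i :=
  ((continuous_astar_canonical (S := S) (n := n)).matrix_elem i (Sum.inr ())).measurable

theorem measurable_gramError_canonical (k l : Fin (S.p n) ⊕ Fin (S.p n)) :
    Measurable fun e : EntryIndex S n → ℝ =>
      gramError n (S.w n) ((canonicalSample S n).Xstar e) k l := by
  unfold gramError
  refine measurable_const.sub (measurable_const.mul (Finset.measurable_sum _ fun i _ => ?_))
  exact (measurable_xstar_canonical i k).mul (measurable_xstar_canonical i l)

theorem measurable_noiseTerm_canonical (k : Fin (S.p n) ⊕ Fin (S.p n)) :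
    Measurable fun e : EntryIndex S n → ℝ =>
      noiseTerm n (S.w n) ((canonicalSample S n).Xstar e) ((canonicalSample S n).ystar e)
        (S.θext n) k := by
  unfold noiseTerm
  refine (measurable_const.mul (Finset.measurable_sum _ fun i _ => ?_)).add measurable_const
  simp only [Matrix.mulVec, dotProduct, Pi.sub_apply]
  exact (measurable_xstar_canonical i k).mul ((measurable_ystar_canonical i).sub
    (Finset.measurable_sum _ fun l _ => (measurable_xstar_canonical i l).mul measurable_const))

/-- Mean square of an entry of the error of the Gram matrix. -/
theorem lintegral_gramError_sq_le (hS : S.Standing) (hn : 0 < n)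
    (k l : Fin (S.p n) ⊕ Fin (S.p n)) :
    ∫⁻ e, ENNReal.ofReal (gramError n (S.w n) ((canonicalSample S n).Xstar e) k l ^ 2)
        ∂Measure.pi (entryLaw S n) ≤
      ENNReal.ofReal (2 / (n : ℝ) ^ 2 * (gaussFourth / S.r n * (n * S.b ^ 2 + S.w n ^ 2) ^ 2)
        + 2 / (n : ℝ) ^ 2 * (n * S.b ^ 4)) := by
  have hn' : (0 : ℝ) < n := by exact_mod_cast hn
  have hD := hS.D_prob
  have hN := isProbabilityMeasure_noiseLaw hS n
  have hPr : IsProbabilityMeasure (S.projLaw n) := by unfold Setting.projLaw; infer_instance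
  have h4 := gaussFourth_nonneg
  rw [lintegral_entries hS n ((measurable_gramError_canonical k l).pow_const 2).ennreal_ofReal]
  set H : (Fin n × (Fin (S.p n) ⊕ Fin (S.p n)) → ℝ) → ℝ := fun a =>
    (∑ i, a (i, k) * a (i, l) - n * (if k = l then 1 else 0)) ^ 2 with hH
  set A : ℝ := gaussFourth / S.r n * (n * S.b ^ 2 + S.w n ^ 2) ^ 2 with hA
  have hA0 : 0 ≤ A := by positivity
  have hinner : ∀ᵐ a ∂(Measure.pi fun _ : Fin n × (Fin (S.p n) ⊕ Fin (S.p n)) => S.D),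
      ∀ b : Fin n → ℝ, ∫⁻ c, ENNReal.ofReal (gramError n (S.w n)
        ((canonicalSample S n).Xstar (Sum.elim a (Sum.elim b c))) k l ^ 2)
        ∂(Measure.pi fun _ => S.projLaw n) ≤
      ENNReal.ofReal (2 / (n : ℝ) ^ 2 * H a + 2 / (n : ℝ) ^ 2 * A) := by
    filter_upwards [hS.ae_entries_bdd (I := Fin n) (K := Fin (S.p n) ⊕ Fin (S.p n))] with a ha b
    have hpt : ∀ c, gramError n (S.w n)
        ((canonicalSample S n).Xstar (Sum.elim a (Sum.elim b c))) k l ^ 2 ≤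
        2 / (n : ℝ) ^ 2 * (∑ i, rowForm i (augCol S n a k) c * rowForm i (augCol S n a l) c -
          ∑ q, augCol S n a k q * augCol S n a l q) ^ 2 + 2 / (n : ℝ) ^ 2 * H a := by
      intro c
      simp only [gramError, xstar_eq_rowForm, sum_augCol_mul, hH]
      set Q := ∑ i, rowForm i (augCol S n a k) c * rowForm i (augCol S n a l) c
      set Y := ∑ i, a (i, k) * a (i, l)
      -- Splits the error into the deviation of the projected inner product from the exact one, and
      -- that of the empirical second moment of the design from its mean.
      have hid : ((if k = l then 1 + S.w n ^ 2 / (n : ℝ) else 0) - 1 / (n : ℝ) * Q) =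
          -(1 / n * ((Q - (Y + if k = l then S.w n ^ 2 else 0)) +
            (Y - n * if k = l then 1 else 0))) := by
        split_ifs <;> field_simp <;> ring
      rw [hid]
      set x := Q - (Y + if k = l then S.w n ^ 2 else 0)
      set y := Y - n * if k = l then 1 else 0
      have : (x + y) ^ 2 ≤ 2 * x ^ 2 + 2 * y ^ 2 := by nlinarith [sq_nonneg (x - y)]
      calc (-(1 / (n : ℝ) * (x + y))) ^ 2 = 1 / (n : ℝ) ^ 2 * (x + y) ^ 2 := by ring
        _ ≤ 1 / (n : ℝ) ^ 2 * (2 * x ^ 2 + 2 * y ^ 2) := by gcongr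
        _ = _ := by ring
    refine (lintegral_mono fun c => ENNReal.ofReal_le_ofReal (hpt c)).trans ?_
    rw [add_comm (2 / (n : ℝ) ^ 2 * H a)]
    refine lintegral_ofReal_mul_add_le ?_ (fun _ => sq_nonneg _) (by positivity)
      (by simp only [hH]; positivity) hA0 ?_
    · unfold rowForm; fun_prop
    · refine (lintegral_proj_le hS n _ _).trans (ENNReal.ofReal_le_ofReal ?_)
      rw [hA, sq (_ + _)]
      have h1 := sum_augCol_sq_le ha k
      have h2 := sum_augCol_sq_le ha l
      have h3 : 0 ≤ ∑ q, augCol S n a l q ^ 2 := Finset.sum_nonneg fun _ _ => sq_nonneg _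
      gcongr
  calc _ ≤ ∫⁻ a, ∫⁻ _b : Fin n → ℝ, ENNReal.ofReal (2 / (n : ℝ) ^ 2 * H a + 2 / (n : ℝ) ^ 2 * A)
        ∂Measure.pi (fun _ => S.noiseLaw n) ∂Measure.pi (fun _ => S.D) := by
        refine lintegral_mono_ae ?_
        filter_upwards [hinner] with a ha
        exact lintegral_mono fun b => ha b
    _ = ∫⁻ a, ENNReal.ofReal (2 / (n : ℝ) ^ 2 * H a + 2 / (n : ℝ) ^ 2 * A)
        ∂Measure.pi (fun _ => S.D) := by simp
    _ ≤ ENNReal.ofReal (2 / (n : ℝ) ^ 2 * (n * S.b ^ 4) + 2 / (n : ℝ) ^ 2 * A) := by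
        refine lintegral_ofReal_mul_add_le ?_ (fun _ => sq_nonneg _) (by positivity)
          (by positivity) (by positivity) ?_
        · fun_prop
        · have := hS.lintegral_gram_sq_le (I := Fin n) k l
          simpa using this
    _ = _ := by rw [add_comm]

/-- Mean square of a coordinate of the noise term. -/
theorem lintegral_noiseTerm_sq_le (hS : S.Standing) (hn : 0 < n) {m : ℝ} (hm : 0 ≤ m)
    (hξ : ∫⁻ x, ENNReal.ofReal (x ^ 2) ∂S.noiseLaw n ≤ ENNReal.ofReal m)
    (k : Fin (S.p n) ⊕ Fin (S.p n)) :
    ∫⁻ e, ENNReal.ofReal (noiseTerm n (S.w n) ((canonicalSample S n).Xstar e)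
        ((canonicalSample S n).ystar e) (S.θext n) k ^ 2) ∂Measure.pi (entryLaw S n) ≤
      ENNReal.ofReal (2 / (n : ℝ) ^ 2 * (gaussFourth / S.r n *
          ((n * S.b ^ 2 + S.w n ^ 2) * (n * m + 2 * S.w n ^ 2))) + 2 / (n : ℝ) ^ 2 * (n * m)) := by
  have hn' : (0 : ℝ) < n := by exact_mod_cast hn
  have hD := hS.D_prob
  have hN := isProbabilityMeasure_noiseLaw hS n
  have hPr : IsProbabilityMeasure (S.projLaw n) := by unfold Setting.projLaw; infer_instance
  have h4 := gaussFourth_nonneg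
  rw [lintegral_entries hS n ((measurable_noiseTerm_canonical k).pow_const 2).ennreal_ofReal]
  set A : ℝ := gaussFourth / S.r n * (n * S.b ^ 2 + S.w n ^ 2) with hA
  have hA0 : 0 ≤ A := by positivity
  set G : (Fin n → ℝ) → ℝ := fun b => 2 / (n : ℝ) ^ 2 * (A * (∑ i, b i ^ 2 + 2 * S.w n ^ 2)) with hG
  have hG0 : ∀ b, 0 ≤ G b := fun b => by
    have : 0 ≤ ∑ i, b i ^ 2 := Finset.sum_nonneg fun _ _ => sq_nonneg _
    simp only [hG]; positivity
  have hinner : ∀ᵐ a ∂(Measure.pi fun _ : Fin n × (Fin (S.p n) ⊕ Fin (S.p n)) => S.D),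
      ∀ b : Fin n → ℝ, ∫⁻ c, ENNReal.ofReal (noiseTerm n (S.w n)
        ((canonicalSample S n).Xstar (Sum.elim a (Sum.elim b c)))
        ((canonicalSample S n).ystar (Sum.elim a (Sum.elim b c))) (S.θext n) k ^ 2)
        ∂(Measure.pi fun _ => S.projLaw n) ≤
      ENNReal.ofReal (2 / (n : ℝ) ^ 2 * (∑ i, a (i, k) * b i) ^ 2 + G b) := by
    filter_upwards [hS.ae_entries_bdd (I := Fin n) (K := Fin (S.p n) ⊕ Fin (S.p n))] with a ha b
    have hpt : ∀ c, noiseTerm n (S.w n)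
        ((canonicalSample S n).Xstar (Sum.elim a (Sum.elim b c)))
        ((canonicalSample S n).ystar (Sum.elim a (Sum.elim b c))) (S.θext n) k ^ 2 ≤
        2 / (n : ℝ) ^ 2 * (∑ i, rowForm i (augCol S n a k) c * rowForm i (augResidual S n b) c -
          ∑ q, augCol S n a k q * augResidual S n b q) ^ 2 +
          2 / (n : ℝ) ^ 2 * (∑ i, a (i, k) * b i) ^ 2 := by
      intro c
      simp only [noiseTerm, xstar_eq_rowForm, sum_augCol_mul_augResidual, residual_eq_rowForm]
      set Q := ∑ i, rowForm i (augCol S n a k) c * rowForm i (augResidual S n b) c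
      set Y := ∑ i, a (i, k) * b i
      have hid : 1 / (n : ℝ) * Q + S.w n ^ 2 / n * S.θext n k =
          1 / n * ((Q - (Y - S.w n ^ 2 * S.θext n k)) + Y) := by
        field_simp; ring
      rw [hid]
      set x := Q - (Y - S.w n ^ 2 * S.θext n k)
      have : (x + Y) ^ 2 ≤ 2 * x ^ 2 + 2 * Y ^ 2 := by nlinarith [sq_nonneg (x - Y)]
      calc (1 / (n : ℝ) * (x + Y)) ^ 2 = 1 / (n : ℝ) ^ 2 * (x + Y) ^ 2 := by ring
        _ ≤ 1 / (n : ℝ) ^ 2 * (2 * x ^ 2 + 2 * Y ^ 2) := by gcongr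
        _ = _ := by ring
    refine (lintegral_mono fun c => ENNReal.ofReal_le_ofReal (hpt c)).trans ?_
    rw [add_comm (2 / (n : ℝ) ^ 2 * (∑ i, a (i, k) * b i) ^ 2)]
    have hb0 : 0 ≤ ∑ i, b i ^ 2 := Finset.sum_nonneg fun _ _ => sq_nonneg _
    refine lintegral_ofReal_mul_add_le ?_ (fun _ => sq_nonneg _) (by positivity)
      (by positivity) (by positivity) ?_
    · unfold rowForm; fun_prop
    · refine (lintegral_proj_le hS n _ _).trans (ENNReal.ofReal_le_ofReal ?_)
      rw [hA, sum_augResidual_sq hS, mul_assoc]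
      have h1 := sum_augCol_sq_le ha k
      gcongr
  have hsumξ : ∫⁻ b : Fin n → ℝ, ENNReal.ofReal (∑ i, b i ^ 2)
      ∂Measure.pi (fun _ => S.noiseLaw n) ≤ ENNReal.ofReal (n * m) := by
    have : ∀ b : Fin n → ℝ, ENNReal.ofReal (∑ i, b i ^ 2) = ∑ i, ENNReal.ofReal (b i ^ 2) :=
      fun b => ENNReal.ofReal_sum_of_nonneg fun _ _ => sq_nonneg _
    simp_rw [this]
    rw [lintegral_finsetSum _ fun i _ => by fun_prop]
    calc ∑ i : Fin n, ∫⁻ b : Fin n → ℝ, ENNReal.ofReal (b i ^ 2)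
          ∂Measure.pi (fun _ => S.noiseLaw n)
        ≤ ∑ _i : Fin n, ENNReal.ofReal m := by
          refine Finset.sum_le_sum fun i _ => ?_
          have := (measurePreserving_eval (fun _ : Fin n => S.noiseLaw n) i).lintegral_comp
            (f := fun x => ENNReal.ofReal (x ^ 2)) (by fun_prop)
          simp only [Function.eval] at this
          rw [this]
          exact hξ
      _ = ENNReal.ofReal (n * m) := by
          rw [Finset.sum_const, Finset.card_univ, Fintype.card_fin, nsmul_eq_mul,
            ENNReal.ofReal_mul hn'.le, ENNReal.ofReal_natCast]
  have hGm : Measurable G := by simp only [hG]; fun_prop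
  calc _ ≤ ∫⁻ a, ∫⁻ b : Fin n → ℝ, ENNReal.ofReal
          (2 / (n : ℝ) ^ 2 * (∑ i, a (i, k) * b i) ^ 2 + G b)
        ∂Measure.pi (fun _ => S.noiseLaw n) ∂Measure.pi (fun _ => S.D) := by
        refine lintegral_mono_ae ?_
        filter_upwards [hinner] with a ha
        exact lintegral_mono fun b => ha b
    -- Order exchanged so that, for fixed noise, the centred design column is integrated first; the
    -- correlation then has mean square exactly `‖ξ‖²`.
    _ = ∫⁻ b : Fin n → ℝ, ∫⁻ a, ENNReal.ofReal
          (2 / (n : ℝ) ^ 2 * (∑ i, a (i, k) * b i) ^ 2 + G b)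
        ∂Measure.pi (fun _ => S.D) ∂Measure.pi (fun _ => S.noiseLaw n) := by
        refine lintegral_lintegral_swap (Measurable.aemeasurable ?_)
        simp only [Function.uncurry_def]
        refine Measurable.ennreal_ofReal (Measurable.add ?_ (hGm.comp measurable_snd))
        fun_prop
    _ ≤ ∫⁻ b : Fin n → ℝ, ENNReal.ofReal
          (2 / (n : ℝ) ^ 2 * (∑ i, b i ^ 2) + G b) ∂Measure.pi (fun _ => S.noiseLaw n) := by
        refine lintegral_mono fun b => ?_
        refine lintegral_ofReal_mul_add_le ?_ (fun _ => sq_nonneg _) (by positivity)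
          (hG0 b) (Finset.sum_nonneg fun _ _ => sq_nonneg _) ?_
        · fun_prop
        · exact (hS.lintegral_corr_sq k b).le
    _ = ∫⁻ b : Fin n → ℝ, ENNReal.ofReal
          ((2 / (n : ℝ) ^ 2 * (1 + A)) * (∑ i, b i ^ 2) + 2 / (n : ℝ) ^ 2 * (A * (2 * S.w n ^ 2)))
          ∂Measure.pi (fun _ => S.noiseLaw n) := by
        refine lintegral_congr fun b => ?_
        congr 1
        simp only [hG]; ring
    _ ≤ ENNReal.ofReal ((2 / (n : ℝ) ^ 2 * (1 + A)) * (n * m) +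
          2 / (n : ℝ) ^ 2 * (A * (2 * S.w n ^ 2))) := by
        refine lintegral_ofReal_mul_add_le (by fun_prop)
          (fun _ => Finset.sum_nonneg fun _ _ => sq_nonneg _) (by positivity) (by positivity)
          (by positivity) hsumξ
    _ = _ := by
        congr 1
        rw [hA]; ring

end ModelMoments

/-! ### Deterministic error bound for the debiased Lasso -/

section Deterministic

variable {ρ κ : Type*} [Fintype ρ] [Fintype κ]

theorem sum_sq_mul_le (g : κ → κ → ℝ) (v : κ → ℝ) :
    ∑ k, (∑ l, g k l * v l) ^ 2 ≤ (∑ k, ∑ l, g k l ^ 2) * ∑ l, v l ^ 2 := by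
  rw [Finset.sum_mul]
  exact Finset.sum_le_sum fun k _ => Finset.sum_mul_sq_le_sq_mul_sq _ _ _

variable [DecidableEq κ]

/-- The correction `(w²/n) θ̂` compensates the inflation of the Gram matrix by `w²/n`. It leaves the
centred Gram error acting on the Lasso error, and the term `(w²/n) θ` that centres the noise
correlation. -/
theorem debiased_sub (n : ℕ) (w : ℝ) (M : Matrix ρ κ ℝ) (y : ρ → ℝ) (θ θhat : κ → ℝ) (k : κ) :
    debiased n w M y θhat k - θ k =
      ∑ l, gramError n w M k l * (θhat l - θ l) + noiseTerm n w M y θ k := by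
  have h1 : ∑ l, gramError n w M k l * (θhat l - θ l) =
      (1 + w ^ 2 / (n : ℝ)) * (θhat k - θ k) -
        1 / (n : ℝ) * ∑ a, M a k * M.mulVec (θhat - θ) a := by
    simp only [gramError, sub_mul, Finset.sum_sub_distrib, ite_mul, zero_mul, Finset.sum_ite_eq,
      Finset.mem_univ, if_true]
    congr 1
    simp only [Matrix.mulVec, dotProduct, Finset.mul_sum, Finset.sum_mul, Pi.sub_apply]
    rw [Finset.sum_comm]
    exact Finset.sum_congr rfl fun a _ => Finset.sum_congr rfl fun l _ => by ring
  rw [h1]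
  have h2 : ∑ a, M a k * M.mulVec (θhat - θ) a =
      ∑ a, M a k * (y - M.mulVec θ) a - ∑ a, M a k * (y - M.mulVec θhat) a := by
    rw [← Finset.sum_sub_distrib]
    refine Finset.sum_congr rfl fun a _ => ?_
    rw [Matrix.mulVec_sub]
    simp only [Pi.sub_apply]; ring
  rw [h2]
  have h3 : debiased n w M y θhat k =
      θhat k + 1 / (n : ℝ) * ∑ a, M a k * (y - M.mulVec θhat) a + w ^ 2 / n * θhat k := by
    simp [debiased, Matrix.mulVec, dotProduct]
  rw [h3, noiseTerm]
  ring

/-- `ℓ²` error of the Lasso when the Gram matrix is well conditioned. -/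
theorem IsLassoSolution.sqrt_sum_sq_sub_le {n : ℕ} (hn : 0 < n) {lam : ℝ} (hlam : 0 ≤ lam) {w : ℝ}
    {M : Matrix ρ κ ℝ} {y : ρ → ℝ} {θ θhat : κ → ℝ} (h : IsLassoSolution n lam M y θhat)
    (hθ : ∑ k, θ k ^ 2 = 1)
    (hG : √(∑ k, ∑ l, gramError n w M k l ^ 2) ≤ (1 + w ^ 2 / n) / 2) :
    √(∑ k, (θhat k - θ k) ^ 2) ≤ 4 / (1 + w ^ 2 / n) *
      (√(∑ k, noiseTerm n w M y θ k ^ 2) + w ^ 2 / n + lam * √(Fintype.card κ : ℝ)) := by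
  have hn' : (0 : ℝ) < n := by exact_mod_cast hn
  set Δ : κ → ℝ := θhat - θ with hΔ
  set φ : ℝ := 1 + w ^ 2 / n with hφ
  have hφ0 : 0 < φ := by positivity
  set GF := √(∑ k, ∑ l, gramError n w M k l ^ 2) with hGF
  set NN := √(∑ k, noiseTerm n w M y θ k ^ 2) with hNN
  set D := √(∑ k, Δ k ^ 2) with hD
  have hD0 : 0 ≤ D := Real.sqrt_nonneg _
  have hDsq : D ^ 2 = ∑ k, Δ k ^ 2 := Real.sq_sqrt (Finset.sum_nonneg fun _ _ => sq_nonneg _)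
  -- Basic inequality: compare the objective at the minimizer with its value at the truth.
  have hbase : 1 / (2 * (n : ℝ)) * ∑ i, M.mulVec Δ i ^ 2 ≤
      1 / (n : ℝ) * ∑ i, M.mulVec Δ i * (y - M.mulVec θ) i + lam * ∑ k, |Δ k| := by
    have e := lassoObjective_add n lam M y θ Δ
    have h1 : θ + Δ = θhat := by simp [hΔ]
    rw [h1] at e
    have h2 := h θ
    have h3 : -∑ k, (|θ k + Δ k| - |θ k|) ≤ ∑ k, |Δ k| := by
      rw [← Finset.sum_neg_distrib]
      refine Finset.sum_le_sum fun k _ => ?_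
      have := abs_sub_abs_le_abs_sub (θ k) (θ k + Δ k)
      rw [show θ k - (θ k + Δ k) = -Δ k by ring, abs_neg] at this
      linarith
    have := mul_le_mul_of_nonneg_left h3 hlam
    linarith
  have hquad : 1 / (n : ℝ) * ∑ i, M.mulVec Δ i ^ 2 =
      φ * D ^ 2 - ∑ k, Δ k * ∑ l, gramError n w M k l * Δ l := by
    have h1 : ∀ k, ∑ l, gramError n w M k l * Δ l =
        φ * Δ k - 1 / (n : ℝ) * ∑ a, M a k * M.mulVec Δ a := by
      intro k
      simp only [gramError, sub_mul, Finset.sum_sub_distrib, ite_mul, zero_mul, Finset.sum_ite_eq,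
        Finset.mem_univ, if_true]
      congr 1
      simp only [Matrix.mulVec, dotProduct, Finset.mul_sum, Finset.sum_mul]
      rw [Finset.sum_comm]
      exact Finset.sum_congr rfl fun a _ => Finset.sum_congr rfl fun l _ => by ring
    simp only [h1, mul_sub, Finset.sum_sub_distrib]
    have h2 : ∑ k, Δ k * (φ * Δ k) = φ * D ^ 2 := by
      rw [hDsq, Finset.mul_sum]
      exact Finset.sum_congr rfl fun k _ => by ring
    have h3 : ∑ k, Δ k * (1 / (n : ℝ) * ∑ a, M a k * M.mulVec Δ a) =
        1 / (n : ℝ) * ∑ i, M.mulVec Δ i ^ 2 := by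
      have : ∀ i, M.mulVec Δ i ^ 2 = ∑ k, M i k * Δ k * M.mulVec Δ i := by
        intro i
        rw [← Finset.sum_mul, sq]
        rfl
      simp only [this, Finset.mul_sum]
      rw [Finset.sum_comm]
      exact Finset.sum_congr rfl fun a _ => Finset.sum_congr rfl fun l _ => by ring
    rw [h2, h3]; ring
  have hcross : 1 / (n : ℝ) * ∑ i, M.mulVec Δ i * (y - M.mulVec θ) i =
      ∑ k, Δ k * noiseTerm n w M y θ k - w ^ 2 / n * ∑ k, Δ k * θ k := by
    simp only [noiseTerm, mul_add, Finset.sum_add_distrib]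
    have h1 : ∑ k, Δ k * (w ^ 2 / n * θ k) = w ^ 2 / n * ∑ k, Δ k * θ k := by
      rw [Finset.mul_sum]; exact Finset.sum_congr rfl fun k _ => by ring
    have h2 : ∑ k, Δ k * (1 / (n : ℝ) * ∑ a, M a k * (y - M.mulVec θ) a) =
        1 / (n : ℝ) * ∑ i, M.mulVec Δ i * (y - M.mulVec θ) i := by
      have : ∀ i, M.mulVec Δ i * (y - M.mulVec θ) i =
          ∑ k, M i k * Δ k * (y - M.mulVec θ) i := by
        intro i
        rw [← Finset.sum_mul]
        rfl
      simp only [this, Finset.mul_sum]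
      rw [Finset.sum_comm]
      exact Finset.sum_congr rfl fun a _ => Finset.sum_congr rfl fun l _ => by ring
    rw [h1, h2]; ring
  have b1 : ∑ k, Δ k * ∑ l, gramError n w M k l * Δ l ≤ D * (GF * D) := by
    refine (Real.sum_mul_le_sqrt_mul_sqrt _ _ _).trans ?_
    refine mul_le_mul_of_nonneg_left ?_ hD0
    rw [hGF, hD, ← Real.sqrt_mul (Finset.sum_nonneg fun _ _ => Finset.sum_nonneg fun _ _ =>
      sq_nonneg _)]
    exact Real.sqrt_le_sqrt (sum_sq_mul_le _ _)
  have b2 : ∑ k, Δ k * noiseTerm n w M y θ k ≤ D * NN := Real.sum_mul_le_sqrt_mul_sqrt _ _ _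
  have b3 : -∑ k, Δ k * θ k ≤ D := by
    have := Real.sum_mul_le_sqrt_mul_sqrt Finset.univ Δ (-θ)
    simp only [Pi.neg_apply, mul_neg, Finset.sum_neg_distrib, neg_sq, hθ, Real.sqrt_one,
      mul_one] at this
    exact this
  -- No cone condition is used: the full dimension enters. With `s₀` of order `p` this costs only a
  -- constant factor.
  have b4 : ∑ k, |Δ k| ≤ √(Fintype.card κ : ℝ) * D := by
    have := Real.sum_mul_le_sqrt_mul_sqrt Finset.univ (fun _ : κ => (1 : ℝ)) (fun k => |Δ k|)
    simpa using this
  have hw0 : 0 ≤ w ^ 2 / (n : ℝ) := by positivity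
  have b3' := mul_le_mul_of_nonneg_left b3 hw0
  have b4' := mul_le_mul_of_nonneg_left b4 hlam
  have hhalf : 1 / (2 * (n : ℝ)) * ∑ i, M.mulVec Δ i ^ 2 =
      1 / 2 * (1 / (n : ℝ) * ∑ i, M.mulVec Δ i ^ 2) := by
    field_simp
  rw [hhalf, hquad, hcross] at hbase
  -- A Gram error of at most `φ/2` in Frobenius norm leaves half of the curvature; together with the
  -- factor 1/2 of the loss, `φ/4` remains.
  have hGD : D * (GF * D) ≤ φ / 2 * D ^ 2 := by nlinarith [sq_nonneg D]
  have hfin : φ / 4 * D ^ 2 ≤ D * (NN + w ^ 2 / n + lam * √(Fintype.card κ : ℝ)) := by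
    nlinarith
  change D ≤ _
  rcases hD0.eq_or_lt with h0 | hpos
  · rw [← h0]
    have : 0 ≤ NN := Real.sqrt_nonneg _
    positivity
  · have : φ / 4 * D ≤ NN + w ^ 2 / n + lam * √(Fintype.card κ : ℝ) := by
      by_contra! hc
      have := mul_lt_mul_of_pos_left hc hpos
      nlinarith
    rw [div_mul_eq_mul_div, le_div_iff₀ hφ0]
    linarith

/-- `ℓ²` error of the debiased Lasso. -/
theorem IsLassoSolution.sum_sq_debiased_sub_le {n : ℕ} (hn : 0 < n) {lam : ℝ} (hlam : 0 ≤ lam)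
    {w : ℝ} {M : Matrix ρ κ ℝ} {y : ρ → ℝ} {θ θhat : κ → ℝ} (h : IsLassoSolution n lam M y θhat)
    (hθ : ∑ k, θ k ^ 2 = 1) {GF NN : ℝ} (hGF : √(∑ k, ∑ l, gramError n w M k l ^ 2) ≤ GF)
    (hNN : √(∑ k, noiseTerm n w M y θ k ^ 2) ≤ NN) (hG : GF ≤ (1 + w ^ 2 / n) / 2) :
    ∑ k, (debiased n w M y θhat k - θ k) ^ 2 ≤
      2 * (2 * NN + 4 / (1 + w ^ 2 / n) * (GF * (w ^ 2 / n + lam * √(Fintype.card κ : ℝ)))) ^ 2 +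
        2 * NN ^ 2 := by
  have hn' : (0 : ℝ) < n := by exact_mod_cast hn
  have hL := h.sqrt_sum_sq_sub_le (w := w) hn hlam hθ (hGF.trans hG)
  set φ : ℝ := 1 + w ^ 2 / n with hφ
  have hφ0 : 0 < φ := by positivity
  set D := √(∑ k, (θhat k - θ k) ^ 2) with hD
  set G2 := ∑ k, ∑ l, gramError n w M k l ^ 2 with hG2
  set N2 := ∑ k, noiseTerm n w M y θ k ^ 2 with hN2
  set E := w ^ 2 / n + lam * √(Fintype.card κ : ℝ) with hE
  have hE0 : 0 ≤ E := by positivity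
  have hG20 : 0 ≤ G2 := Finset.sum_nonneg fun _ _ => Finset.sum_nonneg fun _ _ => sq_nonneg _
  have hGF0 : 0 ≤ GF := (Real.sqrt_nonneg _).trans hGF
  have hNN0 : 0 ≤ NN := (Real.sqrt_nonneg _).trans hNN
  have hD0 : 0 ≤ D := Real.sqrt_nonneg _
  have hDsq : D ^ 2 = ∑ k, (θhat k - θ k) ^ 2 :=
    Real.sq_sqrt (Finset.sum_nonneg fun _ _ => sq_nonneg _)
  have hN2le : N2 ≤ NN ^ 2 := (Real.sqrt_le_left hNN0).1 hNN
  have hG2le : G2 ≤ GF ^ 2 := (Real.sqrt_le_left hGF0).1 hGF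
  -- Where the noise is concerned, `GF ≤ φ/2` absorbs the factor `4/φ`. Only the bias `w²/n + lam
  -- √|κ|` needs the actual smallness of `GF`.
  have hGD : GF * D ≤ 2 * NN + 4 / φ * (GF * E) := by
    have h1 : GF * D ≤ GF * (4 / φ * (NN + w ^ 2 / n + lam * √(Fintype.card κ : ℝ))) := by
      refine mul_le_mul_of_nonneg_left (hL.trans ?_) hGF0
      gcongr
    have h2 : GF * (4 / φ) * NN ≤ 2 * NN := by
      refine mul_le_mul_of_nonneg_right ?_ hNN0
      rw [mul_div_assoc', div_le_iff₀ hφ0]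
      linarith
    calc GF * D ≤ _ := h1
      _ = GF * (4 / φ) * NN + 4 / φ * (GF * E) := by rw [hE]; ring
      _ ≤ _ := by linarith
  calc ∑ k, (debiased n w M y θhat k - θ k) ^ 2
      ≤ ∑ k, (2 * (∑ l, gramError n w M k l * (θhat l - θ l)) ^ 2 +
          2 * noiseTerm n w M y θ k ^ 2) := by
        refine Finset.sum_le_sum fun k _ => ?_
        rw [debiased_sub]
        nlinarith [sq_nonneg (∑ l, gramError n w M k l * (θhat l - θ l) - noiseTerm n w M y θ k)]
    _ = 2 * ∑ k, (∑ l, gramError n w M k l * (θhat l - θ l)) ^ 2 + 2 * N2 := by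
        rw [Finset.sum_add_distrib, Finset.mul_sum, Finset.mul_sum]
    _ ≤ 2 * (GF * D) ^ 2 + 2 * NN ^ 2 := by
        have := sum_sq_mul_le (gramError n w M) (fun l => θhat l - θ l)
        rw [← hG2, ← hDsq] at this
        have h2 : G2 * D ^ 2 ≤ GF ^ 2 * D ^ 2 := by gcongr
        rw [mul_pow]
        linarith
    _ ≤ _ := by gcongr

end Deterministic

/-! ### Variance of the truncated noise -/

/-- By Chebyshev the interval carries at least half of the Gaussian mass, so conditioning on it at
most doubles the second moment. -/
theorem lintegral_noiseLaw_sq_le {S : Setting} (hS : S.Standing) {n : ℕ}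
    (hbn : 2 * S.σ ^ 2 ≤ S.bn n ^ 2) :
    ∫⁻ x, ENNReal.ofReal (x ^ 2) ∂S.noiseLaw n ≤ ENNReal.ofReal (2 * S.σ ^ 2) := by
  have hσ := hS.σ_pos
  have hb := hS.bn_pos n
  set γ := gaussianReal 0 (Real.toNNReal (S.σ ^ 2)) with hγ
  set A := Set.Icc (-S.bn n) (S.bn n) with hA
  have hL : MemLp (id : ℝ → ℝ) 2 γ := memLp_id_gaussianReal' 2 (by simp)
  have hvar : variance id γ = S.σ ^ 2 := by
    rw [variance_id_gaussianReal, Real.coe_toNNReal _ (sq_nonneg _)]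
  have hmean : ∫ x, id x ∂γ = 0 := integral_id_gaussianReal
  have hsq : ∫⁻ x, ENNReal.ofReal (x ^ 2) ∂γ = ENNReal.ofReal (S.σ ^ 2) := by
    have := lintegral_sq_sub_integral hL
    rw [hmean, hvar] at this
    simpa using this
  have hcompl : γ Aᶜ ≤ 1 / 2 := by
    have h1 := meas_ge_le_variance_div_sq hL hb
    rw [hmean, hvar] at h1
    have h2 : Aᶜ ⊆ {ω : ℝ | S.bn n ≤ |id ω - 0|} := by
      intro x hx
      simp only [hA, Set.mem_compl_iff, Set.mem_Icc, not_and_or, not_le] at hx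
      change S.bn n ≤ |x - 0|
      rw [sub_zero, le_abs]
      rcases hx with hx | hx
      · right; linarith
      · left; exact hx.le
    refine (measure_mono h2).trans (h1.trans ?_)
    have : S.σ ^ 2 / S.bn n ^ 2 ≤ 1 / 2 := by
      rw [div_le_div_iff₀ (by positivity) (by norm_num)]; linarith
    refine (ENNReal.ofReal_le_ofReal this).trans ?_
    rw [ENNReal.ofReal_div_of_pos (by norm_num)]; simp
  have hAhalf : 1 / 2 ≤ γ A := by
    have h1 := prob_add_prob_compl (μ := γ) (s := A) measurableSet_Icc
    by_contra! hc
    have : γ A + γ Aᶜ < 1 := by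
      calc γ A + γ Aᶜ ≤ γ A + 1 / 2 := by gcongr
        _ < 1 / 2 + 1 / 2 := by
          exact ENNReal.add_lt_add_right (by simp) hc
        _ = 1 := ENNReal.add_halves 1
    exact absurd h1 this.ne
  unfold Setting.noiseLaw
  rw [ProbabilityTheory.cond, lintegral_smul_measure, smul_eq_mul]
  calc (γ A)⁻¹ * ∫⁻ x in A, ENNReal.ofReal (x ^ 2) ∂γ
      ≤ 2 * ∫⁻ x, ENNReal.ofReal (x ^ 2) ∂γ := by
        refine mul_le_mul' ?_ (setLIntegral_le_lintegral _ _)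
        rw [ENNReal.inv_le_iff_inv_le]
        simpa using hAhalf
    _ = ENNReal.ofReal (2 * S.σ ^ 2) := by
        rw [hsq, ENNReal.ofReal_mul (by norm_num)]; simp

theorem eventually_bn {S : Setting} (hS : S.Standing) :
    ∀ᶠ n in atTop, 2 * S.σ ^ 2 ≤ S.bn n ^ 2 := by
  have hσ := hS.σ_pos
  filter_upwards [hS.bn_lower.eventually_ge_atTop 2] with n hn
  have h1 : 2 ≤ S.bn n / S.σ := by
    linarith [Real.sqrt_nonneg (2 * Real.log (2 * (n : ℝ)))]
  rw [le_div_iff₀ hσ] at h1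
  nlinarith

/-! ### Consequences of the growth conditions -/

namespace Setting

variable {S : Setting}

/-- Rate of convergence of the entries of the Gram matrix. -/
def τ (S : Setting) (n : ℕ) : ℝ := 1 / √(n : ℝ) + S.φ n / √(S.r n : ℝ)

theorem Standing.r_pos' (hS : S.Standing) (n : ℕ) : (0 : ℝ) < S.r n := by
  exact_mod_cast hS.r_pos n

theorem Standing.p_pos' (hS : S.Standing) (n : ℕ) : (0 : ℝ) < S.p n := by
  exact_mod_cast hS.p_pos n

theorem Standing.one_le_s₀ (hS : S.Standing) (n : ℕ) : (1 : ℝ) ≤ S.s₀ n := by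
  have : 0 < S.s₀ n := by
    rw [Setting.s₀, Finset.card_pos]
    by_contra h
    rw [Finset.not_nonempty_iff_eq_empty] at h
    have h0 : ∀ j, S.θ₀ n j = 0 := by
      intro j
      by_contra hj
      have : j ∈ supp (S.θ₀ n) := by simp [supp, hj]
      rw [h] at this
      simp at this
    have := hS.θ₀_norm n
    simp [h0] at this
  exact_mod_cast this

theorem φ_pos (S : Setting) (n : ℕ) : 0 < S.φ n := by
  unfold Setting.φ; positivity

theorem Standing.ρ_sq (hS : S.Standing) {n : ℕ} (hn : 0 < n) :
    S.ρ n ^ 2 = ((n : ℝ) + S.r n + 1) / (n * S.r n) + S.w n ^ 2 / (n * S.r n) := by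
  have := hS.r_pos' n
  have hn' : (0 : ℝ) < n := by exact_mod_cast hn
  unfold Setting.ρ
  rw [Real.sq_sqrt (by positivity)]

theorem Standing.ρ_pos (hS : S.Standing) {n : ℕ} (hn : 0 < n) : 0 < S.ρ n := by
  have := hS.r_pos' n
  have hn' : (0 : ℝ) < n := by exact_mod_cast hn
  unfold Setting.ρ
  exact Real.sqrt_pos.2 (by positivity)

theorem Standing.inv_n_le (hS : S.Standing) {n : ℕ} (hn : 0 < n) : 1 / (n : ℝ) ≤ S.ρ n ^ 2 := by
  have hr := hS.r_pos' n
  have hn' : (0 : ℝ) < n := by exact_mod_cast hn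
  rw [hS.ρ_sq hn, ← add_div, div_le_div_iff₀ hn' (by positivity)]
  nlinarith [sq_nonneg (S.w n)]

theorem Standing.inv_r_le (hS : S.Standing) {n : ℕ} (hn : 0 < n) :
    1 / (S.r n : ℝ) ≤ S.ρ n ^ 2 := by
  have hr := hS.r_pos' n
  have hn' : (0 : ℝ) < n := by exact_mod_cast hn
  rw [hS.ρ_sq hn, ← add_div, div_le_div_iff₀ hr (by positivity)]
  nlinarith [sq_nonneg (S.w n)]

theorem Standing.eventually_log_d (hS : S.Standing) : ∀ᶠ n in atTop, 1 ≤ Real.log (S.d n) := by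
  have h : Tendsto (fun n => Real.log (S.d n)) atTop atTop := by
    refine Real.tendsto_log_atTop.comp ?_
    unfold Setting.d
    exact (tendsto_natCast_atTop_atTop.comp hS.p_tendsto).const_mul_atTop (by norm_num)
  exact h.eventually_ge_atTop 1

theorem Standing.eventually_p_le (hS : S.Standing) {c₀ : ℝ} (hc₀ : 0 < c₀)
    (h : Tendsto (fun n => (S.s₀ n : ℝ) / (S.p n : ℝ)) atTop (𝓝 c₀)) :
    ∀ᶠ n in atTop, (S.p n : ℝ) ≤ 2 / c₀ * S.s₀ n := by
  filter_upwards [h.eventually (lt_mem_nhds (half_lt_self hc₀))] with n hn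
  rw [lt_div_iff₀ (hS.p_pos' n)] at hn
  rw [div_mul_eq_mul_div, le_div_iff₀ hc₀]
  linarith

theorem sqrt_div_log_le {x l : ℝ} (hx : 0 ≤ x) (hl : 1 ≤ l) : √(x / l) ≤ √x :=
  Real.sqrt_le_sqrt (div_le_self hx hl)

/-- Square the sparsity condition, keeping only the first member of its minimum and using `s₀ ≥ 1`,
`log d ≥ 1`. -/
theorem Debiasing.eventually_w_pow_four (hS : S.Standing) {C : ℝ} (hd : S.Debiasing C) :
    ∀ᶠ n in atTop, S.w n ^ 4 / (n ^ 2 * S.r n) ≤ S.σ ^ 2 * S.ρ n ^ 2 := by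
  filter_upwards [hd.sparsity.def one_pos, hS.eventually_log_d, eventually_gt_atTop 0]
    with n h hl hn
  have hn' : (0 : ℝ) < n := by exact_mod_cast hn
  have hσ := hS.σ_pos
  have hρ := hS.ρ_pos hn
  have hr := hS.r_pos' n
  have hw := hS.w_pos n
  have hs := hS.one_le_s₀ n
  rw [Real.norm_of_nonneg (by positivity), Real.norm_of_nonneg (by positivity), one_mul] at h
  have h1 : 1 / (S.σ * S.ρ n) ≤ n / S.w n ^ 2 * √(S.r n : ℝ) := by
    calc 1 / (S.σ * S.ρ n) ≤ 1 / (S.σ * S.ρ n) * √(S.s₀ n : ℝ) := by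
          refine le_mul_of_one_le_right (by positivity) ?_
          rw [Real.one_le_sqrt]; exact hs
      _ ≤ _ := h
      _ ≤ n / S.w n ^ 2 * √((S.r n : ℝ) / Real.log (S.d n)) := min_le_left _ _
      _ ≤ _ := by gcongr; exact div_le_self hr.le hl
  have h2 : S.w n ^ 2 ≤ S.σ * S.ρ n * (n * √(S.r n : ℝ)) := by
    rw [div_le_iff₀ (by positivity)] at h1
    have : n / S.w n ^ 2 * √(S.r n : ℝ) * (S.σ * S.ρ n) =
        S.σ * S.ρ n * (n * √(S.r n : ℝ)) / S.w n ^ 2 := by ring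
    rw [this, le_div_iff₀ (by positivity)] at h1
    linarith
  rw [div_le_iff₀ (by positivity)]
  calc S.w n ^ 4 = (S.w n ^ 2) ^ 2 := by ring
    _ ≤ (S.σ * S.ρ n * (n * √(S.r n : ℝ))) ^ 2 := by gcongr
    _ = S.σ ^ 2 * S.ρ n ^ 2 * (n ^ 2 * √(S.r n : ℝ) ^ 2) := by ring
    _ = _ := by rw [Real.sq_sqrt hr.le]

theorem τ_eq (S : Setting) (n : ℕ) : S.τ n = 1 / √(n : ℝ) + 1 / √(S.r n : ℝ) +
    S.w n ^ 2 / n / √(S.r n : ℝ) := by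
  unfold Setting.τ Setting.φ; ring

theorem Standing.κ_ge (hS : S.Standing) {C : ℝ} (hC : 0 < C) {n : ℕ} (hn : 0 < n) :
    2 * S.lam C n * √(S.s₀ n : ℝ) ≤ S.κ C n ∧ S.w n ^ 2 / n ≤ S.κ C n := by
  have := hS.lam_pos hC hn
  have h1 : 0 ≤ S.w n ^ 2 / n := by positivity
  have h2 : 0 ≤ 2 * S.lam C n * √(S.s₀ n : ℝ) := by positivity
  unfold Setting.κ
  constructor <;> linarith

/-- Since `κ ≥ 2 lam √s₀`, the left side of the compatibility condition is at least `4 s₀ / φ`. The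
three members of the minimum on the right match the three summands of `τ`, giving `s₀ τ = o(φ)`;
finally `p` is bounded by a multiple of `s₀`. -/
theorem Debiasing.eventually_mul_τ_le (hS : S.Standing) {C : ℝ} (hC : 0 < C)
    (hd : S.Debiasing C) {c₀ : ℝ} (hc₀ : 0 < c₀)
    (hlim : Tendsto (fun n => (S.s₀ n : ℝ) / (S.p n : ℝ)) atTop (𝓝 c₀)) {ε : ℝ} (hε : 0 < ε) :
    ∀ᶠ n in atTop, S.p n * S.τ n ≤ ε * S.φ n := by
  have hc : 0 < ε * c₀ / 2 := by positivity
  filter_upwards [hd.compatibility.def hc, hS.eventually_log_d, eventually_gt_atTop 0,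
    hS.eventually_p_le hc₀ hlim] with n h hl hn hp
  set c := ε * c₀ / 2 with hcdef
  have hn' : (0 : ℝ) < n := by exact_mod_cast hn
  have hr := hS.r_pos' n
  have hw := hS.w_pos n
  have hs := hS.one_le_s₀ n
  have hlam := hS.lam_pos hC hn
  have hφ := S.φ_pos n
  have hκ := (hS.κ_ge hC hn).1
  rw [Real.norm_of_nonneg (by positivity), Real.norm_of_nonneg (by positivity)] at h
  have h0 : 4 * S.s₀ n / S.φ n ≤ S.κ C n ^ 2 / (S.lam C n ^ 2 * S.φ n) := by
    rw [div_le_div_iff₀ hφ (by positivity)]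
    have : 4 * S.lam C n ^ 2 * S.s₀ n ≤ S.κ C n ^ 2 := by
      calc 4 * S.lam C n ^ 2 * S.s₀ n = (2 * S.lam C n * √(S.s₀ n : ℝ)) ^ 2 := by
            rw [mul_pow, mul_pow, Real.sq_sqrt (by positivity)]; ring
        _ ≤ _ := by gcongr
    calc 4 * (S.s₀ n : ℝ) * (S.lam C n ^ 2 * S.φ n) = 4 * S.lam C n ^ 2 * S.s₀ n * S.φ n := by ring
      _ ≤ _ := by gcongr
  have key : ∀ x : ℝ, 0 ≤ x →
      min 1 (min √((S.r n : ℝ) / n) (√((S.r n : ℝ) * n) / S.w n ^ 2)) ≤ x →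
      4 * S.s₀ n ≤ c * (√(n : ℝ) * x) * S.φ n := by
    intro x hx0 hx
    rw [← div_le_iff₀ hφ]
    refine h0.trans (h.trans ?_)
    have := sqrt_div_log_le hn'.le hl
    gcongr
  have hsn : 0 < √(n : ℝ) := Real.sqrt_pos.2 hn'
  have hsr : 0 < √(S.r n : ℝ) := Real.sqrt_pos.2 hr
  have k1 := key 1 zero_le_one (min_le_left _ _)
  have k2 := key √((S.r n : ℝ) / n) (Real.sqrt_nonneg _)
    ((min_le_right _ _).trans (min_le_left _ _))
  have k3 := key (√((S.r n : ℝ) * n) / S.w n ^ 2) (by positivity)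
    ((min_le_right _ _).trans (min_le_right _ _))
  rw [Real.sqrt_div hr.le, mul_div_cancel₀ _ hsn.ne'] at k2
  have e3 : √(n : ℝ) * (√((S.r n : ℝ) * n) / S.w n ^ 2) = n * √(S.r n : ℝ) / S.w n ^ 2 := by
    rw [Real.sqrt_mul hr.le]
    calc _ = (√(n : ℝ) * √(n : ℝ)) * √(S.r n : ℝ) / S.w n ^ 2 := by ring
      _ = _ := by rw [Real.mul_self_sqrt hn'.le]
  rw [e3] at k3
  rw [mul_one] at k1
  have m1 : S.s₀ n * (1 / √(n : ℝ)) ≤ c * S.φ n / 4 := by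
    rw [mul_one_div, div_le_iff₀ hsn]; linarith
  have m2 : S.s₀ n * (1 / √(S.r n : ℝ)) ≤ c * S.φ n / 4 := by
    rw [mul_one_div, div_le_iff₀ hsr]; linarith
  have m3 : S.s₀ n * (S.w n ^ 2 / n / √(S.r n : ℝ)) ≤ c * S.φ n / 4 := by
    have : c * (n * √(S.r n : ℝ) / S.w n ^ 2) * S.φ n =
      c * S.φ n * (n * √(S.r n : ℝ)) / S.w n ^ 2 := by ring
    rw [this, le_div_iff₀ (by positivity)] at k3
    rw [div_div, mul_div_assoc', div_le_iff₀ (by positivity)]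
    linarith
  have hτ : S.s₀ n * S.τ n ≤ c * S.φ n := by
    rw [τ_eq, mul_add, mul_add]
    have : 0 < c * S.φ n := by positivity
    linarith
  have hτ0 : 0 ≤ S.τ n := by
    unfold Setting.τ; positivity
  calc S.p n * S.τ n ≤ 2 / c₀ * S.s₀ n * S.τ n := by gcongr
    _ = 2 / c₀ * (S.s₀ n * S.τ n) := by ring
    _ ≤ 2 / c₀ * (c * S.φ n) := by gcongr
    _ = ε * S.φ n := by rw [hcdef]; field_simp

/-- Three members of the minimum in the error condition match the summands of `τ`, so `E τ` is at
most `3 σ ρ`, where `E = 4 κ² / (lam φ)`. The bias itself is at most a constant times `κ`, because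
`κ` dominates `w²/n` and `lam √s₀`. -/
theorem Debiasing.eventually_bias_le (hS : S.Standing) {C : ℝ} (hC : 0 < C)
    (hd : S.Debiasing C) {c₀ : ℝ} (hc₀ : 0 < c₀)
    (hlim : Tendsto (fun n => (S.s₀ n : ℝ) / (S.p n : ℝ)) atTop (𝓝 c₀)) :
    ∃ K : ℝ, 0 < K ∧ ∀ᶠ n in atTop, S.p n * S.τ n *
      (S.w n ^ 2 / n + S.lam C n * √(2 * (S.p n : ℝ))) ≤ K * (√(S.p n : ℝ) * S.ρ n * S.φ n) := by
  have hσ := hS.σ_pos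
  have hsc : 0 < √(2 / c₀) := Real.sqrt_pos.2 (by positivity)
  refine ⟨√(2 / c₀) * (1 + √2 * √(2 / c₀)) * S.σ, by positivity, ?_⟩
  filter_upwards [hd.error.def one_pos, hS.eventually_log_d, eventually_gt_atTop 0,
    hS.eventually_p_le hc₀ hlim] with n h hl hn hp
  have hn' : (0 : ℝ) < n := by exact_mod_cast hn
  have hr := hS.r_pos' n
  have hw := hS.w_pos n
  have hs := hS.one_le_s₀ n
  have hlam := hS.lam_pos hC hn
  have hφ := S.φ_pos n
  have hρ := hS.ρ_pos hn
  obtain ⟨hκ, hκ'⟩ := hS.κ_ge hC hn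
  have hss : 1 ≤ √(S.s₀ n : ℝ) := by rw [Real.one_le_sqrt]; exact hs
  have hκ0 : 0 < S.κ C n := lt_of_lt_of_le (by positivity) hκ
  rw [Real.norm_of_nonneg (by positivity), Real.norm_of_nonneg (by positivity), one_mul,
    one_div_mul_eq_div, div_le_iff₀ (by positivity)] at h
  have hsn : 0 < √(n : ℝ) := Real.sqrt_pos.2 hn'
  have hsr : 0 < √(S.r n : ℝ) := Real.sqrt_pos.2 hr
  set E := 4 * S.κ C n ^ 2 / (S.lam C n * S.φ n) with hE
  set A := S.σ * S.ρ n with hA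
  have hA0 : 0 < A := by positivity
  have k1 : E ≤ √(n : ℝ) * A := by
    refine h.trans ?_
    gcongr
    exact (min_le_left _ _).trans ((min_le_left _ _).trans (sqrt_div_log_le hn'.le hl))
  have k2 : E ≤ √(S.r n : ℝ) * A := by
    refine h.trans ?_
    gcongr
    exact (min_le_left _ _).trans ((min_le_right _ _).trans (sqrt_div_log_le hr.le hl))
  have k3 : E ≤ n / S.w n ^ 2 * √(S.r n : ℝ) * A := by
    refine h.trans ?_
    gcongr
    refine (min_le_right _ _).trans ((min_le_left _ _).trans ?_)
    gcongr
    exact div_le_self hr.le hl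
  have m1 : E * (1 / √(n : ℝ)) ≤ A := by
    rw [mul_one_div, div_le_iff₀ hsn]; linarith
  have m2 : E * (1 / √(S.r n : ℝ)) ≤ A := by
    rw [mul_one_div, div_le_iff₀ hsr]; linarith
  have m3 : E * (S.w n ^ 2 / n / √(S.r n : ℝ)) ≤ A := by
    have : n / S.w n ^ 2 * √(S.r n : ℝ) * A = A * (n * √(S.r n : ℝ)) / S.w n ^ 2 := by ring
    rw [this, le_div_iff₀ (by positivity)] at k3
    rw [div_div, mul_div_assoc', div_le_iff₀ (by positivity)]
    linarith
  have hτ0 : 0 ≤ S.τ n := by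
    unfold Setting.τ; positivity
  have hEτ : E * S.τ n ≤ 3 * A := by
    rw [τ_eq, mul_add, mul_add]; linarith
  -- One factor `κ` is traded for `2 lam √s₀`, which cancels `lam`; the other is kept to dominate
  -- the bias.
  have hEge : 8 * (√(S.s₀ n : ℝ) * S.κ C n) / S.φ n ≤ E := by
    rw [hE, div_le_div_iff₀ hφ (by positivity)]
    have := mul_le_mul_of_nonneg_right hκ hκ0.le
    calc 8 * (√(S.s₀ n : ℝ) * S.κ C n) * (S.lam C n * S.φ n)
        = 4 * (2 * S.lam C n * √(S.s₀ n : ℝ) * S.κ C n) * S.φ n := by ring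
      _ ≤ 4 * (S.κ C n * S.κ C n) * S.φ n := by gcongr
      _ = _ := by ring
  have hκτ : √(S.s₀ n : ℝ) * S.κ C n * S.τ n ≤ A * S.φ n := by
    have h1 := (mul_le_mul_of_nonneg_right hEge hτ0).trans hEτ
    rw [div_mul_eq_mul_div, div_le_iff₀ hφ] at h1
    have : 0 < A * S.φ n := by positivity
    linarith
  have hsp : √(S.p n : ℝ) ≤ √(2 / c₀) * √(S.s₀ n : ℝ) := by
    rw [← Real.sqrt_mul (by positivity)]
    exact Real.sqrt_le_sqrt hp
  have hbias : S.w n ^ 2 / n + S.lam C n * √(2 * (S.p n : ℝ)) ≤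
      (1 + √2 * √(2 / c₀)) * S.κ C n := by
    have h1 : S.lam C n * √(2 * (S.p n : ℝ)) ≤ √2 * √(2 / c₀) * S.κ C n := by
      rw [Real.sqrt_mul (by norm_num)]
      calc S.lam C n * (√2 * √(S.p n : ℝ))
          ≤ S.lam C n * (√2 * (√(2 / c₀) * √(S.s₀ n : ℝ))) := by gcongr
        _ = √2 * √(2 / c₀) * (S.lam C n * √(S.s₀ n : ℝ)) := by ring
        _ ≤ √2 * √(2 / c₀) * S.κ C n := by
            gcongr
            have : 0 ≤ S.lam C n * √(S.s₀ n : ℝ) := by positivity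
            linarith
    linarith
  calc S.p n * S.τ n * (S.w n ^ 2 / n + S.lam C n * √(2 * (S.p n : ℝ)))
      ≤ S.p n * S.τ n * ((1 + √2 * √(2 / c₀)) * S.κ C n) := by gcongr
    _ = √(S.p n : ℝ) * √(S.p n : ℝ) * S.τ n * ((1 + √2 * √(2 / c₀)) * S.κ C n) := by
        rw [Real.mul_self_sqrt (by positivity)]
    _ ≤ √(S.p n : ℝ) * (√(2 / c₀) * √(S.s₀ n : ℝ)) * S.τ n *
          ((1 + √2 * √(2 / c₀)) * S.κ C n) := by gcongr
    _ = √(S.p n : ℝ) * √(2 / c₀) * (1 + √2 * √(2 / c₀)) *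
          (√(S.s₀ n : ℝ) * S.κ C n * S.τ n) := by ring
    _ ≤ √(S.p n : ℝ) * √(2 / c₀) * (1 + √2 * √(2 / c₀)) * (A * S.φ n) := by gcongr
    _ = _ := by rw [hA]; ring

end Setting

/-! ### Tightness of the error of the debiased Lasso -/

theorem measure_lt_comp_le {Ω E : Type*} [MeasurableSpace Ω] [MeasurableSpace E] {P : Measure Ω}
    {ν : Measure E} {X : Ω → E} (hX : HasLaw X ν P) {F : E → ℝ} (hF : Measurable F) {A t : ℝ}
    (ht : 0 < t) (h : ∫⁻ e, ENNReal.ofReal (F e) ∂ν ≤ ENNReal.ofReal A) :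
    P {ω | t < F (X ω)} ≤ ENNReal.ofReal (A / t) := by
  have hm : AEMeasurable (fun ω => ENNReal.ofReal (F (X ω))) P :=
    hF.ennreal_ofReal.comp_aemeasurable hX.aemeasurable
  have he : ∫⁻ ω, ENNReal.ofReal (F (X ω)) ∂P = ∫⁻ e, ENNReal.ofReal (F e) ∂ν :=
    hX.lintegral_comp hF.ennreal_ofReal.aemeasurable
  calc P {ω | t < F (X ω)} ≤ P {ω | ENNReal.ofReal t ≤ ENNReal.ofReal (F (X ω))} :=
        measure_mono fun ω (hω : t < F (X ω)) => ENNReal.ofReal_le_ofReal hω.le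
    _ ≤ (∫⁻ ω, ENNReal.ofReal (F (X ω)) ∂P) / ENNReal.ofReal t :=
        meas_ge_le_lintegral_div hm (by simpa using ht) ENNReal.ofReal_ne_top
    _ ≤ ENNReal.ofReal A / ENNReal.ofReal t := by rw [he]; gcongr
    _ = _ := (ENNReal.ofReal_div_of_pos ht).symm

theorem lintegral_ofReal_sum_le {E ι : Type*} [MeasurableSpace E] {ν : Measure E} [Fintype ι]
    {F : ι → E → ℝ} (hF : ∀ i, Measurable (F i)) (hF0 : ∀ i e, 0 ≤ F i e) {A : ℝ}
    (h : ∀ i, ∫⁻ e, ENNReal.ofReal (F i e) ∂ν ≤ ENNReal.ofReal A) :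
    ∫⁻ e, ENNReal.ofReal (∑ i, F i e) ∂ν ≤ ENNReal.ofReal (Fintype.card ι * A) := by
  calc ∫⁻ e, ENNReal.ofReal (∑ i, F i e) ∂ν = ∫⁻ e, ∑ i, ENNReal.ofReal (F i e) ∂ν := by
        congr 1; ext e; exact ENNReal.ofReal_sum_of_nonneg fun i _ => hF0 i e
    _ = ∑ i, ∫⁻ e, ENNReal.ofReal (F i e) ∂ν :=
        lintegral_finsetSum _ fun i _ => (hF i).ennreal_ofReal
    _ ≤ ∑ _i : ι, ENNReal.ofReal A := Finset.sum_le_sum fun i _ => h i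
    _ = _ := by
        rw [Finset.sum_const, Finset.card_univ, nsmul_eq_mul, ENNReal.ofReal_mul (by positivity),
          ENNReal.ofReal_natCast]

variable {S : Setting}

theorem gramError_bound_le (hS : S.Standing) {n : ℕ} (hn : 0 < n) :
    2 / (n : ℝ) ^ 2 * (gaussFourth / S.r n * (n * S.b ^ 2 + S.w n ^ 2) ^ 2)
        + 2 / (n : ℝ) ^ 2 * (n * S.b ^ 4) ≤ 2 * S.b ^ 4 * (gaussFourth + 1) * S.τ n ^ 2 := by
  have hn' : (0 : ℝ) < n := by exact_mod_cast hn
  have hr := hS.r_pos' n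
  have h4 := gaussFourth_nonneg
  have hb := hS.one_le_b
  have hb2 : 1 ≤ S.b ^ 2 := one_le_pow₀ hb
  have hφ := S.φ_pos n
  have e1 : n * S.b ^ 2 + S.w n ^ 2 ≤ n * (S.b ^ 2 * S.φ n) := by
    have : n * (S.b ^ 2 * S.φ n) = n * S.b ^ 2 + S.b ^ 2 * S.w n ^ 2 := by
      unfold Setting.φ; field_simp
    rw [this]
    nlinarith [sq_nonneg (S.w n)]
  have e2 : 1 / (n : ℝ) ≤ S.τ n ^ 2 := by
    have : 1 / (n : ℝ) = (1 / √(n : ℝ)) ^ 2 := by rw [div_pow, Real.sq_sqrt hn'.le, one_pow]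
    rw [this]; unfold Setting.τ; gcongr; exact le_add_of_nonneg_right (by positivity)
  have e3 : S.φ n ^ 2 / S.r n ≤ S.τ n ^ 2 := by
    have : S.φ n ^ 2 / S.r n = (S.φ n / √(S.r n : ℝ)) ^ 2 := by rw [div_pow, Real.sq_sqrt hr.le]
    rw [this]; unfold Setting.τ; gcongr; exact le_add_of_nonneg_left (by positivity)
  calc _ ≤ 2 / (n : ℝ) ^ 2 * (gaussFourth / S.r n * (n * (S.b ^ 2 * S.φ n)) ^ 2)
        + 2 / (n : ℝ) ^ 2 * (n * S.b ^ 4) := by gcongr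
    _ = 2 * S.b ^ 4 * gaussFourth * (S.φ n ^ 2 / S.r n) + 2 * S.b ^ 4 * (1 / n) := by
        field_simp
    _ ≤ 2 * S.b ^ 4 * gaussFourth * S.τ n ^ 2 + 2 * S.b ^ 4 * S.τ n ^ 2 := by gcongr
    _ = _ := by ring

/-- Everything reduces to `1/n` and `φ²/r`. The first and the `1/r` part of the second are at most
`ρ²`; the remaining `w⁴/(n² r)` is controlled by the hypothesis `hw`. -/
theorem noiseTerm_bound_le (hS : S.Standing) {n : ℕ} (hn : 0 < n)
    (hw : S.w n ^ 4 / (n ^ 2 * S.r n) ≤ S.σ ^ 2 * S.ρ n ^ 2) :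
    2 / (n : ℝ) ^ 2 * (gaussFourth / S.r n *
          ((n * S.b ^ 2 + S.w n ^ 2) * (n * (2 * S.σ ^ 2) + 2 * S.w n ^ 2))) +
        2 / (n : ℝ) ^ 2 * (n * (2 * S.σ ^ 2)) ≤
      (4 * gaussFourth * S.b ^ 2 * (S.σ ^ 2 + 1) * (2 + 2 * S.σ ^ 2) + 4 * S.σ ^ 2) *
        S.ρ n ^ 2 := by
  have hn' : (0 : ℝ) < n := by exact_mod_cast hn
  have hr := hS.r_pos' n
  have h4 := gaussFourth_nonneg
  have hb := hS.one_le_b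
  have hb2 : 1 ≤ S.b ^ 2 := one_le_pow₀ hb
  have hφ := S.φ_pos n
  have hσ := hS.σ_pos
  have e0 : n * S.φ n = n + S.w n ^ 2 := by unfold Setting.φ; field_simp
  have e1 : n * S.b ^ 2 + S.w n ^ 2 ≤ S.b ^ 2 * (n * S.φ n) := by
    rw [e0]; nlinarith [sq_nonneg (S.w n)]
  have e2 : n * (2 * S.σ ^ 2) + 2 * S.w n ^ 2 ≤ 2 * (S.σ ^ 2 + 1) * (n * S.φ n) := by
    rw [e0]; nlinarith [sq_nonneg (S.w n), mul_nonneg (sq_nonneg S.σ) (sq_nonneg (S.w n))]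
  have e3 : S.φ n ^ 2 / S.r n ≤ (2 + 2 * S.σ ^ 2) * S.ρ n ^ 2 := by
    have h1 : S.φ n ^ 2 ≤ 2 + 2 * (S.w n ^ 2 / n) ^ 2 := by
      unfold Setting.φ; nlinarith [sq_nonneg (1 - S.w n ^ 2 / n)]
    calc S.φ n ^ 2 / S.r n ≤ (2 + 2 * (S.w n ^ 2 / n) ^ 2) / S.r n := by gcongr
      _ = 2 * (1 / S.r n) + 2 * (S.w n ^ 4 / (n ^ 2 * S.r n)) := by field_simp
      _ ≤ 2 * S.ρ n ^ 2 + 2 * (S.σ ^ 2 * S.ρ n ^ 2) := by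
          gcongr; exact hS.inv_r_le hn
      _ = _ := by ring
  calc _ ≤ 2 / (n : ℝ) ^ 2 * (gaussFourth / S.r n *
          ((S.b ^ 2 * (n * S.φ n)) * (2 * (S.σ ^ 2 + 1) * (n * S.φ n)))) +
        2 / (n : ℝ) ^ 2 * (n * (2 * S.σ ^ 2)) := by gcongr
    _ = 4 * gaussFourth * S.b ^ 2 * (S.σ ^ 2 + 1) * (S.φ n ^ 2 / S.r n) +
        4 * S.σ ^ 2 * (1 / n) := by field_simp; ring
    _ ≤ 4 * gaussFourth * S.b ^ 2 * (S.σ ^ 2 + 1) * ((2 + 2 * S.σ ^ 2) * S.ρ n ^ 2) +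
        4 * S.σ ^ 2 * S.ρ n ^ 2 := by gcongr; exact hS.inv_n_le hn
    _ = _ := by ring

namespace Sample

/-- Coordinates of the debiased private Lasso minus the true coefficients. -/
def debiasedError {n : ℕ} {Ω : Type*} (T : Sample S n Ω) (ω : Ω) (k : Fin (S.p n) ⊕ Fin (S.p n)) :
    ℝ :=
  debiased n (S.w n) (T.Xstar ω) (T.ystar ω) (T.θhat ω) k - S.θext n k

end Sample

/-- Markov bounds the total squared noise and the squared Frobenius norm of the Gram error outside
an event of probability `η`; the rest is the deterministic `ℓ²` bound together with the growth
conditions. -/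
theorem Setting.Debiasing.debiasedError_tight (hS : S.Standing) {C : ℝ} (hC : 0 < C)
    (hd : S.Debiasing C) {c₀ : ℝ} (hc₀ : 0 < c₀)
    (hlim : Tendsto (fun n => (S.s₀ n : ℝ) / (S.p n : ℝ)) atTop (𝓝 c₀))
    {Ω : ℕ → Type*} [∀ n, MeasurableSpace (Ω n)] {P : ∀ n, Measure (Ω n)}
    {T : ∀ n, Sample S n (Ω n)} (hT : ∀ n, (T n).IsModel C (P n)) {η : ℝ} (hη : 0 < η) :
    ∃ K : ℝ, 0 < K ∧ ∀ᶠ n in atTop,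
      P n {ω | K * (S.p n * S.ρ n ^ 2) < ∑ k, (T n).debiasedError ω k ^ 2} ≤ ENNReal.ofReal η := by
  obtain ⟨Kb, hKb, hbias⟩ := hd.eventually_bias_le hS hC hc₀ hlim
  have hσ := hS.σ_pos
  have h4 := gaussFourth_nonneg
  have hb : 0 < S.b := zero_lt_one.trans_le hS.one_le_b
  set K₁ := 4 * gaussFourth * S.b ^ 2 * (S.σ ^ 2 + 1) * (2 + 2 * S.σ ^ 2) + 4 * S.σ ^ 2 with hK₁
  set K₂ := 2 * S.b ^ 4 * (gaussFourth + 1) with hK₂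
  have hK₁0 : 0 < K₁ := by positivity
  have hK₂0 : 0 < K₂ := by positivity
  -- `h` and `g` are chosen so that each of the two Markov bounds, with `2p` and `(2p)²` summands,
  -- equals `η/2`.
  set h := √(4 * K₁ / η) with hh
  set g := √(8 * K₂ / η) with hg
  have hh2 : h ^ 2 = 4 * K₁ / η := Real.sq_sqrt (by positivity)
  have hg2 : g ^ 2 = 8 * K₂ / η := Real.sq_sqrt (by positivity)
  have hh0 : 0 < h := Real.sqrt_pos.2 (by positivity)
  have hg0 : 0 < g := Real.sqrt_pos.2 (by positivity)
  refine ⟨2 * (2 * h + 4 * g * Kb) ^ 2 + 2 * h ^ 2, by positivity, ?_⟩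
  -- The constant `1/(2g)` turns the Frobenius bound `g p τ` into `φ/2`, the conditioning required
  -- by the deterministic bound.
  filter_upwards [hbias, hd.eventually_mul_τ_le hS hC hc₀ hlim
    (show (0 : ℝ) < 1 / (2 * g) by positivity), hd.eventually_w_pow_four hS, eventually_bn hS,
    eventually_gt_atTop 0] with n hE hτ hw hbn hn
  have hn' : (0 : ℝ) < n := by exact_mod_cast hn
  have hr := hS.r_pos' n
  have hp := hS.p_pos' n
  have hρ := hS.ρ_pos hn
  have hφ := S.φ_pos n
  have hτ0 : 0 < S.τ n := by unfold Setting.τ; positivity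
  have hcard : (Fintype.card (Fin (S.p n) ⊕ Fin (S.p n)) : ℝ) = 2 * S.p n := by
    simp; ring
  have hlaw := (hT n).hasLaw_entryFun
  have hX : ∀ ω, (T n).Xstar ω = (canonicalSample S n).Xstar ((T n).entryFun ω) := fun ω => by
    unfold Sample.Xstar; rw [(T n).astar_eq_canonical]
  have hy : ∀ ω, (T n).ystar ω = (canonicalSample S n).ystar ((T n).entryFun ω) := fun ω => by
    unfold Sample.ystar; rw [(T n).astar_eq_canonical]
  set N2 : (EntryIndex S n → ℝ) → ℝ := fun e => ∑ k, noiseTerm n (S.w n)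
    ((canonicalSample S n).Xstar e) ((canonicalSample S n).ystar e) (S.θext n) k ^ 2 with hN2
  set G2 : (EntryIndex S n → ℝ) → ℝ := fun e => ∑ k, ∑ l, gramError n (S.w n)
    ((canonicalSample S n).Xstar e) k l ^ 2 with hG2
  have hmN : Measurable N2 :=
    Finset.measurable_sum _ fun k _ => (measurable_noiseTerm_canonical k).pow_const 2
  have hmG : Measurable G2 := Finset.measurable_sum _ fun k _ =>
    Finset.measurable_sum _ fun l _ => (measurable_gramError_canonical k l).pow_const 2
  have hNe : ∫⁻ e, ENNReal.ofReal (N2 e) ∂Measure.pi (entryLaw S n) ≤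
      ENNReal.ofReal (2 * S.p n * (K₁ * S.ρ n ^ 2)) := by
    rw [← hcard]
    refine lintegral_ofReal_sum_le (fun k => (measurable_noiseTerm_canonical k).pow_const 2)
      (fun k e => sq_nonneg _) fun k => ?_
    refine (lintegral_noiseTerm_sq_le hS hn (by positivity) (lintegral_noiseLaw_sq_le hS hbn)
      k).trans (ENNReal.ofReal_le_ofReal (noiseTerm_bound_le hS hn hw))
  have hGe : ∫⁻ e, ENNReal.ofReal (G2 e) ∂Measure.pi (entryLaw S n) ≤
      ENNReal.ofReal (2 * S.p n * (2 * S.p n * (K₂ * S.τ n ^ 2))) := by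
    rw [← hcard]
    refine lintegral_ofReal_sum_le (fun k => Finset.measurable_sum _ fun l _ =>
      (measurable_gramError_canonical k l).pow_const 2)
      (fun k e => Finset.sum_nonneg fun l _ => sq_nonneg _) fun k => ?_
    refine lintegral_ofReal_sum_le (fun l => (measurable_gramError_canonical k l).pow_const 2)
      (fun l e => sq_nonneg _) fun l => ?_
    exact (lintegral_gramError_sq_le hS hn k l).trans
      (ENNReal.ofReal_le_ofReal (gramError_bound_le hS hn))
  have hNp : P n {ω | h ^ 2 * (S.p n * S.ρ n ^ 2) < N2 ((T n).entryFun ω)} ≤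
      ENNReal.ofReal (η / 2) := by
    refine (measure_lt_comp_le hlaw hmN (by positivity) hNe).trans_eq ?_
    rw [hh2]; congr 1; field_simp; norm_num
  have hGp : P n {ω | g ^ 2 * (S.p n ^ 2 * S.τ n ^ 2) < G2 ((T n).entryFun ω)} ≤
      ENNReal.ofReal (η / 2) := by
    refine (measure_lt_comp_le hlaw hmG (by positivity) hGe).trans_eq ?_
    rw [hg2]; congr 1; field_simp; norm_num
  set bad : Set (Ω n) :=
    {ω | ¬ IsLassoSolution n (S.lam C n) ((T n).Xstar ω) ((T n).ystar ω) ((T n).θhat ω)} with hbad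
  have hbad0 : P n bad = 0 := (hT n).θhat_lasso
  have hsub : {ω | (2 * (2 * h + 4 * g * Kb) ^ 2 + 2 * h ^ 2) * (S.p n * S.ρ n ^ 2) <
      ∑ k, (T n).debiasedError ω k ^ 2} ⊆
      ({ω | h ^ 2 * (S.p n * S.ρ n ^ 2) < N2 ((T n).entryFun ω)} ∪
        {ω | g ^ 2 * (S.p n ^ 2 * S.τ n ^ 2) < G2 ((T n).entryFun ω)}) ∪ bad := by
    intro ω hω
    by_contra hcon
    simp only [Set.mem_union, Set.mem_ofPred_eq, not_or, not_lt, hbad, not_not] at hcon hω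
    obtain ⟨⟨c1, c2⟩, c3⟩ := hcon
    have hNN : √(∑ k, noiseTerm n (S.w n) ((T n).Xstar ω) ((T n).ystar ω) (S.θext n) k ^ 2) ≤
        h * (√(S.p n : ℝ) * S.ρ n) := by
      rw [hX, hy]
      refine Real.sqrt_le_iff.2 ⟨by positivity, c1.trans_eq ?_⟩
      rw [mul_pow, mul_pow, Real.sq_sqrt hp.le]
    have hGF : √(∑ k, ∑ l, gramError n (S.w n) ((T n).Xstar ω) k l ^ 2) ≤
        g * (S.p n * S.τ n) := by
      rw [hX]
      refine Real.sqrt_le_iff.2 ⟨by positivity, c2.trans_eq ?_⟩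
      rw [mul_pow, mul_pow]
    have hGφ : g * (S.p n * S.τ n) ≤ (1 + S.w n ^ 2 / n) / 2 := by
      calc g * (S.p n * S.τ n) ≤ g * (1 / (2 * g) * S.φ n) := by gcongr
        _ = S.φ n / 2 := by field_simp
        _ = _ := rfl
    have key := c3.sum_sq_debiased_sub_le hn (hS.lam_pos hC hn).le (hS.sum_θext_sq n) hGF hNN hGφ
    have hb4 : 4 / (1 + S.w n ^ 2 / n) * (g * (S.p n * S.τ n) * (S.w n ^ 2 / n + S.lam C n *
        √(Fintype.card (Fin (S.p n) ⊕ Fin (S.p n)) : ℝ))) ≤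
        4 * g * Kb * (√(S.p n : ℝ) * S.ρ n) := by
      rw [hcard, show 1 + S.w n ^ 2 / n = S.φ n from rfl]
      calc _ = 4 * g / S.φ n * (S.p n * S.τ n * (S.w n ^ 2 / n + S.lam C n *
            √(2 * S.p n : ℝ))) := by ring
        _ ≤ 4 * g / S.φ n * (Kb * (√(S.p n : ℝ) * S.ρ n * S.φ n)) := by gcongr
        _ = _ := by field_simp
    have hl0 := (hS.lam_pos hC hn).le
    have : ∑ k, (T n).debiasedError ω k ^ 2 ≤
        2 * (2 * (h * (√(S.p n : ℝ) * S.ρ n)) + 4 * g * Kb * (√(S.p n : ℝ) * S.ρ n)) ^ 2 +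
          2 * (h * (√(S.p n : ℝ) * S.ρ n)) ^ 2 := by
      refine key.trans ?_
      gcongr
    refine absurd (this.trans_eq ?_) (not_le.2 hω)
    have hs := Real.sq_sqrt hp.le
    linear_combination (2 * (2 * h + 4 * g * Kb) ^ 2 + 2 * h ^ 2) * S.ρ n ^ 2 * hs
  calc _ ≤ _ := measure_mono hsub
    _ ≤ P n {ω | h ^ 2 * (S.p n * S.ρ n ^ 2) < N2 ((T n).entryFun ω)} +
        P n {ω | g ^ 2 * (S.p n ^ 2 * S.τ n ^ 2) < G2 ((T n).entryFun ω)} + P n bad :=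
        (measure_union_le _ _).trans (by gcongr; exact measure_union_le _ _)
    _ ≤ ENNReal.ofReal (η / 2) + ENNReal.ofReal (η / 2) + 0 := by
        rw [hbad0]; gcongr
    _ = _ := by rw [add_zero, ← ENNReal.ofReal_add (by positivity) (by positivity), add_halves]

/-! ### Separation of signals and nulls, false discovery proportion and power -/

/-- Homogeneity reduces every scale `a > 0` to `a = 1`, so the growth constants, which may depend on
`a`, become uniform along the sequence of scales. -/
theorem IsFeatureFunction.exists_bounds {f : ℝ → ℝ → ℝ} (hf : IsFeatureFunction f) :
    ∃ L c x₀ F₀ : ℝ, 0 < L ∧ 0 < c ∧ 0 ≤ F₀ ∧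
      (∀ a u v, |f u a - f v a| ≤ L * |u - v|) ∧
      (∀ a u, 0 < a → x₀ * a ≤ |u| → c * |u| ≤ f u a) ∧
      ∀ a v, 0 < a → f v a ≤ F₀ * a + L * |v| := by
  obtain ⟨L, hL, hlip⟩ := hf.lipschitz
  obtain ⟨c, x₀, hc, hx₀, hgrow⟩ := hf.linear_growth 1
  have hl : ∀ a u v, |f u a - f v a| ≤ L * |u - v| := fun a u v => by
    simpa [Real.dist_eq] using (hlip a).dist_le_mul u v
  have habs : ∀ u a, f |u| a = f u a := fun u a => by
    rcases abs_choice u with h | h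
    · rw [h]
    · rw [h, ← hf.even]
  have hscale : ∀ u a, 0 < a → a * f (u / a) 1 = f u a := fun u a ha => by
    rw [hf.homogeneous a _ _ ha, mul_one, mul_div_cancel₀ _ ha.ne']
  refine ⟨L, c, x₀, f 0 1, hL, hc, hf.nonneg _ _, hl, fun a u ha hu => ?_, fun a v ha => ?_⟩
  · have := hgrow (|u| / a) ((le_div_iff₀ ha).2 hu)
    calc c * |u| = a * (c * (|u| / a)) := by field_simp
      _ ≤ a * f (|u| / a) 1 := by gcongr
      _ = f u a := by rw [hscale _ _ ha, habs]
  · have h1 := (abs_le.1 (hl a v 0)).2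
    have h2 : a * f 0 1 = f 0 a := by simpa using hscale 0 a ha
    rw [sub_zero] at h1
    linarith

/-- All but at most `β p` of the statistics `W` are below `t` in absolute value at null features
and at least `t` at the features in the support. -/
def Separates {p : ℕ} (θ₀ W : Fin p → ℝ) (t β : ℝ) : Prop :=
  ∃ E : Finset (Fin p), (E.card : ℝ) ≤ β * p ∧
    ∀ j, j ∉ E → (θ₀ j = 0 → |W j| < t) ∧ (θ₀ j ≠ 0 → t ≤ W j)

/-! ### From separation to bounds on FDP, estimated FDP and power. -/

section Separates

variable {p : ℕ} {θ₀ W : Fin p → ℝ} {t β c q : ℝ}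

/-- The exceptional set contains all false selections, all features with statistic at most `-t`, and
all missed signals. -/
theorem Separates.card_le (h : Separates θ₀ W t β) (ht : 0 < t) :
    (((selected W t \ supp θ₀).card : ℝ) ≤ β * p ∧
      ((Finset.univ.filter fun j => W j ≤ -t).card : ℝ) ≤ β * p) ∧
    ((supp θ₀).card : ℝ) ≤ (selected W t ∩ supp θ₀).card + β * p := by
  obtain ⟨E, hE, hsep⟩ := h
  have h1 : selected W t \ supp θ₀ ⊆ E := fun j hj => by
    rw [Finset.mem_sdiff, mem_selected, WithTop.coe_le_coe] at hj
    by_contra hjE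
    have := (hsep j hjE).1 (by simpa [supp] using hj.2)
    exact absurd (hj.1.trans (le_abs_self _)) (not_le.2 this)
  have h2 : (Finset.univ.filter fun j => W j ≤ -t) ⊆ E := fun j hj => by
    have hj' : W j ≤ -t := by simpa using hj
    by_contra hjE
    by_cases h0 : θ₀ j = 0
    · have := (abs_lt.1 ((hsep j hjE).1 h0)).1
      linarith
    · have := (hsep j hjE).2 h0
      linarith
  have h3 : supp θ₀ ⊆ (selected W t ∩ supp θ₀) ∪ E := fun j hj => by
    rw [Finset.mem_union, Finset.mem_inter, mem_selected, WithTop.coe_le_coe]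
    by_cases hjE : j ∈ E
    · exact Or.inr hjE
    · exact Or.inl ⟨(hsep j hjE).2 (by simpa [supp] using hj), hj⟩
  refine ⟨⟨le_trans ?_ hE, le_trans ?_ hE⟩, ?_⟩
  · exact_mod_cast Finset.card_le_card h1
  · exact_mod_cast Finset.card_le_card h2
  · have := (Finset.card_le_card h3).trans (Finset.card_union_le _ _)
    have : ((supp θ₀).card : ℝ) ≤ (selected W t ∩ supp θ₀).card + E.card := by exact_mod_cast this
    linarith

theorem Separates.le_card_selected (h : Separates θ₀ W t β) (ht : 0 < t)
    (hc : c * p ≤ (supp θ₀).card) : (c - β) * p ≤ (selected W t).card := by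
  have h1 := (h.card_le ht).2
  have h2 : ((selected W t ∩ supp θ₀).card : ℝ) ≤ (selected W t).card := by
    exact_mod_cast Finset.card_le_card Finset.inter_subset_left
  linarith

theorem Separates.fdp_le (h : Separates θ₀ W t β) (ht : 0 < t) (hp : 0 < p) (hβ : 0 ≤ β)
    (hβc : β < c) (hc : c * p ≤ (supp θ₀).card) : FDP θ₀ W t ≤ β / (c - β) := by
  have hp' : (0 : ℝ) < p := by exact_mod_cast hp
  have hd : 0 < c - β := sub_pos.2 hβc
  calc FDP θ₀ W t ≤ β * p / ((c - β) * p) := by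
        unfold FDP
        gcongr
        · exact (h.card_le ht).1.1
        · exact (h.le_card_selected ht hc).trans (le_max_right _ _)
    _ = _ := by field_simp

theorem Separates.fdpHat_le (h : Separates θ₀ W t β) (ht : 0 < t) (hp : 0 < p) (hβ : 0 ≤ β)
    (hβc : β < c) (hc : c * p ≤ (supp θ₀).card) :
    fdpHat W t ≤ (1 / p + β) / (c - β) := by
  have hp' : (0 : ℝ) < p := by exact_mod_cast hp
  have hd : 0 < c - β := sub_pos.2 hβc
  have hsel : (Finset.univ.filter fun j => t ≤ W j) = selected W t := by
    ext j; rw [mem_selected, WithTop.coe_le_coe]; simp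
  calc fdpHat W t ≤ (1 + β * p) / ((c - β) * p) := by
        unfold fdpHat
        rw [hsel]
        gcongr
        · exact (h.card_le ht).1.2
        · exact (h.le_card_selected ht hc).trans (le_max_right _ _)
    _ = _ := by field_simp

theorem Separates.one_sub_le_power (h : Separates θ₀ W t β) (ht : 0 < t) (hp : 0 < p)
    (hβ : 0 ≤ β) (hc0 : 0 < c) (hc : c * p ≤ (supp θ₀).card) : 1 - β / c ≤ power θ₀ W t := by
  have hp' : (0 : ℝ) < p := by exact_mod_cast hp
  have hs : 0 < ((supp θ₀).card : ℝ) := lt_of_lt_of_le (by positivity) hc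
  have h1 := (h.card_le ht).2
  unfold power
  rw [le_div_iff₀ hs]
  have : β * p ≤ β / c * (supp θ₀).card := by
    calc β * p = β / c * (c * p) := by field_simp
      _ ≤ _ := by gcongr
  linarith

theorem power_le_one (t : WithTop ℝ) : power θ₀ W t ≤ 1 := by
  unfold power
  refine div_le_one_of_le₀ ?_ (by positivity)
  exact_mod_cast Finset.card_le_card Finset.inter_subset_right

theorem power_mono {t t' : WithTop ℝ} (h : selected W t ⊆ selected W t') :
    power θ₀ W t ≤ power θ₀ W t' := by
  unfold power
  gcongr

/-- If the estimated false discovery proportion at `t` is at most `q`, then the data-dependent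
threshold selects at least as many features as `t`. -/
theorem selected_subset_selected_knockoffThreshold (ht : 0 < t) (hq : fdpHat W t ≤ q) :
    selected W t ⊆ selected W (knockoffThreshold q W) := by
  intro j hj
  rw [mem_selected, WithTop.coe_le_coe] at hj
  -- The data-dependent threshold ranges only over values `|W k|`. Rounding `t` up to the nearest
  -- such value changes neither count in `fdpHat` nor the selection.
  obtain ⟨k, hk, hmin⟩ := (Finset.univ.filter fun i => t ≤ |W i|).exists_min_image
    (fun i => |W i|) ⟨j, by simpa using hj.trans (le_abs_self _)⟩
  have hk' : t ≤ |W k| := by simpa using hk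
  have hmin' : ∀ i, t ≤ |W i| → |W k| ≤ |W i| := fun i hi => hmin i (by simpa using hi)
  have e1 : ∀ i, W i ≤ -|W k| ↔ W i ≤ -t := fun i =>
    ⟨fun h => by linarith, fun h => by
      have hi : |W i| = -W i := abs_of_neg (by linarith)
      have := hmin' i (by rw [hi]; linarith)
      rw [hi] at this; linarith⟩
  have e2 : ∀ i, |W k| ≤ W i ↔ t ≤ W i := fun i =>
    ⟨fun h => hk'.trans h, fun h => by
      have hi : |W i| = W i := abs_of_pos (by linarith)
      have := hmin' i (by rw [hi]; exact h)
      rwa [hi] at this⟩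
  have e3 : fdpHat W |W k| = fdpHat W t := by
    unfold fdpHat; simp only [e1, e2]
  rw [mem_selected, knockoffThreshold_le_coe_iff]
  exact ⟨k, abs_pos.1 (ht.trans_le hk'), e3.trans_le hq, (e2 j).2 hj⟩

end Separates

theorem tendstoInProb_of_forall_eventually {Ω : ℕ → Type*} [∀ n, MeasurableSpace (Ω n)]
    {P : ∀ n, Measure (Ω n)} {Y : ∀ n, Ω n → ℝ} {c : ℝ}
    (h : ∀ η : ℝ, 0 < η → ∀ ε : ℝ, 0 < ε →
      ∀ᶠ n in atTop, P n {ω | η ≤ |Y n ω - c|} ≤ ENNReal.ofReal ε) : TendstoInProb P Y c := by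
  intro η hη
  rw [ENNReal.tendsto_nhds_zero]
  intro ε hε
  by_cases htop : ε = ⊤
  · simp [htop]
  · filter_upwards [h η hη ε.toReal (ENNReal.toReal_pos hε.ne' htop)] with n hn
    rwa [ENNReal.ofReal_toReal htop] at hn

/-- With small errors at both copies of a feature, nulls and signals are on different sides of the
threshold. -/
theorem eventually_separated {f : ℝ → ℝ → ℝ} (hf : IsFeatureFunction f) {a μ t : ℕ → ℝ}
    (ha : ∀ᶠ n in atTop, 0 < a n) (hμ0 : ∀ n, 0 < μ n)
    (hμ : Tendsto (fun n => μ n / a n) atTop atTop) (ht : Tendsto (fun n => t n / a n) atTop atTop)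
    (htμ : Tendsto (fun n => t n / μ n) atTop (𝓝 0)) (m : ℝ) :
    ∀ᶠ n in atTop, 0 < t n ∧ ∀ u v θ : ℝ, |u - θ| ≤ m * a n → |v| ≤ m * a n →
      (θ = 0 → |f u (a n) - f v (a n)| < t n) ∧
      (μ n ≤ |θ| → t n ≤ f u (a n) - f v (a n)) := by
  obtain ⟨L, c, x₀, F₀, hL, hc, hF₀, hlip, hgrow, hup⟩ := hf.exists_bounds
  -- In turn: signals reach the region of linear growth; all error terms together are at most `c μ /
  -- 2`; `t` exceeds the null fluctuation `2 L m a`; and `t < c μ / 2`, the margin left for signals.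
  filter_upwards [ha, hμ.eventually_ge_atTop (x₀ + m),
    hμ.eventually_ge_atTop (2 / c * (c * m + F₀ + L * m)), ht.eventually_gt_atTop (2 * L * m),
    ht.eventually_gt_atTop 0, htμ.eventually (gt_mem_nhds (half_pos hc))]
    with n ha h1 h2 h3 h4 h5
  rw [le_div_iff₀ ha] at h1 h2
  rw [lt_div_iff₀ ha] at h3
  rw [div_lt_iff₀ (hμ0 n)] at h5
  have ht0 : 0 < t n := by rw [lt_div_iff₀ ha] at h4; linarith
  refine ⟨ht0, fun u v θ hu hv => ⟨fun hθ => ?_, fun hθ => ?_⟩⟩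
  · rw [hθ, sub_zero] at hu
    have huv : |u - v| ≤ 2 * m * a n := (abs_sub u v).trans (by linarith)
    calc |f u (a n) - f v (a n)| ≤ L * |u - v| := hlip _ _ _
      _ ≤ L * (2 * m * a n) := by gcongr
      _ < t n := by linarith
  · have hu' : μ n - m * a n ≤ |u| := by
      have := abs_sub_abs_le_abs_sub θ u
      rw [abs_sub_comm] at this
      linarith
    have g1 := hgrow (a n) u ha (by linarith)
    have g2 := hup (a n) v ha
    have g3 : c * (μ n - m * a n) ≤ c * |u| := by gcongr
    have g4 : L * |v| ≤ L * (m * a n) := by gcongr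
    have g5 : (c * m + F₀ + L * m) * a n ≤ c / 2 * μ n := by
      calc (c * m + F₀ + L * m) * a n = c / 2 * (2 / c * (c * m + F₀ + L * m) * a n) := by
            field_simp
        _ ≤ _ := by gcongr
    linarith

/-- Markov for the counting measure: each exceptional feature contributes at least `m²` through one
of its two copies. -/
theorem card_filter_mul_sq_le {p : ℕ} (e : Fin p ⊕ Fin p → ℝ) {m : ℝ} (hm : 0 ≤ m) :
    ((Finset.univ.filter fun j => m < |e (Sum.inl j)| ∨ m < |e (Sum.inr j)|).card : ℝ) * m ^ 2 ≤
      ∑ k, e k ^ 2 := by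
  set E := Finset.univ.filter fun j => m < |e (Sum.inl j)| ∨ m < |e (Sum.inr j)| with hE
  have hsq : ∀ x : ℝ, m < |x| → m ^ 2 ≤ x ^ 2 := fun x hx => by
    rw [← sq_abs x]; gcongr
  calc (E.card : ℝ) * m ^ 2 = ∑ _j ∈ E, m ^ 2 := by rw [Finset.sum_const, nsmul_eq_mul]
    _ ≤ ∑ j ∈ E, (e (Sum.inl j) ^ 2 + e (Sum.inr j) ^ 2) := by
        refine Finset.sum_le_sum fun j hj => ?_
        have hj' : m < |e (Sum.inl j)| ∨ m < |e (Sum.inr j)| := by simpa [hE] using hj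
        rcases hj' with h | h
        · linarith [hsq _ h, sq_nonneg (e (Sum.inr j))]
        · linarith [hsq _ h, sq_nonneg (e (Sum.inl j))]
    _ ≤ ∑ j, (e (Sum.inl j) ^ 2 + e (Sum.inr j) ^ 2) :=
        Finset.sum_le_sum_of_subset_of_nonneg (Finset.subset_univ _) fun j _ _ => by positivity
    _ = ∑ k, e k ^ 2 := by rw [Fintype.sum_sum_type, Finset.sum_add_distrib]

/-! ### Limits in probability. -/

section Asymptotics

variable {C c₀ : ℝ} {f : ℝ → ℝ → ℝ} {μ t : ℕ → ℝ} {Ω : ℕ → Type*} [∀ n, MeasurableSpace (Ω n)]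
  {P : ∀ n, Measure (Ω n)} {T : ∀ n, Sample S n (Ω n)}

theorem eventually_measure_not_separates_le (hS : S.Standing) (hC : 0 < C) (hd : S.Debiasing C)
    (hf : IsFeatureFunction f) (hc₀ : 0 < c₀)
    (hlim : Tendsto (fun n => (S.s₀ n : ℝ) / (S.p n : ℝ)) atTop (𝓝 c₀)) (hμ0 : ∀ n, 0 < μ n)
    (hμθ : ∀ n j, S.θ₀ n j ≠ 0 → μ n ≤ |S.θ₀ n j|)
    (hμ : Tendsto (fun n => μ n / (S.σ * S.ρ n)) atTop atTop)
    (hT : ∀ n, (T n).IsModel C (P n))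
    (ht : Tendsto (fun n => t n / (S.σ * S.ρ n)) atTop atTop)
    (htμ : Tendsto (fun n => t n / μ n) atTop (𝓝 0)) {β ε : ℝ} (hβ : 0 < β) (hε : 0 < ε) :
    ∀ᶠ n in atTop, 0 < t n ∧
      P n {ω | ¬ Separates (S.θ₀ n) ((T n).W f ω) (t n) β} ≤ ENNReal.ofReal ε := by
  obtain ⟨K, hK, htight⟩ := hd.debiasedError_tight hS hC hc₀ hlim hT hε
  have hσ := hS.σ_pos
  -- Makes the tightness level `K p ρ²` equal to `β p (m σ ρ)²`, so at most `β p` features are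
  -- exceptional.
  set m := √(K / (β * S.σ ^ 2)) with hm
  have hm0 : 0 < m := Real.sqrt_pos.2 (by positivity)
  have hm2 : m ^ 2 = K / (β * S.σ ^ 2) := Real.sq_sqrt (by positivity)
  have ha : ∀ᶠ n in atTop, 0 < S.σ * S.ρ n := by
    filter_upwards [eventually_gt_atTop 0] with n hn
    exact mul_pos hσ (hS.ρ_pos hn)
  filter_upwards [htight, eventually_separated hf ha hμ0 hμ ht htμ m, ha, eventually_gt_atTop 0]
    with n hn ⟨ht0, hsep⟩ ha hn0
  have hρ := hS.ρ_pos hn0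
  refine ⟨ht0, (measure_mono fun ω hω => ?_).trans hn⟩
  by_contra hcon
  rw [Set.mem_ofPred_eq, not_lt] at hcon
  refine hω ⟨Finset.univ.filter fun j => m * (S.σ * S.ρ n) < |(T n).debiasedError ω (Sum.inl j)| ∨
    m * (S.σ * S.ρ n) < |(T n).debiasedError ω (Sum.inr j)|, ?_, fun j hj => ?_⟩
  · have h1 := (card_filter_mul_sq_le ((T n).debiasedError ω)
      (show 0 ≤ m * (S.σ * S.ρ n) by positivity)).trans hcon
    have h2 : K * (S.p n * S.ρ n ^ 2) = β * S.p n * (m * (S.σ * S.ρ n)) ^ 2 := by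
      rw [mul_pow, hm2]; field_simp
    rw [h2] at h1
    exact le_of_mul_le_mul_right h1 (by positivity)
  · simp only [Finset.mem_filter, Finset.mem_univ, true_and, not_or, not_lt] at hj
    have h := hsep _ _ (S.θ₀ n j) hj.1 (by simpa [Sample.debiasedError, Setting.θext] using hj.2)
    exact ⟨h.1, fun hne => h.2 (hμθ n j hne)⟩

theorem eventually_le_s₀ (hS : S.Standing) (hc₀ : 0 < c₀)
    (hlim : Tendsto (fun n => (S.s₀ n : ℝ) / (S.p n : ℝ)) atTop (𝓝 c₀)) :
    ∀ᶠ n in atTop, c₀ / 2 * S.p n ≤ (supp (S.θ₀ n)).card := by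
  filter_upwards [hS.eventually_p_le hc₀ hlim] with n hn
  calc c₀ / 2 * S.p n ≤ c₀ / 2 * (2 / c₀ * S.s₀ n) := by gcongr
    _ = (S.s₀ n : ℝ) := by field_simp

theorem tendstoInProb_fdp (hS : S.Standing) (hC : 0 < C) (hd : S.Debiasing C)
    (hf : IsFeatureFunction f) (hc₀ : 0 < c₀)
    (hlim : Tendsto (fun n => (S.s₀ n : ℝ) / (S.p n : ℝ)) atTop (𝓝 c₀)) (hμ0 : ∀ n, 0 < μ n)
    (hμθ : ∀ n j, S.θ₀ n j ≠ 0 → μ n ≤ |S.θ₀ n j|)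
    (hμ : Tendsto (fun n => μ n / (S.σ * S.ρ n)) atTop atTop)
    (hT : ∀ n, (T n).IsModel C (P n))
    (ht : Tendsto (fun n => t n / (S.σ * S.ρ n)) atTop atTop)
    (htμ : Tendsto (fun n => t n / μ n) atTop (𝓝 0)) :
    TendstoInProb P (fun n ω => FDP (S.θ₀ n) ((T n).W f ω) (t n : WithTop ℝ)) 0 := by
  refine tendstoInProb_of_forall_eventually fun η hη ε hε => ?_
  -- The bound on `β` is equivalent to `β / (c₀/2 - β) < η`, the FDP bound given by separation.
  obtain ⟨β, hβ, hβη⟩ : ∃ β : ℝ, 0 < β ∧ β < c₀ / 2 * (η / (1 + η)) :=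
    exists_between (by positivity)
  have h1 : η / (1 + η) < 1 := (div_lt_one (by positivity)).2 (by linarith)
  have hβc : β < c₀ / 2 := hβη.trans (mul_lt_of_lt_one_right (by positivity) h1)
  filter_upwards [eventually_measure_not_separates_le hS hC hd hf hc₀ hlim hμ0 hμθ hμ hT ht htμ
    hβ hε, eventually_le_s₀ hS hc₀ hlim] with n ⟨ht0, hn⟩ hs
  refine (measure_mono fun ω hω hsep => ?_).trans hn
  have h2 := hsep.fdp_le ht0 (hS.p_pos n) hβ.le hβc hs
  have h3 : β / (c₀ / 2 - β) < η := by
    rw [div_lt_iff₀ (sub_pos.2 hβc)]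
    rw [← mul_div_assoc, lt_div_iff₀ (by positivity)] at hβη
    linarith
  rw [Set.mem_ofPred_eq, sub_zero, abs_of_nonneg (fdp_nonneg _ _ _)] at hω
  linarith

theorem tendstoInProb_power (hS : S.Standing) (hC : 0 < C) (hd : S.Debiasing C)
    (hf : IsFeatureFunction f) (hc₀ : 0 < c₀)
    (hlim : Tendsto (fun n => (S.s₀ n : ℝ) / (S.p n : ℝ)) atTop (𝓝 c₀)) (hμ0 : ∀ n, 0 < μ n)
    (hμθ : ∀ n j, S.θ₀ n j ≠ 0 → μ n ≤ |S.θ₀ n j|)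
    (hμ : Tendsto (fun n => μ n / (S.σ * S.ρ n)) atTop atTop)
    (hT : ∀ n, (T n).IsModel C (P n))
    (ht : Tendsto (fun n => t n / (S.σ * S.ρ n)) atTop atTop)
    (htμ : Tendsto (fun n => t n / μ n) atTop (𝓝 0)) :
    TendstoInProb P (fun n ω => power (S.θ₀ n) ((T n).W f ω) (t n : WithTop ℝ)) 1 := by
  refine tendstoInProb_of_forall_eventually fun η hη ε hε => ?_
  obtain ⟨β, hβ, hβη⟩ : ∃ β : ℝ, 0 < β ∧ β < η * (c₀ / 2) := exists_between (by positivity)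
  filter_upwards [eventually_measure_not_separates_le hS hC hd hf hc₀ hlim hμ0 hμθ hμ hT ht htμ
    hβ hε, eventually_le_s₀ hS hc₀ hlim] with n ⟨ht0, hn⟩ hs
  refine (measure_mono fun ω hω hsep => ?_).trans hn
  have h2 := hsep.one_sub_le_power ht0 (hS.p_pos n) hβ.le (half_pos hc₀) hs
  have h3 : β / (c₀ / 2) < η := by rwa [div_lt_iff₀ (half_pos hc₀)]
  have h4 := power_le_one (θ₀ := S.θ₀ n) (W := (T n).W f ω) (t n)
  rw [Set.mem_ofPred_eq, abs_of_nonpos (by linarith)] at hω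
  linarith

theorem tendstoInProb_power_knockoffThreshold (hS : S.Standing) (hC : 0 < C) (hd : S.Debiasing C)
    (hf : IsFeatureFunction f) (hc₀ : 0 < c₀)
    (hlim : Tendsto (fun n => (S.s₀ n : ℝ) / (S.p n : ℝ)) atTop (𝓝 c₀)) (hμ0 : ∀ n, 0 < μ n)
    (hμθ : ∀ n j, S.θ₀ n j ≠ 0 → μ n ≤ |S.θ₀ n j|)
    (hμ : Tendsto (fun n => μ n / (S.σ * S.ρ n)) atTop atTop)
    (hT : ∀ n, (T n).IsModel C (P n)) {q : ℝ} (hq : 0 < q) :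
    TendstoInProb P (fun n ω => power (S.θ₀ n) ((T n).W f ω)
      (knockoffThreshold q ((T n).W f ω))) 1 := by
  have hσ := hS.σ_pos
  have ha : ∀ᶠ n in atTop, 0 < S.σ * S.ρ n := by
    filter_upwards [eventually_gt_atTop 0] with n hn
    exact mul_pos hσ (hS.ρ_pos hn)
  -- Geometric mean of `σ ρ` and `μ`, which is far from both scales.
  set t : ℕ → ℝ := fun n => S.σ * S.ρ n * √(μ n / (S.σ * S.ρ n)) with ht_def
  have hsqrt : Tendsto (fun n => √(μ n / (S.σ * S.ρ n))) atTop atTop :=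
    Real.tendsto_sqrt_atTop.comp hμ
  have ht : Tendsto (fun n => t n / (S.σ * S.ρ n)) atTop atTop := by
    refine hsqrt.congr' ?_
    filter_upwards [ha] with n ha
    rw [ht_def, mul_div_cancel_left₀ _ ha.ne']
  have htμ : Tendsto (fun n => t n / μ n) atTop (𝓝 0) := by
    refine (tendsto_inv_atTop_zero.comp hsqrt).congr' ?_
    filter_upwards [ha] with n ha
    have hx : 0 < μ n / (S.σ * S.ρ n) := div_pos (hμ0 n) ha
    have hs := Real.sq_sqrt hx.le
    have hs0 : 0 < √(μ n / (S.σ * S.ρ n)) := Real.sqrt_pos.2 hx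
    have hμe : μ n = √(μ n / (S.σ * S.ρ n)) ^ 2 * (S.σ * S.ρ n) := by
      rw [hs, div_mul_cancel₀ _ ha.ne']
    have hm := (hμ0 n).ne'
    simp only [Function.comp_apply, ht_def]
    rw [eq_div_iff hm]
    nth_rewrite 2 [hμe]
    field_simp
  refine tendstoInProb_of_forall_eventually fun η hη ε hε => ?_
  -- The first bound gives power at least `1 - η`. The second says `2β < q (c₀/2 - β)`, where one
  -- `β` pays for `1/p`, the added one in the estimated FDP.
  obtain ⟨β, hβ, hβ'⟩ : ∃ β : ℝ, 0 < β ∧ β < min (η * (c₀ / 2)) (c₀ / 2 * (q / (2 + q))) :=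
    exists_between (lt_min (by positivity) (by positivity))
  obtain ⟨hβη, hβq⟩ := lt_min_iff.1 hβ'
  have h1 : q / (2 + q) < 1 := (div_lt_one (by positivity)).2 (by linarith)
  have hβc : β < c₀ / 2 := hβq.trans (mul_lt_of_lt_one_right (by positivity) h1)
  have hp : Tendsto (fun n => 1 / (S.p n : ℝ)) atTop (𝓝 0) :=
    tendsto_one_div_atTop_nhds_zero_nat.comp hS.p_tendsto
  filter_upwards [eventually_measure_not_separates_le hS hC hd hf hc₀ hlim hμ0 hμθ hμ hT ht htμ
    hβ hε, eventually_le_s₀ hS hc₀ hlim, hp.eventually (gt_mem_nhds hβ)] with n ⟨ht0, hn⟩ hs hpβ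
  refine (measure_mono fun ω hω hsep => ?_).trans hn
  have h2 := hsep.one_sub_le_power ht0 (hS.p_pos n) hβ.le (half_pos hc₀) hs
  have h3 : β / (c₀ / 2) < η := by rwa [div_lt_iff₀ (half_pos hc₀)]
  have h4 := power_le_one (θ₀ := S.θ₀ n) (W := (T n).W f ω) (knockoffThreshold q ((T n).W f ω))
  have h5 : fdpHat ((T n).W f ω) (t n) ≤ q := by
    refine (hsep.fdpHat_le ht0 (hS.p_pos n) hβ.le hβc hs).trans ?_
    rw [div_le_iff₀ (sub_pos.2 hβc)]
    rw [← mul_div_assoc, lt_div_iff₀ (by positivity)] at hβq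
    linarith
  have h6 := power_mono (θ₀ := S.θ₀ n) (selected_subset_selected_knockoffThreshold ht0 h5)
  rw [Set.mem_ofPred_eq, abs_of_nonpos (by linarith)] at hω
  linarith

end Asymptotics

end JLKnockoff

end

/-! ### The main theorem. -/

theorem mainTheorem4 :
    ∃ C : ℝ, 0 < C ∧
      ∀ (S : JLKnockoff.Setting) (f : ℝ → ℝ → ℝ) (c₀ : ℝ) (μ : ℕ → ℝ)
        (Ω : ℕ → Type*) [∀ n, MeasurableSpace (Ω n)] (P : ∀ n, Measure (Ω n))
        [∀ n, IsProbabilityMeasure (P n)] (T : ∀ n, JLKnockoff.Sample S n (Ω n)),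
        S.Standing → S.Debiasing C → JLKnockoff.IsFeatureFunction f →
        0 < c₀ → c₀ < 1 →
        Tendsto (fun n => (S.s₀ n : ℝ) / (S.p n : ℝ)) atTop (𝓝 c₀) →
        (∀ n, 0 < μ n) →
        (∀ n j, S.θ₀ n j ≠ 0 → μ n ≤ |S.θ₀ n j|) →
        Tendsto (fun n => μ n / (S.σ * S.ρ n)) atTop atTop →
        (∀ n, (T n).IsModel C (P n)) →
        (∀ q : ℝ, 0 < q → q < 1 →
          (∀ n, 1 ≤ n →
            Integrable (fun ω => JLKnockoff.FDP (S.θ₀ n) ((T n).W f ω)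
              (JLKnockoff.knockoffThreshold q ((T n).W f ω))) (P n) ∧
            ∫ ω, JLKnockoff.FDP (S.θ₀ n) ((T n).W f ω)
              (JLKnockoff.knockoffThreshold q ((T n).W f ω)) ∂(P n) ≤ q) ∧
          JLKnockoff.TendstoInProb P (fun n ω => JLKnockoff.power (S.θ₀ n) ((T n).W f ω)
            (JLKnockoff.knockoffThreshold q ((T n).W f ω))) 1) ∧
        (∀ t : ℕ → ℝ,
          Tendsto (fun n => t n / (S.σ * S.ρ n)) atTop atTop →
          Tendsto (fun n => t n / μ n) atTop (𝓝 0) →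
          JLKnockoff.TendstoInProb P
            (fun n ω => JLKnockoff.FDP (S.θ₀ n) ((T n).W f ω) (t n : WithTop ℝ)) 0 ∧
          JLKnockoff.TendstoInProb P
            (fun n ω => JLKnockoff.power (S.θ₀ n) ((T n).W f ω) (t n : WithTop ℝ)) 1) := by
  -- Any positive constant would do: the argument needs only `lam > 0` and the presence of the same
  -- `lam` in `κ` and in the debiasing conditions.
  refine ⟨1, one_pos, ?_⟩
  intro S f c₀ μ Ω _ P _ T hS hd hf hc₀ _ hlim hμ0 hμθ hμ hT
  refine ⟨fun q hq _ => ⟨fun n hn => (hT n).fdr_control hS one_pos hn hf hq, ?_⟩,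
    fun t ht htμ => ⟨?_, ?_⟩⟩
  · exact JLKnockoff.tendstoInProb_power_knockoffThreshold hS one_pos hd hf hc₀ hlim hμ0 hμθ hμ hT
      hq
  · exact JLKnockoff.tendstoInProb_fdp hS one_pos hd hf hc₀ hlim hμ0 hμθ hμ hT ht htμ
  · exact JLKnockoff.tendstoInProb_power hS one_pos hd hf hc₀ hlim hμ0 hμθ hμ hT ht htμ
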